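/- Let $\pi\colon X\to S$ be a smooth morphism of schemes and let $E$ be a quasi-coherent $\mathscr O_X$-module. Let $W\subseteq X\times_S X$ be the largest open subscheme in which the diagonal is closed (so $W=X\times_SX$ if $\pi$ is separated), let $\Delta\colon X\to W$ be the diagonal, $\mathscr I\subseteq\mathscr O_W$ its ideal sheaf, $p,q\colon W\to X$ the two projections, and $\Delta_k\subseteq W$ the closed subscheme defined by $\mathscr I^{k+1}$, $k\ge 0$. Put $\Omega^1_\pi=\Delta^*(\mathscr I/\mathscr I^2)$ and $$P^k_\pi(E)=p_*\bigl(q^*E\otimes\mathscr O_{\Delta_k}\bigr).$$ Then for every $k\ge 1$ there is a right exact sequence of $\mathscr O_X$-modules $$E\otimes \operatorname{Sym}^k\Omega^1_\pi\xrightarrow{\ \varphi\ } P^k_\pi(E)\to P^{k-1}_\pi(E)\to 0,$$ in which the second map is induced by the restriction $\mathscr O_{\Delta_k}\to\mathscr O_{\Delta_{k-1}}$ and $\varphi$ is the canonical map: for $U\subseteq X$ open, $e\in E(U)$ and $t_1,\dots,t_k\in\mathscr I(p^{-1}U\cap q^{-1}U)$ it sends $e\otimes \Delta^*[t_1]\cdots\Delta^*[t_k]$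 to the section whose restriction to $p^{-1}U\cap q^{-1}U$ is $q^*e\otimes t_1\cdots t_k$. If $E$ is locally free, then these sequences are also exact on the left (that is, $\varphi$ is injective), and $P^k_\pi(E)$ is locally free for every $k\ge 0$, and is locally free of finite rank if $E$ is. -/

import Mathlib

open CategoryTheory Limits AlgebraicGeometry Opposite
open scoped TensorProduct
universe u
namespace PrincipalParts

section SymPower

variable {R R' : Type*} [CommRing R] [CommRing R'] {M M' : Type*} [AddCommGroup M]
  [AddCommGroup M'] [Module R M] [Module R' M'] {σ : R →+* R'}

/-- `Sym^k_R(M)`: the submodule of the symmetric algebra spanned by the products of `k` elements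
of `M`. -/
def symPower (R M : Type*) [CommRing R] [AddCommGroup M] [Module R M] (k : ℕ) :
    Submodule R (SymmetricAlgebra R M) :=
  Submodule.span R (Set.range fun m : Fin k → M => ∏ i, SymmetricAlgebra.ι R M (m i))

/-- The product `m₁ ⋯ mₖ` in `Sym^k_R(M)`. -/
def symProd (R : Type*) {M : Type*} [CommRing R] [AddCommGroup M] [Module R M] {k : ℕ}
    (m : Fin k → M) : symPower R M k :=
  ⟨∏ i, SymmetricAlgebra.ι R M (m i), Submodule.subset_span ⟨m, rfl⟩⟩

/-- The ring homomorphism `Sym_R(M) → Sym_{R'}(M')` induced by a semilinear map `M → M'`. -/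
noncomputable def symMap (f : M →ₛₗ[σ] M') : SymmetricAlgebra R M →+* SymmetricAlgebra R' M' :=
  letI : Algebra R (SymmetricAlgebra R' M') :=
    ((algebraMap R' (SymmetricAlgebra R' M')).comp σ).toAlgebra
  (SymmetricAlgebra.lift (R := R) (M := M) (A := SymmetricAlgebra R' M')
    { toFun := fun m => SymmetricAlgebra.ι R' M' (f m)
      map_add' := by simp
      map_smul' := fun r m => by
        rw [map_smulₛₗ, map_smul, Algebra.smul_def, RingHom.id_apply, Algebra.smul_def]
        rfl } ).toRingHom

lemma symMap_ι (f : M →ₛₗ[σ] M') (m : M) :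
    symMap f (SymmetricAlgebra.ι R M m) = SymmetricAlgebra.ι R' M' (f m) := by
  let _ : Algebra R (SymmetricAlgebra R' M') :=
    ((algebraMap R' (SymmetricAlgebra R' M')).comp σ).toAlgebra
  exact SymmetricAlgebra.lift_ι_apply _ m

lemma symMap_algebraMap (f : M →ₛₗ[σ] M') (r : R) :
    symMap f (algebraMap R _ r) = algebraMap R' _ (σ r) := by
  let _ : Algebra R (SymmetricAlgebra R' M') :=
    ((algebraMap R' (SymmetricAlgebra R' M')).comp σ).toAlgebra
  exact (SymmetricAlgebra.lift _).commutes r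

/-- `symMap f` as a semilinear map. -/
noncomputable def symMapₛₗ (f : M →ₛₗ[σ] M') :
    SymmetricAlgebra R M →ₛₗ[σ] SymmetricAlgebra R' M' where
  toFun := symMap f
  map_add' := map_add _
  map_smul' r x := by rw [Algebra.smul_def, map_mul, symMap_algebraMap, Algebra.smul_def]

lemma symMap_mem (f : M →ₛₗ[σ] M') (k : ℕ) {x : SymmetricAlgebra R M}
    (hx : x ∈ symPower R M k) : symMap f x ∈ symPower R' M' k := by
  have h : symPower R M k ≤ (symPower R' M' k).comap (symMapₛₗ f) := by
    rw [symPower, Submodule.span_le]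
    rintro _ ⟨m, rfl⟩
    refine Submodule.subset_span ⟨fun i => f (m i), ?_⟩
    change _ = symMap f _
    simp only [map_prod, symMap_ι]
  exact h hx

lemma symMap_symMap {R'' M'' : Type*} [CommRing R''] [AddCommGroup M''] [Module R'' M'']
    {τ : R' →+* R''} {ρ : R →+* R''} (f : M →ₛₗ[σ] M') (g : M' →ₛₗ[τ] M'') (h : M →ₛₗ[ρ] M'')
    (hρ : ∀ r, ρ r = τ (σ r)) (hh : ∀ m, h m = g (f m)) (x : SymmetricAlgebra R M) :
    symMap h x = symMap g (symMap f x) := by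
  induction x using SymmetricAlgebra.induction with
  | algebraMap r => simp only [symMap_algebraMap, hρ]
  | ι m => simp only [symMap_ι, hh]
  | mul a b ha hb => simp only [map_mul, ha, hb]
  | add a b ha hb => simp only [map_add, ha, hb]

lemma symMap_id {ρ : R →+* R} (h : M →ₛₗ[ρ] M) (hρ : ∀ r, ρ r = r) (hh : ∀ m, h m = m)
    (x : SymmetricAlgebra R M) : symMap h x = x := by
  induction x using SymmetricAlgebra.induction with
  | algebraMap r => simp only [symMap_algebraMap, hρ]
  | ι m => simp only [symMap_ι, hh]
  | mul a b ha hb => simp only [map_mul, ha, hb]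
  | add a b ha hb => simp only [map_add, ha, hb]

/-- The semilinear map `Sym^k_R(M) → Sym^k_{R'}(M')` induced by a semilinear map `M → M'`. -/
noncomputable def symPowerMap (f : M →ₛₗ[σ] M') (k : ℕ) :
    symPower R M k →ₛₗ[σ] symPower R' M' k :=
  (symMapₛₗ f).restrict (fun _ hx => symMap_mem f k hx)

end SymPower

section Presheaf

universe v w
variable {C : Type v} [Category.{w} C] {R : Cᵒᵖ ⥤ CommRingCat.{u}}

variable (M : PresheafOfModules.{u} (R ⋙ forget₂ _ RingCat)) (k : ℕ)

/-- The module `Sym^k_{R(U)}(M(U))`. -/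
noncomputable def symPreObj (U : Cᵒᵖ) : ModuleCat.{u} ((R ⋙ forget₂ _ RingCat).obj U) :=
  ModuleCat.of (R.obj U) (symPower (R.obj U) (M.obj U) k)

/-- The restriction map `Sym^k_{R(U)}(M(U)) → Sym^k_{R(V)}(M(V))`. -/
noncomputable def symPreMap {U V : Cᵒᵖ} (f : U ⟶ V) :
    symPreObj M k U ⟶
      (ModuleCat.restrictScalars ((R ⋙ forget₂ _ RingCat).map f).hom).obj (symPreObj M k V) :=
  (ModuleCat.semilinearMapAddEquiv ((R ⋙ forget₂ _ RingCat).map f).hom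
    (symPreObj M k U) (symPreObj M k V))
    (symPowerMap (σ := (R.map f).hom) (M.restrictₛₗ f) k)

lemma symPreMap_apply {U V : Cᵒᵖ} (f : U ⟶ V) (x : symPower (R.obj U) (M.obj U) k) :
    (symPreMap M k f).hom x = symPowerMap (σ := (R.map f).hom) (M.restrictₛₗ f) k x := rfl

lemma symPowerMap_id (U : Cᵒᵖ) (x : symPower (R.obj U) (M.obj U) k) :
    symPowerMap (σ := (R.map (𝟙 U)).hom) (M.restrictₛₗ (𝟙 U)) k x = x := by
  refine Subtype.ext (symMap_id _ (fun r => ?_) (fun m => ?_) _)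
  · simp
  · change M.map (𝟙 U) m = m
    simp
    rfl

lemma symPowerMap_comp {U V W : Cᵒᵖ} (f : U ⟶ V) (g : V ⟶ W)
    (x : symPower (R.obj U) (M.obj U) k) :
    symPowerMap (σ := (R.map (f ≫ g)).hom) (M.restrictₛₗ (f ≫ g)) k x =
      symPowerMap (σ := (R.map g).hom) (M.restrictₛₗ g) k
        (symPowerMap (σ := (R.map f).hom) (M.restrictₛₗ f) k x) := by
  refine Subtype.ext (symMap_symMap _ _ _ (fun r => ?_) (fun m => ?_) _)
  · simp
  · change M.map (f ≫ g) m = M.map g (M.map f m)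
    simp
    rfl

lemma symPreMap_id (U : Cᵒᵖ) :
    symPreMap M k (𝟙 U) =
      (ModuleCat.restrictScalarsId' ((R ⋙ forget₂ _ RingCat).map (𝟙 U)).hom
        (congrArg RingCat.Hom.hom ((R ⋙ forget₂ _ RingCat).map_id U))).inv.app _ := by
  ext x
  exact symPowerMap_id M k U x

lemma symPreMap_comp {U V W : Cᵒᵖ} (f : U ⟶ V) (g : V ⟶ W) :
    symPreMap M k (f ≫ g) = symPreMap M k f ≫
      (ModuleCat.restrictScalars _).map (symPreMap M k g) ≫
      (ModuleCat.restrictScalarsComp' ((R ⋙ forget₂ _ RingCat).map f).hom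
        ((R ⋙ forget₂ _ RingCat).map g).hom ((R ⋙ forget₂ _ RingCat).map (f ≫ g)).hom
        (congrArg RingCat.Hom.hom ((R ⋙ forget₂ _ RingCat).map_comp f g))).inv.app _ := by
  ext x
  exact symPowerMap_comp M k f g x

/-- The presheaf of modules `U ↦ Sym^k_{R(U)}(M(U))`. -/
noncomputable def symPre : PresheafOfModules.{u} (R ⋙ forget₂ _ RingCat) where
  obj U := symPreObj M k U
  map f := symPreMap M k f
  map_id U := symPreMap_id M k U
  map_comp f g := symPreMap_comp M k f g

end Presheaf

noncomputable section

section Modules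

variable {X Y : Scheme.{u}}

/-- The structure sheaf `𝒪_X` as a module over itself. -/
def structureModule (X : Scheme.{u}) : X.Modules := SheafOfModules.unit X.ringCatSheaf

/-- The sheaf of `𝒪_X`-modules associated to a presheaf of `𝒪_X`-modules. -/
def sheafify : X.PresheafOfModules ⥤ X.Modules :=
  PresheafOfModules.sheafification (𝟙 X.ringCatSheaf.obj)

/-- The section of the associated sheaf defined by a section of a presheaf. -/
def sheafifySection (P : X.PresheafOfModules) (U : X.Opens) (s : P.obj (op U)) :
    Γ(sheafify.obj P, U) :=
  ((PresheafOfModules.sheafificationAdjunction (𝟙 X.ringCatSheaf.obj)).unit.app P).app (op U) s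

/-- The presheaf `U ↦ M(U) ⊗_{𝒪_X(U)} N(U)`. -/
def tensorPre (M N : X.Modules) : X.PresheafOfModules :=
  PresheafOfModules.Monoidal.tensorObj (R := X.presheaf) M.val N.val

/-- The tensor product `M ⊗ N` of `𝒪_X`-modules. -/
def tensor (M N : X.Modules) : X.Modules := sheafify.obj (tensorPre M N)

/-- The section `m ⊗ n` of `M ⊗ N`. -/
def tmul {M N : X.Modules} {U : X.Opens} (m : Γ(M, U)) (n : Γ(N, U)) : Γ(tensor M N, U) :=
  sheafifySection (tensorPre M N) U (m ⊗ₜ[Γ(X, U)] n)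

/-- The morphism `M ⊗ N ⟶ M ⊗ N'` induced by `g : N ⟶ N'`. -/
def tensorMap (M : X.Modules) {N N' : X.Modules} (g : N ⟶ N') : tensor M N ⟶ tensor M N' :=
  sheafify.map (PresheafOfModules.Monoidal.tensorHom (R := X.presheaf) (𝟙 M.val) g.val)

/-- The presheaf `U ↦ Sym^k_{𝒪_X(U)}(M(U))`. -/
def symPowPre (M : X.Modules) (k : ℕ) : X.PresheafOfModules := symPre (R := X.presheaf) M.val k

/-- The `k`-th symmetric power of an `𝒪_X`-module. -/
def symPow (M : X.Modules) (k : ℕ) : X.Modules := sheafify.obj (symPowPre M k)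

/-- The section `m₁ ⋯ mₖ` of `Sym^k M`. -/
def symMul {M : X.Modules} {U : X.Opens} {k : ℕ} (m : Fin k → Γ(M, U)) : Γ(symPow M k, U) :=
  sheafifySection (symPowPre M k) U (symProd Γ(X, U) m)

/-- Restriction of sections. -/
def res {M : X.Modules} {U V : X.Opens} (h : V ≤ U) (m : Γ(M, U)) : Γ(M, V) :=
  M.presheaf.map (homOfLE h).op m

/-- The section `f^* m` of the inverse image `f^* M`. -/
def pullbackSection (f : X ⟶ Y) {M : Y.Modules} {U : Y.Opens} (m : Γ(M, U)) :
    Γ((Scheme.Modules.pullback f).obj M, f ⁻¹ᵁ U) :=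
  ((Scheme.Modules.pullbackPushforwardAdjunction f).unit.app M).app U m

/-- The morphism `𝒪_Y ⟶ f_* 𝒪_X`. -/
def toPushforward (f : X ⟶ Y) :
    structureModule Y ⟶ (Scheme.Modules.pushforward f).obj (structureModule X) :=
  SheafOfModules.unitToPushforwardObjUnit f.toRingCatSheafHom

end Modules

section Ideals

variable {Y : Scheme.{u}}

/-- `𝒪_Z`, as an `𝒪_Y`-module, for the closed subscheme `Z ⊆ Y` defined by `J`. -/
def quotientModule (J : Y.IdealSheafData) : Y.Modules :=
  (Scheme.Modules.pushforward J.subschemeι).obj (structureModule J.subscheme)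

/-- The restriction of functions `𝒪_Y ⟶ 𝒪_Z`. -/
def toQuotient (J : Y.IdealSheafData) : structureModule Y ⟶ quotientModule J :=
  toPushforward J.subschemeι

/-- The restriction of functions `𝒪_Z ⟶ 𝒪_{Z'}` for closed subschemes `Z' ⊆ Z` of `Y`. -/
def quotientMap {J J' : Y.IdealSheafData} (h : J ≤ J') : quotientModule J ⟶ quotientModule J' :=
  (Scheme.Modules.pushforward J.subschemeι).map
      (toPushforward (Scheme.IdealSheafData.inclusion h)) ≫
    (Scheme.Modules.pushforwardComp (Scheme.IdealSheafData.inclusion h) J.subschemeι).hom.app _ ≫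
    (Scheme.Modules.pushforwardCongr (Scheme.IdealSheafData.inclusion_subschemeι h)).hom.app _

lemma toQuotient_quotientMap {J J' : Y.IdealSheafData} (h : J ≤ J') :
    toQuotient J ≫ quotientMap h = toQuotient J' := by
  ext U (x : Γ(Y, U))
  have h1 := Scheme.Hom.congr_app (Scheme.IdealSheafData.inclusion_subschemeι h).symm U
  rw [Scheme.Hom.comp_app] at h1
  exact (congr($h1 x)).symm

/-- The ideal of functions vanishing on `Z`, as an `𝒪_Y`-module. -/
def idealModule (J : Y.IdealSheafData) : Y.Modules := kernel (toQuotient J)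

/-- A section of the ideal, regarded as a function. -/
def idealSection {J : Y.IdealSheafData} {V : Y.Opens} (t : Γ(idealModule J, V)) : Γ(Y, V) :=
  (kernel.ι (toQuotient J)).app V t

/-- The inclusion of ideals. -/
def idealMap {J J' : Y.IdealSheafData} (h : J ≤ J') : idealModule J ⟶ idealModule J' :=
  kernel.map _ _ (𝟙 _) (quotientMap h) (by rw [toQuotient_quotientMap, Category.id_comp])

lemma pow_succ_le (J : Y.IdealSheafData) (k : ℕ) : J ^ (k + 1) ≤ J ^ k := by
  intro U
  exact Ideal.pow_le_pow_right (I := J.ideal U) (Nat.le_succ k)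

lemma sq_le (J : Y.IdealSheafData) : J ^ 2 ≤ J := by
  intro U
  exact Ideal.pow_le_self (I := J.ideal U) two_ne_zero

/-- The conormal module `J / J²`. -/
def conormal (J : Y.IdealSheafData) : Y.Modules := cokernel (idealMap (sq_le J))

/-- The class in `J / J²` of a section of `J`. -/
def conormalSection {J : Y.IdealSheafData} {V : Y.Opens} (t : Γ(idealModule J, V)) :
    Γ(conormal J, V) :=
  (cokernel.π (idealMap (sq_le J))).app V t

end Ideals
section PrincipalParts

variable {X S : Scheme.{u}} (π : X ⟶ S)

/-- The largest open `W ⊆ X ×_S X` in which (the image of) the diagonal is closed.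
It is all of `X ×_S X` when `π` is separated. -/
def diagNhd : (pullback π π).Opens := (pullback.diagonal π).coborderRange

/-- The diagonal `Δ : X ⟶ W`, a closed immersion. -/
def diag : X ⟶ diagNhd π := (pullback.diagonal π).liftCoborder

/-- The first projection `p : W ⟶ X`. -/
def proj₁ : (diagNhd π : Scheme.{u}) ⟶ X := (diagNhd π).ι ≫ pullback.fst π π

/-- The second projection `q : W ⟶ X`. -/
def proj₂ : (diagNhd π : Scheme.{u}) ⟶ X := (diagNhd π).ι ≫ pullback.snd π π

/-- The ideal sheaf `I` of the diagonal. -/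
def diagIdeal : (diagNhd π : Scheme.{u}).IdealSheafData := (diag π).ker

/-- The sheaf of relative differentials `Ω¹_π = Δ^*(I / I²)`. -/
def relDifferentials : X.Modules :=
  (Scheme.Modules.pullback (diag π)).obj (conormal (diagIdeal π))

/-- `q^*E ⊗ 𝒪_{Δ_k}`, where `Δ_k ⊆ W` is the closed subscheme defined by `I^{k+1}`. -/
def preParts (k : ℕ) (E : X.Modules) : (diagNhd π : Scheme.{u}).Modules :=
  tensor ((Scheme.Modules.pullback (proj₂ π)).obj E) (quotientModule (diagIdeal π ^ (k + 1)))

/-- The sheaf of principal parts `P^k_π(E) = p_*(q^*E ⊗ 𝒪_{Δ_k})`. -/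
def principalParts (k : ℕ) (E : X.Modules) : X.Modules :=
  (Scheme.Modules.pushforward (proj₁ π)).obj (preParts π k E)

/-- The map `P^{k+1}_π(E) ⟶ P^k_π(E)` induced by the restriction `𝒪_{Δ_{k+1}} ⟶ 𝒪_{Δ_k}`. -/
def truncation (k : ℕ) (E : X.Modules) : principalParts π (k + 1) E ⟶ principalParts π k E :=
  (Scheme.Modules.pushforward (proj₁ π)).map (tensorMap _ (quotientMap (pow_succ_le _ (k + 1))))

/-- The neighborhood `p⁻¹U ∩ q⁻¹U` of `Δ(U)` in `W`. -/
def nhd (U : X.Opens) : (diagNhd π : Scheme.{u}).Opens := (proj₁ π ⁻¹ᵁ U) ⊓ (proj₂ π ⁻¹ᵁ U)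

lemma diag_proj₁ : diag π ≫ proj₁ π = 𝟙 X := by simp [diag, proj₁, diagNhd]

lemma diag_proj₂ : diag π ≫ proj₂ π = 𝟙 X := by simp [diag, proj₂, diagNhd]

lemma le_diag_preimage_nhd (U : X.Opens) : U ≤ diag π ⁻¹ᵁ nhd π U := by
  have h1 : diag π ⁻¹ᵁ proj₁ π ⁻¹ᵁ U = U := by
    rw [← Scheme.Hom.comp_preimage, diag_proj₁]; rfl
  have h2 : diag π ⁻¹ᵁ proj₂ π ⁻¹ᵁ U = U := by
    rw [← Scheme.Hom.comp_preimage, diag_proj₂]; rfl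
  intro x hx
  exact ⟨h1.ge hx, h2.ge hx⟩

variable {π} in
/-- The differential form `Δ^*[t]` on `U` defined by a function `t` on `p⁻¹U ∩ q⁻¹U` that vanishes
on the diagonal; for `t = q^♯ a - p^♯ a` this is `da`. -/
def formOf {U : X.Opens} (t : Γ(idealModule (diagIdeal π), nhd π U)) : Γ(relDifferentials π, U) :=
  res (le_diag_preimage_nhd π U) (pullbackSection (diag π) (conormalSection t))

/-- `φ : E ⊗ Sym^k Ω¹_π ⟶ P^k_π(E)` is the canonical map: it sends
`e ⊗ Δ^*[t₁] ⋯ Δ^*[tₖ]` to the section of `q^*E ⊗ 𝒪_{Δ_k}` over `p⁻¹U` which on the neighborhood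
`p⁻¹U ∩ q⁻¹U` of `Δ(U)` is `q^*e ⊗ t₁ ⋯ tₖ`. -/
def IsCanonical {k : ℕ} {E : X.Modules}
    (φ : tensor E (symPow (relDifferentials π) k) ⟶ principalParts π k E) : Prop :=
  ∀ (U : X.Opens) (e : Γ(E, U)) (t : Fin k → Γ(idealModule (diagIdeal π), nhd π U)),
    res (M := preParts π k E) (U := proj₁ π ⁻¹ᵁ U) (V := nhd π U) inf_le_left
      (φ.app U (tmul e (symMul fun i => formOf (t i)))) =
    tmul (res inf_le_right (pullbackSection (proj₂ π) e))
      ((toQuotient (diagIdeal π ^ (k + 1))).app (nhd π U)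
        (∏ i, idealSection (t i) : Γ(diagNhd π, nhd π U)))

end PrincipalParts

end

end PrincipalParts

/-!
Write `Δ_k` for the `k`-th infinitesimal neighborhood of the diagonal. All sheaves involved are
quasi-coherent, so the assertions reduce to modules over rings, as follows.

Call an open set `U ⊆ X` *small* if it is affine and lies over an affine open set of `S`
(`IsSmall`); the small open sets form a basis. For such `U` the open set `p⁻¹U ∩ q⁻¹U` is
`U ×_V U` for an affine open `V ⊆ S`; it is therefore affine and contained in `W`. Let `B` and `C`
be the rings of functions on `U` and on `p⁻¹U ∩ q⁻¹U`. Then `C` is smooth over `B` by means of `p`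
and by means of `q`, both structures are split by the restriction `δ : C → B` to the diagonal, and
the ideal of the diagonal is `I = ker δ`.

To pass from sheaves to modules, `IsQCAt P U` says that the restriction maps of the presheaf of
modules `P` from `U` to the sets `D(f)` are localizations. Then `P(U)` is also the module of
sections of the associated sheaf (`IsQCAt.secUnit_bijective`). The property passes to tensor
products, symmetric powers, kernels, cokernels and inverse images, and the sections of an inverse
image are obtained by base change (`pullback_isQCAt_and_isSemilinearBaseChange`). With
`N = C ⊗_B E(U)`, formed along `q`, the sections over `U` of `Ω^1_π` are `I/I²`
(`formSec_surjective`, `formSec_eq_zero_iff`). Since `q^*E ⊗ 𝒪_{Δ_k}` is supported on the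
diagonal, its sections over `p⁻¹U` and over `p⁻¹U ∩ q⁻¹U` are the same (`partsRes_bijective`), and
`P^k_π(E)(U)` is `N/I^(k+1)N` (`toParts_surjective_and_ker`), a `B`-module by means of `p`.

The algebra is in `exists_localCanonicalMap`. Multiplication gives a surjection `E(U) ⊗ Sym^k(I/I²)
→ I^k N/I^(k+1) N`. By formal smoothness the map `C → C/I² = B ⊕ I/I²` lifts to `C →
Sym(I/I²)/(I/I²)^(k+1)`, and the component of degree `k` of the lift provides a left inverse. The
two projections define the same `B`-module structure on `I^k N/I^(k+1) N`, because their difference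
takes values in `I`, which kills this module (`exists_canonicalMap_of_two_sections`). The maps over
the small open sets are determined by their values on products of differential forms, hence they are
compatible and glue to the canonical map (`exists_canonicalMap`). Exactness is then read off from
the sections over small open sets (`exact_of_basis`, `epi_of_basis`, `mono_of_basis`).

If `E(U)` is free on a set `J`, then `P^k_π(E)(U)` is a direct sum of copies of `C/I^(k+1)` indexed
by `J`. The module `C/I^(k+1)` is finitely generated projective over `B`, as an iterated extension
of the modules `Sym^i(I/I²)` (`projective_quotient_pow`), so it becomes free on a neighborhood of
each point (`exists_free_principalParts`). Finally, `isLocallyFree_of_cover` and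
`exists_mem_forall_free` translate between locally free sheaves and free modules of sections.
-/

namespace PrincipalParts

/-! ### The grading of the symmetric algebra -/

section SymPowerGrading

variable (R M : Type*) [CommRing R] [AddCommGroup M] [Module R M]

lemma symPower_eq_pow (k : ℕ) :
    symPower R M k = LinearMap.range (SymmetricAlgebra.ι R M) ^ k := by
  conv_rhs => rw [← Submodule.span_eq (LinearMap.range (SymmetricAlgebra.ι R M))]
  rw [Submodule.span_pow, symPower]
  congr 1
  ext x
  simp only [Set.mem_range, Set.mem_pow, List.prod_ofFn]
  constructor
  · rintro ⟨m, rfl⟩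
    exact ⟨fun i => ⟨_, m i, rfl⟩, rfl⟩
  · rintro ⟨f, rfl⟩
    choose m hm using fun i => (f i).2
    exact ⟨m, by simp [hm]⟩

/-- The grading of `Sym_R(M)`, as the coaction `Sym_R(M) → Sym_R(M)[T]`, `m ↦ m T`. -/
noncomputable def symCoaction :
    SymmetricAlgebra R M →ₐ[R] Polynomial (SymmetricAlgebra R M) :=
  SymmetricAlgebra.lift
    (((Polynomial.monomial (R := SymmetricAlgebra R M) 1).restrictScalars R) ∘ₗ
      SymmetricAlgebra.ι R M)

lemma symCoaction_ι (m : M) : symCoaction R M (SymmetricAlgebra.ι R M m) =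
    Polynomial.monomial 1 (SymmetricAlgebra.ι R M m) :=
  SymmetricAlgebra.lift_ι_apply _ m

lemma symCoaction_coeff_mem (x : SymmetricAlgebra R M) (k : ℕ) :
    (symCoaction R M x).coeff k ∈ symPower R M k := by
  induction x using SymmetricAlgebra.induction generalizing k with
  | algebraMap r =>
    rw [AlgHom.commutes, Polynomial.algebraMap_apply, Polynomial.coeff_C]
    split_ifs with h
    · subst h
      rw [symPower_eq_pow, pow_zero]
      exact Submodule.algebraMap_mem r
    · exact zero_mem _
  | ι m =>
    rw [symCoaction_ι, Polynomial.coeff_monomial]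
    split_ifs with h
    · subst h
      rw [symPower_eq_pow, pow_one]
      exact ⟨m, rfl⟩
    · exact zero_mem _
  | mul a b ha hb =>
    rw [map_mul, Polynomial.coeff_mul]
    refine sum_mem fun p hp => ?_
    rw [← Finset.HasAntidiagonal.mem_antidiagonal.mp hp, symPower_eq_pow, pow_add]
    refine Submodule.mul_mem_mul ?_ ?_
    · rw [← symPower_eq_pow]; exact ha _
    · rw [← symPower_eq_pow]; exact hb _
  | add a b ha hb =>
    rw [map_add, Polynomial.coeff_add]
    exact add_mem (ha k) (hb k)

/-- The projection of `Sym_R(M)` onto its component of degree `k`. -/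
noncomputable def symProj (k : ℕ) : SymmetricAlgebra R M →ₗ[R] symPower R M k :=
  (((Polynomial.lcoeff (SymmetricAlgebra R M) k).restrictScalars R) ∘ₗ
    (symCoaction R M).toLinearMap).codRestrict _ fun x => symCoaction_coeff_mem R M x k

variable {R M}

lemma span_range_symProd (k : ℕ) :
    Submodule.span R (Set.range fun m : Fin k → M => symProd R m) = ⊤ := by
  apply Submodule.map_injective_of_injective (symPower R M k).subtype_injective
  rw [Submodule.map_span, Submodule.map_top, Submodule.range_subtype, ← Set.range_comp]
  rfl

/-- The coaction multiplies a product of `k` elements of `M` by `T^k`. -/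
lemma symProj_coe {k : ℕ} (x : symPower R M k) : symProj R M k x = x := by
  have h : symProj R M k ∘ₗ (symPower R M k).subtype = LinearMap.id := by
    refine LinearMap.ext_on_range (v := fun m : Fin k → M => symProd R m) ?_ ?_
    · exact span_range_symProd k
    · intro m
      ext
      change (symCoaction R M (∏ i, SymmetricAlgebra.ι R M (m i))).coeff k = _
      rw [map_prod]
      simp only [symCoaction_ι]
      have (s : Finset (Fin k)) : ∏ i ∈ s, Polynomial.monomial 1 (SymmetricAlgebra.ι R M (m i)) =
          Polynomial.monomial s.card (∏ i ∈ s, SymmetricAlgebra.ι R M (m i)) := by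
        induction s using Finset.induction_on with
        | empty => simp
        | insert a s ha ih =>
          rw [Finset.prod_insert ha, ih, Polynomial.monomial_mul_monomial, Finset.prod_insert ha,
            Finset.card_insert_of_notMem ha, add_comm]
      rw [this]
      simp [symProd]
  exact LinearMap.congr_fun h x

variable (R M) in
/-- The augmentation ideal of `Sym_R(M)`, generated by `M`. -/
noncomputable def symIdeal : Ideal (SymmetricAlgebra R M) :=
  Ideal.span (Set.range (SymmetricAlgebra.ι R M))

lemma ι_mem_symIdeal (m : M) : SymmetricAlgebra.ι R M m ∈ symIdeal R M :=
  Ideal.subset_span ⟨m, rfl⟩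

/-- The coaction sends the augmentation ideal into the ideal generated by `T`. -/
lemma symProj_eq_zero {k : ℕ} {x : SymmetricAlgebra R M} (hx : x ∈ symIdeal R M ^ (k + 1)) :
    symProj R M k x = 0 := by
  have h1 : symIdeal R M ≤ (Ideal.span {Polynomial.X}).comap (symCoaction R M) := by
    rw [symIdeal, Ideal.span_le]
    rintro _ ⟨m, rfl⟩
    rw [SetLike.mem_coe, Ideal.mem_comap, symCoaction_ι, ← Polynomial.C_mul_X_eq_monomial]
    exact Ideal.mul_mem_left _ _ (Ideal.mem_span_singleton_self _)
  have h2 : symCoaction R M x ∈ Ideal.span {Polynomial.X ^ (k + 1)} := by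
    rw [← Ideal.span_singleton_pow]
    exact (Ideal.pow_right_mono h1 _).trans (Ideal.le_comap_pow _ _) hx
  ext
  rw [Ideal.mem_span_singleton, Polynomial.X_pow_dvd_iff] at h2
  exact h2 k (Nat.lt_succ_self k)

/-- A splitting of the surjection from a free module to `M` induces a splitting of the surjection
from a polynomial algebra to `Sym_R(M)`. -/
instance projective_symmetricAlgebra [Module.Projective R M] :
    Module.Projective R (SymmetricAlgebra R M) := by
  obtain ⟨s, hs⟩ := Module.projective_def.mp ‹Module.Projective R M›
  let b : Module.Basis M R (M →₀ R) := Finsupp.basisSingleOne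
  have : Module.Free R (SymmetricAlgebra R (M →₀ R)) := .of_basis b.symmetricAlgebra
  refine Module.Projective.of_split
    (SymmetricAlgebra.lift (SymmetricAlgebra.ι R _ ∘ₗ s)).toLinearMap
    (SymmetricAlgebra.lift
      (SymmetricAlgebra.ι R _ ∘ₗ Finsupp.linearCombination R id)).toLinearMap ?_
  have : (SymmetricAlgebra.lift (SymmetricAlgebra.ι R _ ∘ₗ Finsupp.linearCombination R id)).comp
      (SymmetricAlgebra.lift (SymmetricAlgebra.ι R _ ∘ₗ s)) = AlgHom.id R _ := by
    refine SymmetricAlgebra.algHom_ext (LinearMap.ext fun m => ?_)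
    change SymmetricAlgebra.lift _ (SymmetricAlgebra.lift _ (SymmetricAlgebra.ι R M m)) = _
    rw [SymmetricAlgebra.lift_ι_apply, LinearMap.comp_apply, SymmetricAlgebra.lift_ι_apply]
    exact congrArg (SymmetricAlgebra.ι R M) (hs m)
  exact congr(($this).toLinearMap)

instance projective_symPower [Module.Projective R M] (k : ℕ) :
    Module.Projective R (symPower R M k) :=
  Module.Projective.of_split (symPower R M k).subtype (symProj R M k)
    (LinearMap.ext symProj_coe)

end SymPowerGrading

/-! ### Powers of the augmentation ideal of a formally smooth algebra -/

section GradedPieces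

/-- If `yᵢ ≡ aᵢ` modulo `m²`, then products of `n` of them are congruent modulo `m^(n+1)`; the
statement that `∏ aᵢ` lies in `m^n` is included for the induction. -/
lemma prod_sub_prod_mem_pow {D ι : Type*} [CommRing D] (m : Ideal D) (a y : ι → D)
    (ha : ∀ i, a i ∈ m) (hy : ∀ i, y i - a i ∈ m ^ 2) (s : Finset ι) :
    ∏ i ∈ s, a i ∈ m ^ s.card ∧ ∏ i ∈ s, y i - ∏ i ∈ s, a i ∈ m ^ (s.card + 1) := by
  classical
  induction s using Finset.induction_on with
  | empty => simp
  | insert j s hj ih =>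
    rw [Finset.prod_insert hj, Finset.prod_insert hj, Finset.card_insert_of_notMem hj]
    refine ⟨by rw [pow_succ']; exact Ideal.mul_mem_mul (ha j) ih.1, ?_⟩
    have hyj : y j ∈ m := by
      have := add_mem (Ideal.pow_le_self two_ne_zero (hy j)) (ha j)
      rwa [sub_add_cancel] at this
    have h1 : y j * (∏ i ∈ s, y i - ∏ i ∈ s, a i) ∈ m ^ (s.card + 1 + 1) := by
      rw [pow_succ']; exact Ideal.mul_mem_mul hyj ih.2
    have h2 : (y j - a j) * ∏ i ∈ s, a i ∈ m ^ (s.card + 1 + 1) := by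
      rw [show s.card + 1 + 1 = 2 + s.card by ring, pow_add]; exact Ideal.mul_mem_mul (hy j) ih.1
    convert add_mem h1 h2 using 1
    ring

open scoped Pointwise in
lemma mem_span_prod_of_mem_pow {C : Type*} [CommRing C] (I : Ideal C) (n : ℕ) {x : C}
    (hx : x ∈ I ^ n) : x ∈ Submodule.span C (Set.range fun t : Fin n → I => ∏ i, (t i : C)) := by
  have h : I ^ n = Submodule.span C ((I : Set C) ^ n) := by
    rw [← Submodule.span_pow, Submodule.span_eq]
  rw [h] at hx
  refine Submodule.span_mono ?_ hx
  intro y hy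
  obtain ⟨f, rfl⟩ := Set.mem_pow.mp hy
  exact ⟨f, by simp [List.prod_ofFn]⟩

variable {B C Ω : Type*} [CommRing B] [CommRing C] [Algebra B C] (δ : C →ₐ[B] B)
  [AddCommGroup Ω] [Module B Ω] (d : RingHom.ker δ →ₛₗ[(δ : C →+* B)] Ω)

lemma sub_algebraMap_mem_ker (c : C) : c - algebraMap B C (δ c) ∈ RingHom.ker δ := by
  simp [RingHom.mem_ker]

/-- Let `C` be a formally smooth `B`-algebra with augmentation `δ`, and `I` the kernel of `δ`. A
linear map `d : I → Ω` that vanishes on `I²` defines an algebra homomorphism from `C` to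
`B ⊕ Ω = Sym(Ω)/(Ω)²`, which lifts along the nilpotent thickening
`Sym(Ω)/(Ω)^(k+2) → Sym(Ω)/(Ω)²`. The lift sends a product of `k+1` elements of `I` to the product
of their images under `d`. -/
theorem exists_algHom_symmetricAlgebra [Algebra.FormallySmooth B C]
    (hd : ∀ t : RingHom.ker δ, (t : C) ∈ RingHom.ker δ ^ 2 → d t = 0) (k : ℕ) :
    ∃ ψ : C →ₐ[B] SymmetricAlgebra B Ω ⧸ symIdeal B Ω ^ (k + 2),
      (∀ t : Fin (k + 1) → RingHom.ker δ, ψ (∏ i, (t i : C)) =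
        Ideal.Quotient.mk _ (∏ i, SymmetricAlgebra.ι B Ω (d (t i)))) ∧
      ∀ x ∈ RingHom.ker δ ^ (k + 2), ψ x = 0 := by
  let m := symIdeal B Ω
  let r : C →ₗ[B] RingHom.ker δ :=
    { toFun := fun c => ⟨c - algebraMap B C (δ c), sub_algebraMap_mem_ker δ c⟩
      map_add' := fun x y => by ext; simp; ring
      map_smul' := fun b x => by ext; simp [Algebra.smul_def]; ring }
  have hdr (b : B) (t : RingHom.ker δ) : d (b • t) = b • d t := by
    have : b • t = algebraMap B C b • t := by ext; simp [Algebra.smul_def]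
    rw [this, map_smulₛₗ]
    simp
  -- The homomorphism `C → B ⊕ Ω`, `c ↦ δ(c) + d(c - δ(c))`; `r` is the projection of `C` onto `I`.
  let f : C →ₗ[B] SymmetricAlgebra B Ω ⧸ m ^ 2 :=
    { toFun := fun c => Ideal.Quotient.mk _
        (algebraMap B _ (δ c) + SymmetricAlgebra.ι B Ω (d (r c)))
      map_add' := fun x y => by simp only [map_add]; ring
      map_smul' := fun b x => by
        simp only [map_smul, hdr, RingHom.id_apply, smul_eq_mul, map_mul]
        rw [Algebra.smul_def, Algebra.smul_def, map_add, map_mul, map_add, mul_add]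
        rfl }
  have hf (t : RingHom.ker δ) : f t = Ideal.Quotient.mk _ (SymmetricAlgebra.ι B Ω (d t)) := by
    have h0 : δ t = 0 := t.2
    have hr : r t = t := by ext; simp [r, h0]
    change Ideal.Quotient.mk _ (algebraMap B _ (δ t) + SymmetricAlgebra.ι B Ω (d (r t))) = _
    rw [hr, h0, map_zero, zero_add]
  let ψ₁ : C →ₐ[B] SymmetricAlgebra B Ω ⧸ m ^ 2 := AlgHom.ofLinearMap f
    (by
      have hr : r 1 = 0 := by ext; simp [r]
      change Ideal.Quotient.mk _ (algebraMap B _ (δ 1) + SymmetricAlgebra.ι B Ω (d (r 1))) = _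
      rw [hr]; simp)
    (fun x y => by
      have hr : r (x * y) = (r x : C) • r y + (δ x • r y + δ y • r x) := by
        ext; simp [r, Algebra.smul_def]; ring
      have h1 : d ((r x : C) • r y) = 0 := hd _ (by
        rw [pow_two]; exact Ideal.mul_mem_mul (r x).2 (r y).2)
      change Ideal.Quotient.mk _ (algebraMap B _ (δ _) + SymmetricAlgebra.ι B Ω (d (r _))) =
        Ideal.Quotient.mk _ (algebraMap B _ (δ _) + SymmetricAlgebra.ι B Ω (d (r _))) *
        Ideal.Quotient.mk _ (algebraMap B _ (δ _) + SymmetricAlgebra.ι B Ω (d (r _)))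
      rw [hr, map_add d, h1, zero_add, map_add d, hdr, hdr, ← map_mul, Ideal.Quotient.eq, map_mul,
        map_mul, map_add, map_smul, map_smul, Algebra.smul_def, Algebra.smul_def]
      have := neg_mem (Ideal.mul_mem_mul (ι_mem_symIdeal (R := B) (d (r x)))
        (ι_mem_symIdeal (R := B) (d (r y))))
      rw [← pow_two] at this
      convert this using 1
      ring)
  have hle : m ^ (k + 2) ≤ m ^ 2 := Ideal.pow_le_pow_right (by lia)
  let g : (SymmetricAlgebra B Ω ⧸ m ^ (k + 2)) →ₐ[B] SymmetricAlgebra B Ω ⧸ m ^ 2 :=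
    Ideal.Quotient.factorₐ B hle
  have hg : Function.Surjective g := Ideal.Quotient.factor_surjective hle
  have hnil : IsNilpotent (RingHom.ker g) := by
    refine ⟨k + 2, ?_⟩
    have : RingHom.ker g ≤
        m.map (Ideal.Quotient.mk (m ^ (k + 2))) := by
      intro x hx
      obtain ⟨x, rfl⟩ := Ideal.Quotient.mk_surjective x
      have hx : Ideal.Quotient.mk (m ^ 2) x = 0 := hx
      exact Ideal.mem_map_of_mem _ (Ideal.pow_le_self two_ne_zero
        (Ideal.Quotient.eq_zero_iff_mem.mp hx))
    refine le_bot_iff.mp ((Ideal.pow_right_mono this _).trans ?_)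
    rw [← Ideal.map_pow, Ideal.map_quotient_self]
  let ψ := Algebra.FormallySmooth.liftOfSurjective ψ₁ g hg hnil
  have hψ (t : RingHom.ker δ) : ∃ y, ψ t = Ideal.Quotient.mk _ y ∧
      y - SymmetricAlgebra.ι B Ω (d t) ∈ m ^ 2 := by
    obtain ⟨y, hy⟩ := Ideal.Quotient.mk_surjective (ψ t)
    refine ⟨y, hy.symm, ?_⟩
    have : g (ψ t) = ψ₁ t := Algebra.FormallySmooth.liftOfSurjective_apply ψ₁ g hg hnil _
    rw [← hy] at this
    exact Ideal.Quotient.eq.mp (this.trans (hf t))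
  refine ⟨ψ, fun t => ?_, fun x hx => ?_⟩
  · choose y hy hy' using fun i => hψ (t i)
    simp only [map_prod, hy]
    rw [← map_prod, ← map_prod, Ideal.Quotient.eq]
    have := (prod_sub_prod_mem_pow m (fun i => SymmetricAlgebra.ι B Ω (d (t i))) y
      (fun i => ι_mem_symIdeal _) hy' Finset.univ).2
    rwa [Finset.card_fin] at this
  · have h1 : RingHom.ker δ ≤ (m.map (Ideal.Quotient.mk (m ^ (k + 2)))).comap ψ := by
      intro t ht
      obtain ⟨y, hy, hy'⟩ := hψ ⟨t, ht⟩
      rw [Ideal.mem_comap, show ψ t = _ from hy]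
      refine Ideal.mem_map_of_mem _ ?_
      have := add_mem (Ideal.pow_le_self two_ne_zero hy') (ι_mem_symIdeal (R := B) (d ⟨t, ht⟩))
      rwa [sub_add_cancel] at this
    have h2 := (Ideal.pow_right_mono h1 (k + 2)).trans (Ideal.le_comap_pow _ _) hx
    rwa [Ideal.mem_comap, ← Ideal.map_pow, Ideal.map_quotient_self, Ideal.mem_bot] at h2

/-- The elements of the Rees algebra of `I` whose coefficient of degree `i` lies in `I^(i+1)`; the
quotient is the associated graded ring of `I`. -/
def reesIdeal (I : Ideal C) : Ideal (reesAlgebra I) where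
  carrier := {f | ∀ i, (f : Polynomial C).coeff i ∈ I ^ (i + 1)}
  zero_mem' i := by simp
  add_mem' hf hg i := by
    rw [Subalgebra.coe_add, Polynomial.coeff_add]
    exact add_mem (hf i) (hg i)
  smul_mem' f g hg n := by
    rw [smul_eq_mul, Subalgebra.coe_mul, Polynomial.coeff_mul]
    refine sum_mem fun p hp => ?_
    rw [← Finset.HasAntidiagonal.mem_antidiagonal.mp hp, add_assoc, pow_add]
    exact Ideal.mul_mem_mul ((mem_reesAlgebra_iff I _).mp f.2 p.1) (hg p.2)

/-- The map `Sym^k(I/I²) → I^k/I^(k+1)`, where `I` is the augmentation ideal. It is the component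
of degree `k` of the homomorphism from `Sym(I/I²)` to the associated graded ring of `I`, which is
taken as the quotient of the Rees algebra by `reesIdeal I`. -/
theorem exists_symPower_to_quotient
    (hd : ∀ t : RingHom.ker δ, d t = 0 → (t : C) ∈ RingHom.ker δ ^ 2)
    (hsurj : Function.Surjective d) (k : ℕ) :
    ∃ γ : symPower B Ω k →ₗ[B] C ⧸ RingHom.ker δ ^ (k + 1),
      ∀ t : Fin k → RingHom.ker δ,
        γ (symProd B fun i => d (t i)) = Ideal.Quotient.mk _ (∏ i, (t i : C)) := by
  let I := RingHom.ker δ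
  have hdr (b : B) (t : RingHom.ker δ) : d (b • t) = b • d t := by
    have : b • t = algebraMap B C b • t := by ext; simp [Algebra.smul_def]
    rw [this, map_smulₛₗ]
    simp
  let mon : I →ₗ[B] reesAlgebra I :=
    { toFun := fun t => ⟨Polynomial.monomial 1 (t : C),
        reesAlgebra.monomial_mem.mpr (by rw [pow_one]; exact t.2)⟩
      map_add' := fun x y => by ext1; simp
      map_smul' := fun b x => by
        ext1
        exact (Polynomial.smul_monomial b 1 (x : C)).symm }
  have hmon (t : I) (ht : d t = 0) : Ideal.Quotient.mk (reesIdeal I) (mon t) = 0 := by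
    rw [Ideal.Quotient.eq_zero_iff_mem]
    intro i
    change (Polynomial.monomial 1 (t : C)).coeff i ∈ _
    rw [Polynomial.coeff_monomial]
    split_ifs with h
    · subst h; exact hd t ht
    · exact zero_mem _
  have hmon' (t t' : I) (ht : d t = d t') : Ideal.Quotient.mk (reesIdeal I) (mon t) =
      Ideal.Quotient.mk (reesIdeal I) (mon t') := by
    rw [← sub_eq_zero, ← map_sub, ← map_sub]
    exact hmon _ (by rw [map_sub, ht, sub_self])
  choose s hs using hsurj
  let l : Ω →ₗ[B] reesAlgebra I ⧸ reesIdeal I :=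
    { toFun := fun ω => Ideal.Quotient.mk (reesIdeal I) (mon (s ω))
      map_add' := fun x y => by
        rw [← map_add, ← map_add]; exact hmon' _ _ (by rw [map_add, hs, hs, hs])
      map_smul' := fun b x => by
        rw [RingHom.id_apply, ← Ideal.Quotient.mkₐ_eq_mk B, ← map_smul, ← map_smul]
        exact hmon' _ _ (by rw [hdr, hs, hs]) }
  have hl (t : I) : l (d t) = Ideal.Quotient.mk (reesIdeal I) (mon t) := hmon' _ _ (hs _)
  let co : reesAlgebra I →ₗ[B] C ⧸ I ^ (k + 1) :=
    (Ideal.Quotient.mkₐ B (I ^ (k + 1))).toLinearMap ∘ₗ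
      ((Polynomial.lcoeff C k).restrictScalars B) ∘ₗ
        ((reesAlgebra I).val.restrictScalars B).toLinearMap
  let co' : (reesAlgebra I ⧸ reesIdeal I) →ₗ[B] C ⧸ I ^ (k + 1) :=
    ((reesIdeal I).restrictScalars B).liftQ co (fun f hf =>
      Ideal.Quotient.eq_zero_iff_mem.mpr (hf k)) ∘ₗ
        (Submodule.Quotient.restrictScalarsEquiv B (reesIdeal I)).symm.toLinearMap
  let L : SymmetricAlgebra B Ω →ₐ[B] reesAlgebra I ⧸ reesIdeal I :=
    SymmetricAlgebra.lift (A := reesAlgebra I ⧸ reesIdeal I) l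
  refine ⟨co' ∘ₗ L.toLinearMap ∘ₗ (symPower B Ω k).subtype, fun t => ?_⟩
  change co' (L (∏ i, SymmetricAlgebra.ι B Ω (d (t i)))) = _
  have hL (t : I) : L (SymmetricAlgebra.ι B Ω (d t)) = Ideal.Quotient.mk (reesIdeal I) (mon t) :=
    (SymmetricAlgebra.lift_ι_apply _ _).trans (hl t)
  rw [map_prod, Finset.prod_congr rfl fun i _ => hL (t i)]
  have hp : Ideal.Quotient.mkₐ B (reesIdeal I) (∏ i, mon (t i)) =
    ∏ i, Ideal.Quotient.mkₐ B (reesIdeal I) (mon (t i)) := map_prod _ _ _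
  refine (congrArg co' hp.symm).trans ?_
  change Ideal.Quotient.mk _ (((∏ i, mon (t i) : reesAlgebra I) : Polynomial C).coeff k) = _
  congr 1
  have (u : Finset (Fin k)) : ((∏ i ∈ u, mon (t i) : reesAlgebra I) : Polynomial C) =
      Polynomial.monomial u.card (∏ i ∈ u, (t i : C)) := by
    induction u using Finset.induction_on with
    | empty => simp
    | insert a u ha ih =>
      rw [Finset.prod_insert ha, Subalgebra.coe_mul, ih, Finset.prod_insert ha,
        Finset.card_insert_of_notMem ha, add_comm, ← Polynomial.monomial_mul_monomial]
      rfl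
  rw [this]
  simp

end GradedPieces

/-! ### The canonical map over an augmented formally smooth algebra -/

section Twisted

variable {B C Ω M N F : Type*} [CommRing B] [CommRing C] [Algebra B C] (δ : C →ₐ[B] B)
  [AddCommGroup Ω] [Module B Ω] (d : RingHom.ker δ →ₛₗ[(δ : C →+* B)] Ω)
  [AddCommGroup M] [Module B M] [AddCommGroup N] [Module B N] [Module C N] [IsScalarTower B C N]
  [AddCommGroup F] [Module B F] [Module C F] [IsScalarTower B C F]

/-- The local form of the fundamental exact sequence: `C` is formally smooth over `B` with
augmentation `δ` and augmentation ideal `I`, the module `Ω` is `I/I²`, `N = C ⊗_B M`, and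
`F = N/I^(k+2) N`. The image of the map `M ⊗ Sym^(k+1)(Ω) → F` is `I^(k+1) N/I^(k+2) N`. It is
injective: the lift `C → Sym(Ω)/(Ω)^(k+2)` of `exists_algHom_symmetricAlgebra`, followed by the
projection to degree `k+1` and tensored with `M`, vanishes on `I^(k+2) N` and inverts it. -/
theorem exists_localCanonicalMap [Algebra.FormallySmooth B C]
    (hd : ∀ t : RingHom.ker δ, d t = 0 ↔ (t : C) ∈ RingHom.ker δ ^ 2)
    (hsurj : Function.Surjective d) (k : ℕ) (ε : M →ₗ[B] N) (hε : IsBaseChange C ε)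
    (τ : N →ₗ[C] F) (hτ : LinearMap.ker τ = RingHom.ker δ ^ (k + 2) • (⊤ : Submodule C N)) :
    ∃ φ : M ⊗[B] symPower B Ω (k + 1) →ₗ[B] F,
      (∀ (m : M) (t : Fin (k + 1) → RingHom.ker δ), φ (m ⊗ₜ symProd B fun i => d (t i)) =
        τ ((∏ i, (t i : C)) • ε m)) ∧
      Function.Injective φ ∧
      ∀ y, y ∈ LinearMap.range φ ↔
        y ∈ (RingHom.ker δ ^ (k + 1) • (⊤ : Submodule C N)).map τ := by
  let I := RingHom.ker δ
  obtain ⟨γ, hγ⟩ := exists_symPower_to_quotient δ d (fun t => (hd t).mp) hsurj (k + 1)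
  let μ : (C ⧸ I ^ (k + 2)) →ₗ[C] N →ₗ[C] F :=
    Submodule.liftQ (I ^ (k + 2)) (LinearMap.toSpanSingleton C _ τ) (fun c hc => by
      ext n
      change c • τ n = 0
      rw [← map_smul, ← LinearMap.mem_ker, hτ]
      exact Submodule.smul_mem_smul hc trivial)
  have hμ (c : C) (n : N) : μ (Ideal.Quotient.mk _ c) n = τ (c • n) := (map_smul τ c n).symm
  let φ : M ⊗[B] symPower B Ω (k + 1) →ₗ[B] F := TensorProduct.lift
    (LinearMap.mk₂ B (fun m s => μ (γ s) (ε m))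
      (fun m m' s => by rw [map_add, map_add])
      (fun b m s => by
        rw [map_smul, ← algebraMap_smul C b, map_smul, algebraMap_smul])
      (fun m s s' => by rw [map_add, map_add, LinearMap.add_apply])
      (fun b m s => by
        rw [map_smul, ← algebraMap_smul C b, map_smul, LinearMap.smul_apply, algebraMap_smul]))
  have hφ (m : M) (t : Fin (k + 1) → I) : φ (m ⊗ₜ symProd B fun i => d (t i)) =
      τ ((∏ i, (t i : C)) • ε m) := by
    change μ (γ _) (ε m) = _
    rw [hγ, hμ]
  -- A left inverse of `φ`, from the homomorphism to the truncated symmetric algebra.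
  obtain ⟨ψ, hψ, hψ'⟩ := exists_algHom_symmetricAlgebra δ d (fun t => (hd t).mpr) k
  let pr : (SymmetricAlgebra B Ω ⧸ symIdeal B Ω ^ (k + 2)) →ₗ[B] symPower B Ω (k + 1) :=
    ((symIdeal B Ω ^ (k + 2)).restrictScalars B).liftQ (symProj B Ω (k + 1))
      (fun x hx => symProj_eq_zero hx) ∘ₗ
        (Submodule.Quotient.restrictScalarsEquiv B _).symm.toLinearMap
  have hpr (x : symPower B Ω (k + 1)) : pr (Ideal.Quotient.mk _ (x : SymmetricAlgebra B Ω)) = x :=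
    symProj_coe x
  let Λ : N →ₗ[B] M ⊗[B] symPower B Ω (k + 1) :=
    (TensorProduct.comm B _ _).toLinearMap ∘ₗ
      (TensorProduct.map (pr ∘ₗ ψ.toLinearMap) LinearMap.id) ∘ₗ
        (hε.equiv.symm.restrictScalars B).toLinearMap
  have hΛ (c : C) (m : M) : Λ (c • ε m) = m ⊗ₜ pr (ψ c) := by
    change TensorProduct.comm B _ _ (TensorProduct.map _ _ (hε.equiv.symm (c • ε m))) = _
    rw [map_smul, hε.equiv_symm_apply, TensorProduct.smul_tmul', smul_eq_mul, mul_one]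
    rfl
  have hind (n : N) : n ∈ Submodule.span C (Set.range ε) := by
    obtain ⟨x, rfl⟩ := hε.equiv.surjective n
    induction x with
    | zero => simp
    | tmul c m => exact Submodule.smul_mem _ _ (Submodule.subset_span ⟨m, rfl⟩)
    | add x y hx hy => rw [map_add]; exact add_mem hx hy
  have hΛ0 (n : N) (hn : n ∈ I ^ (k + 2) • (⊤ : Submodule C N)) : Λ n = 0 := by
    refine Submodule.smul_induction_on hn (fun c hc n _ => ?_)
      (fun x y hx hy => by rw [map_add, hx, hy, add_zero])
    · have hn' := hind n
      induction hn' using Submodule.span_induction generalizing c with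
      | mem x hx =>
        obtain ⟨m, rfl⟩ := hx
        rw [hΛ, hψ' c hc, map_zero, TensorProduct.tmul_zero]
      | zero => simp
      | add x y _ _ hx hy => rw [smul_add, map_add, hx c hc trivial, hy c hc trivial, add_zero]
      | smul a x _ hx => rw [smul_smul]; exact hx _ (Ideal.mul_mem_right _ _ hc) trivial
  have hsp : Submodule.span B (Set.range fun t : Fin (k + 1) → I => symProd B fun i => d (t i)) =
      ⊤ := by
    rw [← span_range_symProd]
    congr 1
    ext x
    constructor
    · rintro ⟨t, rfl⟩; exact ⟨_, rfl⟩
    · rintro ⟨ω, rfl⟩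
      choose s hs using fun i => hsurj (ω i)
      exact ⟨s, by simp [hs]⟩
  have hφΛ (x : M ⊗[B] symPower B Ω (k + 1)) : ∃ n ∈ I ^ (k + 1) • (⊤ : Submodule C N),
      φ x = τ n ∧ Λ n = x := by
    induction x with
    | zero => exact ⟨0, zero_mem _, by simp, by simp⟩
    | add x y hx hy =>
      obtain ⟨n, h0, h1, h2⟩ := hx
      obtain ⟨n', h0', h1', h2'⟩ := hy
      exact ⟨n + n', add_mem h0 h0', by rw [map_add, map_add, h1, h1'], by rw [map_add, h2, h2']⟩
    | tmul m s =>
      have hs : s ∈ Submodule.span B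
        (Set.range fun t : Fin (k + 1) → I => symProd B fun i => d (t i)) := by rw [hsp]; trivial
      induction hs using Submodule.span_induction generalizing m with
      | mem x hx =>
        obtain ⟨t, rfl⟩ := hx
        refine ⟨(∏ i, (t i : C)) • ε m, Submodule.smul_mem_smul ?_ trivial, hφ m t, ?_⟩
        · have := Ideal.prod_mem_prod (s := Finset.univ) (I := fun _ : Fin (k + 1) => I)
            (x := fun i => (t i : C)) fun i _ => (t i).2
          rwa [Finset.prod_const, Finset.card_fin] at this
        · rw [hΛ, hψ]
          exact congrArg _ (hpr (symProd B fun i => d (t i)))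
      | zero => exact ⟨0, zero_mem _, by simp, by simp⟩
      | add x y _ _ hx hy =>
        obtain ⟨n, h0, h1, h2⟩ := hx m
        obtain ⟨n', h0', h1', h2'⟩ := hy m
        exact ⟨n + n', add_mem h0 h0', by rw [TensorProduct.tmul_add, map_add, map_add, h1, h1'],
          by rw [map_add, h2, h2', TensorProduct.tmul_add]⟩
      | smul b x _ hx =>
        rw [← TensorProduct.smul_tmul]
        exact hx _
  refine ⟨φ, hφ, ?_, fun y => ⟨?_, ?_⟩⟩
  · rw [← LinearMap.ker_eq_bot, LinearMap.ker_eq_bot']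
    intro x hx
    obtain ⟨n, -, h1, h2⟩ := hφΛ x
    rw [← h2]
    refine hΛ0 n ?_
    rw [← hτ, LinearMap.mem_ker, ← h1, hx]
  · rintro ⟨x, rfl⟩
    obtain ⟨n, h0, h1, -⟩ := hφΛ x
    exact ⟨n, h0, h1.symm⟩
  · rintro ⟨n, hn, rfl⟩
    have hprod (t : Fin (k + 1) → I) (n : N) : τ ((∏ i, (t i : C)) • n) ∈ LinearMap.range φ := by
      have hn := hind n
      induction hn using Submodule.span_induction with
      | mem x hx => obtain ⟨m, rfl⟩ := hx; exact ⟨_, hφ m t⟩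
      | zero => simp
      | add x y _ _ hx hy => rw [smul_add, map_add]; exact add_mem hx hy
      | smul c x _ hx =>
        -- Modulo `I^(k+2)` the scalar `c` may be replaced by its image in `B`.
        have h0 : τ ((∏ i, (t i : C)) • (c - algebraMap B C (δ c)) • x) = 0 := by
          rw [← LinearMap.mem_ker, hτ, smul_smul]
          refine Submodule.smul_mem_smul ?_ trivial
          rw [pow_succ _ (k + 1)]
          refine Ideal.mul_mem_mul ?_ (sub_algebraMap_mem_ker δ c)
          have := Ideal.prod_mem_prod (s := Finset.univ) (I := fun _ : Fin (k + 1) => I)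
            (x := fun i => (t i : C)) fun i _ => (t i).2
          rwa [Finset.prod_const, Finset.card_fin] at this
        rw [sub_smul, smul_sub, map_sub, sub_eq_zero] at h0
        rw [h0, smul_comm, map_smul, algebraMap_smul]
        exact Submodule.smul_mem _ _ hx
    refine Submodule.smul_induction_on hn (fun c hc n _ => ?_)
      (fun x y hx hy => by rw [map_add]; exact add_mem hx hy)
    · have hc' := mem_span_prod_of_mem_pow I (k + 1) hc
      clear hc
      induction hc' using Submodule.span_induction generalizing n with
      | mem x hx => obtain ⟨t, rfl⟩ := hx; exact hprod t n
      | zero => simp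
      | add x y _ _ hx hy => rw [add_smul, map_add]; exact add_mem (hx n trivial) (hy n trivial)
      | smul a x _ hx => rw [smul_assoc, smul_comm]; exact hx _ trivial

end Twisted

/-! ### Projectivity of the quotients by powers of the augmentation ideal -/

section Projectivity

variable {B C : Type*} [CommRing B] [CommRing C] [Algebra B C] (δ : C →ₐ[B] B)

lemma augmentation_surjective : Function.Surjective δ := fun b => ⟨algebraMap B C b, by simp⟩

open scoped KaehlerDifferential in
/-- For a formally smooth algebra `C` with an augmentation, the conormal sequence of `B → C → B`
is split, so `I/I²` is a direct summand of the projective module `B ⊗_C Ω_{C/B}`. -/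
theorem projective_cotangent [Algebra.FormallySmooth B C] :
    Module.Projective B (RingHom.ker δ).Cotangent := by
  let _ : Algebra C B := (δ : C →+* B).toAlgebra
  have : IsScalarTower B C B := .of_algebraMap_eq fun b => (δ.commutes b).symm
  obtain ⟨l, hl⟩ := (Algebra.FormallySmooth.iff_split_injection (R := B) (P := C) (A := B)
    (augmentation_surjective δ)).mp inferInstance
  have hC (b : B) (y : B ⊗[C] Ω[C⁄B]) : b • y = algebraMap B C b • y := by
    rw [← algebraMap_smul B (algebraMap B C b) y]
    congr 1
    exact (δ.commutes b).symm
  let i : (RingHom.ker δ).Cotangent →ₗ[B] B ⊗[C] Ω[C⁄B] :=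
    { toFun := KaehlerDifferential.kerCotangentToTensor B C B
      map_add' := map_add _
      map_smul' := fun b x => by
        rw [RingHom.id_apply, hC, ← algebraMap_smul C b x]
        exact map_smul (KaehlerDifferential.kerCotangentToTensor B C B) _ x }
  let s : B ⊗[C] Ω[C⁄B] →ₗ[B] (RingHom.ker δ).Cotangent :=
    { toFun := l
      map_add' := map_add _
      map_smul' := fun b x => by
        rw [RingHom.id_apply, hC]
        exact (map_smul l _ x).trans (algebraMap_smul C b (M := (RingHom.ker δ).Cotangent) (l x)) }
  have hP : Module.Projective B (B ⊗[C] Ω[C⁄B]) := inferInstance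
  exact .of_split i s (LinearMap.ext fun x => congr($hl x))

/-- The class of a function in `I/I²`, semilinear along the augmentation. -/
def augToCotangent : RingHom.ker δ →ₛₗ[(δ : C →+* B)] (RingHom.ker δ).Cotangent where
  toFun := (RingHom.ker δ).toCotangent
  map_add' := map_add _
  map_smul' c x := by
    rw [map_smul]
    have h : ((c - algebraMap B C (δ c)) • (RingHom.ker δ).toCotangent x) = 0 := by
      rw [← map_smul, Ideal.toCotangent_eq_zero, pow_two]
      exact Ideal.mul_mem_mul (sub_algebraMap_mem_ker δ c) x.2
    rw [sub_smul, sub_eq_zero, algebraMap_smul] at h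
    exact h

/-- For a smooth algebra `C` with augmentation ideal `I`, the module `C/I^(k+2)` is an extension of
`C/I^(k+1)` by `Sym^(k+1)(I/I²)`; the latter are finitely generated projective. -/
theorem projective_quotient_pow [Algebra.Smooth B C] (k : ℕ) :
    Module.Projective B (C ⧸ RingHom.ker δ ^ (k + 1)) ∧
      Module.Finite B (C ⧸ RingHom.ker δ ^ (k + 1)) := by
  classical
  have hfg : (RingHom.ker δ).FG :=
    Algebra.FinitePresentation.ker_fG_of_surjective δ (augmentation_surjective δ)
  have hproj := projective_cotangent δ
  have hfin : Module.Finite B (RingHom.ker δ).Cotangent := by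
    have : Module.Finite C (RingHom.ker δ) := Module.Finite.of_fg hfg
    have h : (⊤ : Submodule C (RingHom.ker δ)).FG := Module.Finite.fg_top
    obtain ⟨s, hs⟩ := h
    refine ⟨⟨s.image (augToCotangent δ), ?_⟩⟩
    rw [Finset.coe_image, eq_top_iff]
    rintro x -
    obtain ⟨x, rfl⟩ := (RingHom.ker δ).toCotangent_surjective x
    have hx : x ∈ Submodule.span C (s : Set (RingHom.ker δ)) := hs ▸ Submodule.mem_top
    induction hx using Submodule.span_induction with
    | mem x hx => exact Submodule.subset_span ⟨x, hx, rfl⟩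
    | zero => rw [map_zero]; exact zero_mem _
    | add x y _ _ hx hy => rw [map_add]; exact add_mem hx hy
    | smul c x _ hx =>
      have := (augToCotangent δ).map_smulₛₗ c x
      change augToCotangent δ (c • x) ∈ _
      rw [this]
      exact Submodule.smul_mem _ _ hx
  induction k with
  | zero =>
    let e : (C ⧸ RingHom.ker δ ^ (0 + 1)) ≃ₐ[B] B :=
      (Ideal.quotientEquivAlgOfEq B (by rw [zero_add, pow_one])).trans
        (Ideal.quotientKerAlgEquivOfSurjective (augmentation_surjective δ))
    exact ⟨.of_equiv e.toLinearEquiv.symm, .equiv e.toLinearEquiv.symm⟩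
  | succ k ih =>
    obtain ⟨h1, h2⟩ := ih
    -- The case `M = B` of the canonical map.
    obtain ⟨φ, -, hinj, hrange⟩ := exists_localCanonicalMap δ (augToCotangent δ)
      (fun t => (RingHom.ker δ).toCotangent_eq_zero t) (RingHom.ker δ).toCotangent_surjective k
      (Algebra.linearMap B C) (IsBaseChange.linearMap B C)
      (Submodule.mkQ (RingHom.ker δ ^ (k + 2)))
      (by rw [Submodule.ker_mkQ, smul_eq_mul, Ideal.mul_top])
    let g : (C ⧸ RingHom.ker δ ^ (k + 2)) →ₗ[B] (C ⧸ RingHom.ker δ ^ (k + 1)) :=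
      (Ideal.Quotient.factorₐ B (Ideal.pow_le_pow_right (Nat.le_succ (k + 1)))).toLinearMap
    have hg : Function.Surjective g := Ideal.Quotient.factor_surjective
      (Ideal.pow_le_pow_right (Nat.le_succ (k + 1)))
    have hex : Function.Exact φ g := by
      intro y
      obtain ⟨c, rfl⟩ := Ideal.Quotient.mk_surjective y
      change Ideal.Quotient.mk _ c = 0 ↔ _
      rw [Ideal.Quotient.eq_zero_iff_mem, ← LinearMap.coe_range, SetLike.mem_coe, hrange,
        smul_eq_mul, Ideal.mul_top]
      constructor
      · intro hc
        exact ⟨c, hc, rfl⟩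
      · rintro ⟨c', hc', h⟩
        have h' := Ideal.Quotient.eq.mp h
        have := sub_mem hc' (Ideal.pow_le_pow_right (Nat.le_succ (k + 1)) h')
        rwa [sub_sub_cancel] at this
    have hS : Module.Finite B (symPower B (RingHom.ker δ).Cotangent (k + 1)) := by
      refine Module.Finite.of_fg ?_
      rw [symPower_eq_pow]
      refine Submodule.FG.pow ?_ _
      rw [LinearMap.range_eq_map]
      exact hfin.fg_top.map _
    have hP : Module.Projective B (symPower B (RingHom.ker δ).Cotangent (k + 1)) := inferInstance
    obtain ⟨s, hs⟩ := Module.projective_lifting_property g LinearMap.id hg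
    have e := (hex.splitSurjectiveEquiv hinj ⟨s, hs⟩).1
    exact ⟨.of_equiv e.symm, .equiv e.symm⟩

end Projectivity

/-! ### Sections of presheaves and sheaves of modules -/

noncomputable section Sections

variable {X : Scheme.{u}}

/-- Restriction of functions. -/
abbrev ringRes {U V : X.Opens} (h : V ≤ U) : Γ(X, U) →+* Γ(X, V) :=
  (X.presheaf.map (homOfLE h).op).hom

lemma ringRes_self {U : X.Opens} (h : U ≤ U) (f : Γ(X, U)) : ringRes h f = f := by
  change X.presheaf.map (𝟙 _) f = f
  simp

lemma ringRes_ringRes {U V W : X.Opens} (h : V ≤ U) (h' : W ≤ V) (f : Γ(X, U)) :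
    ringRes h' (ringRes h f) = ringRes (h'.trans h) f := by
  change (X.presheaf.map _ ≫ X.presheaf.map _) f = _
  rw [← Functor.map_comp]
  rfl

/-- The presheaf of modules underlying a sheaf of modules. -/
def toPre (M : X.Modules) : X.PresheafOfModules := M.val

/-- The morphism of presheaves of modules underlying a morphism of sheaves of modules. -/
def preMap {M N : X.Modules} (α : M ⟶ N) : toPre M ⟶ toPre N := α.val

/-- The module of sections of a presheaf of modules over an open set. -/
def Sec (P : X.PresheafOfModules) (U : X.Opens) : Type u := P.obj (op U)

variable {P Q : X.PresheafOfModules} {U V W : X.Opens}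

instance : AddCommGroup (Sec P U) := (P.obj (op U)).isAddCommGroup

instance : Module Γ(X, U) (Sec P U) := (P.obj (op U)).isModule

/-- Restriction of sections of a presheaf of modules. -/
def secRes (P : X.PresheafOfModules) (h : V ≤ U) : Sec P U →ₛₗ[ringRes h] Sec P V :=
  P.restrictₛₗ (homOfLE h).op

lemma secRes_self (h : U ≤ U) (s : Sec P U) : secRes P h s = s := by
  change P.presheaf.map (𝟙 _) s = s
  rw [P.presheaf.map_id]
  rfl

lemma secRes_secRes (h : V ≤ U) (h' : W ≤ V) (s : Sec P U) :
    secRes P h' (secRes P h s) = secRes P (h'.trans h) s := by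
  change (P.presheaf.map _ ≫ P.presheaf.map _) s = _
  rw [← Functor.map_comp]
  rfl

/-- The effect of a morphism of presheaves of modules on sections. -/
def secMap (α : P ⟶ Q) (U : X.Opens) : Sec P U →ₗ[Γ(X, U)] Sec Q U := (α.app (op U)).hom

lemma secMap_secRes (α : P ⟶ Q) (h : V ≤ U) (s : Sec P U) :
    secMap α V (secRes P h s) = secRes Q h (secMap α U s) :=
  PresheafOfModules.naturality_apply α (homOfLE h).op s

lemma secMap_ext {α β : P ⟶ Q} (h : ∀ U (s : Sec P U), secMap α U s = secMap β U s) : α = β := by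
  ext U s
  exact h U.unop s

/-- Sections of a sheaf agree if they agree locally. -/
lemma sec_eq_of_locally (M : X.Modules) {s t : Sec (toPre M) U}
    (h : ∀ x ∈ U, ∃ (V : X.Opens) (hV : V ≤ U), x ∈ V ∧
      secRes (toPre M) hV s = secRes (toPre M) hV t) :
    s = t := by
  choose V hV hx hst using h
  refine TopCat.Sheaf.eq_of_locally_eq' ⟨M.presheaf, M.isSheaf⟩ (fun x : U => V x x.2) U
    (fun x => homOfLE (hV x x.2)) (fun x hxU => ?_) s t (fun x => hst x x.2)
  exact TopologicalSpace.Opens.mem_iSup.mpr ⟨⟨x, hxU⟩, hx x hxU⟩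

/-- Gluing of compatible local sections of a sheaf. -/
lemma exists_sec_of_locally (M : X.Modules) {ι : Type u} (V : ι → X.Opens) (hV : ∀ i, V i ≤ U)
    (hcov : U ≤ iSup V) (s : ∀ i, Sec (toPre M) (V i))
    (h : ∀ i j, secRes (toPre M) inf_le_left (s i) =
      secRes (toPre M) (inf_le_right : V i ⊓ V j ≤ V j) (s j)) :
    ∃ t : Sec (toPre M) U, ∀ i, secRes (toPre M) (hV i) t = s i := by
  have hc : TopCat.Presheaf.IsCompatible M.presheaf V s := fun i j => h i j
  obtain ⟨t, ht, -⟩ := TopCat.Sheaf.existsUnique_gluing' ⟨M.presheaf, M.isSheaf⟩ V U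
    (fun i => homOfLE (hV i)) hcov s hc
  exact ⟨t, ht⟩

/-- The unit of sheafification on sections. -/
def secUnit (P : X.PresheafOfModules) (U : X.Opens) :
    Sec P U →ₗ[Γ(X, U)] Sec (toPre (sheafify.obj P)) U :=
  secMap ((PresheafOfModules.sheafificationAdjunction (𝟙 X.ringCatSheaf.obj)).unit.app P) U

lemma secUnit_secRes (h : V ≤ U) (s : Sec P U) :
    secUnit P V (secRes P h s) = secRes (toPre (sheafify.obj P)) h (secUnit P U s) :=
  secMap_secRes _ h s

lemma secUnit_locally_injective {s : Sec P U} (hs : secUnit P U s = 0) {x : X} (hx : x ∈ U) :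
    ∃ (V : X.Opens) (hV : V ≤ U), x ∈ V ∧ secRes P hV s = 0 := by
  have := Presheaf.equalizerSieve_mem (Opens.grothendieckTopology X)
    (CategoryTheory.toSheafify (Opens.grothendieckTopology X) P.presheaf)
    (X := op U) s (0 : Sec P U)
    (hs.trans (map_zero (secUnit P U)).symm)
  obtain ⟨V, f, hf, hxV⟩ := this x hx
  exact ⟨V, f.le, hxV, hf.trans (map_zero (secRes P f.le))⟩

lemma secUnit_locally_surjective (t : Sec (toPre (sheafify.obj P)) U) {x : X} (hx : x ∈ U) :
    ∃ (V : X.Opens) (hV : V ≤ U) (s : Sec P V), x ∈ V ∧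
      secUnit P V s = secRes (toPre (sheafify.obj P)) hV t := by
  have := Presheaf.imageSieve_mem (Opens.grothendieckTopology X)
    (CategoryTheory.toSheafify (Opens.grothendieckTopology X) P.presheaf) (U := op U) t
  obtain ⟨V, f, ⟨s, hs⟩, hxV⟩ := this x hx
  exact ⟨V, f.le, s, hxV, hs⟩

lemma secMap_sheafify_map (α : P ⟶ Q) (U : X.Opens) (s : Sec P U) :
    secMap (preMap (sheafify.map α)) U (secUnit P U s) = secUnit Q U (secMap α U s) := by
  have := (PresheafOfModules.sheafificationAdjunction (𝟙 X.ringCatSheaf.obj)).unit.naturality α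
  exact congr(secMap $this.symm U s)

lemma preMap_comp {M N K : X.Modules} (α : M ⟶ N) (β : N ⟶ K) :
    preMap (α ≫ β) = preMap α ≫ preMap β := rfl

lemma preMap_injective {M N : X.Modules} {α β : M ⟶ N} (h : preMap α = preMap β) : α = β :=
  Scheme.Modules.fullyFaithfulToPresheafOfModules.map_injective h

/-- A morphism of presheaves of modules between sheaves is a morphism of sheaves. -/
def ofPreMap {M N : X.Modules} (α : toPre M ⟶ toPre N) : M ⟶ N := ⟨α⟩

lemma preMap_ofPreMap {M N : X.Modules} (α : toPre M ⟶ toPre N) : preMap (ofPreMap α) = α := rfl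

/-- The unit of sheafification. -/
def sheafifyUnit (P : X.PresheafOfModules) : P ⟶ toPre (sheafify.obj P) :=
  (PresheafOfModules.sheafificationAdjunction (𝟙 X.ringCatSheaf.obj)).unit.app P

lemma exists_unique_sheafify_hom {P : X.PresheafOfModules} {N : X.Modules} (g : P ⟶ toPre N) :
    ∃! γ : sheafify.obj P ⟶ N, sheafifyUnit P ≫ preMap γ = g := by
  let adj := PresheafOfModules.sheafificationAdjunction (𝟙 X.ringCatSheaf.obj)
  have key (γ : sheafify.obj P ⟶ N) : adj.homEquiv P N γ = sheafifyUnit P ≫ preMap γ :=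
    Adjunction.homEquiv_unit _ _ _ _
  refine ⟨(adj.homEquiv P N).symm g, ?_, fun γ hγ => ?_⟩
  · exact (key _).symm.trans (Equiv.apply_symm_apply _ _)
  · exact (Equiv.eq_symm_apply _).mpr ((key γ).trans hγ)

/-- The functor of sections over an open set. -/
def sectionsFunctor (U : X.Opens) : X.Modules ⥤ Ab :=
  Scheme.Modules.toPresheaf X ⋙ (evaluation _ _).obj (op U)

instance (U : X.Opens) : PreservesFiniteLimits (sectionsFunctor U) := by
  have h : PreservesFiniteLimits ((evaluation (TopologicalSpace.Opens X)ᵒᵖ Ab.{u}).obj (op U)) :=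
    inferInstance
  exact @comp_preservesFiniteLimits _ _ _ _ _ _ (Scheme.Modules.toPresheaf X) _ _ h

instance (U : X.Opens) : (sectionsFunctor U).PreservesZeroMorphisms := ⟨fun _ _ => rfl⟩

end Sections

/-! ### Quasi-coherence over an affine open set -/

noncomputable section QuasiCoherence

variable {X : Scheme.{u}} {P Q : X.PresheafOfModules} {U V W : X.Opens}

/-- The restriction maps `P(U) → P(D(f))` are localizations at `f`, for all functions `f` on `U`.
For a sheaf `P` and an affine open set `U` this means that the restriction of `P` to `U` is
quasi-coherent. -/
structure IsQCAt (P : X.PresheafOfModules) (U : X.Opens) : Prop where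
  surj (f : Γ(X, U)) (t : Sec P (X.basicOpen f)) :
    ∃ (n : ℕ) (s : Sec P U),
      secRes P (X.basicOpen_le f) s = ringRes (X.basicOpen_le f) f ^ n • t
  inj (f : Γ(X, U)) (s : Sec P U) (hs : secRes P (X.basicOpen_le f) s = 0) :
    ∃ n : ℕ, f ^ n • s = 0

lemma isUnit_ringRes_basicOpen (f : Γ(X, U)) : IsUnit (ringRes (X.basicOpen_le f) f) :=
  RingedSpace.isUnit_res_basicOpen _ f

lemma secRes_smul (P : X.PresheafOfModules) (h : V ≤ U) (a : Γ(X, U)) (s : Sec P U) :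
    secRes P h (a • s) = ringRes h a • secRes P h s := (secRes P h).map_smulₛₗ a s

lemma eq_zero_of_isUnit_smul {M : Type*} {R : Type*} [CommRing R] [AddCommGroup M] [Module R M]
    {a : R} (ha : IsUnit a) {m : M} (h : a • m = 0) : m = 0 :=
  (ha.smul_eq_zero).mp h

lemma exists_ringRes_eq_pow_mul (hU : IsAffineOpen U) (f : Γ(X, U))
    (a : Γ(X, X.basicOpen f)) :
    ∃ (n : ℕ) (b : Γ(X, U)),
      ringRes (X.basicOpen_le f) b = ringRes (X.basicOpen_le f) f ^ n * a := by
  have := hU.isLocalization_basicOpen f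
  obtain ⟨b, ⟨_, n, rfl⟩, h⟩ := IsLocalization.exists_mk'_eq (Submonoid.powers f) a
  refine ⟨n, b, ?_⟩
  rw [← h, mul_comm, ← map_pow]
  exact (IsLocalization.mk'_spec (M := Submonoid.powers f) _ b ⟨f ^ n, n, rfl⟩).symm

lemma exists_pow_mul_eq_zero (hU : IsAffineOpen U) (f b : Γ(X, U))
    (h : ringRes (X.basicOpen_le f) b = 0) : ∃ n : ℕ, f ^ n * b = 0 := by
  have := hU.isLocalization_basicOpen f
  obtain ⟨⟨_, n, rfl⟩, h⟩ := (IsLocalization.map_eq_zero_iff (Submonoid.powers f) _ b).mp h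
  exact ⟨n, h⟩

/-- A basic open subset of a basic open subset `D(g)` of an affine open set `U` is `D(f')` for a
function `f'` on `U` that differs from the given one by a unit. -/
lemma exists_basicOpen_basicOpen (hU : IsAffineOpen U) (g : Γ(X, U)) (f : Γ(X, X.basicOpen g)) :
    ∃ (f' : Γ(X, U)) (v : Γ(X, X.basicOpen g)), IsUnit v ∧
      ringRes (X.basicOpen_le g) f' = v * f ∧ X.basicOpen f' = X.basicOpen f := by
  obtain ⟨n, b, hb⟩ := exists_ringRes_eq_pow_mul hU g f
  have hu := isUnit_ringRes_basicOpen g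
  have h : ringRes (X.basicOpen_le g) (g * b) = ringRes (X.basicOpen_le g) g ^ (n + 1) * f := by
    rw [map_mul, hb, pow_succ']; ring
  refine ⟨g * b, _, hu.pow (n + 1), h, ?_⟩
  have h1 : X.basicOpen (g * b) ≤ X.basicOpen g := by
    rw [Scheme.basicOpen_mul]; exact inf_le_left
  have h2 := X.basicOpen_res (g * b) (homOfLE (X.basicOpen_le g)).op
  rw [inf_eq_right.mpr h1] at h2
  rw [← h2]
  change X.basicOpen (ringRes (X.basicOpen_le g) (g * b)) = _
  rw [h, Scheme.basicOpen_mul, X.basicOpen_of_isUnit (hu.pow (n + 1))]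
  exact inf_eq_right.mpr (X.basicOpen_le f)

namespace IsQCAt

/-- The localization of `P(U)` at `g` localized at `f` is its localization at a function `f'` on
`U` with `D(f') = D(f)`. -/
theorem basicOpen (hU : IsAffineOpen U) (h : IsQCAt P U) (g : Γ(X, U)) :
    IsQCAt P (X.basicOpen g) where
  surj f t := by
    obtain ⟨f', v, hv, hf', hD⟩ := exists_basicOpen_basicOpen hU g f
    obtain ⟨n, s, hs⟩ := h.surj f' (secRes P hD.le t)
    obtain ⟨v, rfl⟩ := hv
    refine ⟨n, ((↑v⁻¹ : Γ(X, X.basicOpen g)) ^ n) • secRes P (X.basicOpen_le g) s, ?_⟩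
    have h1 := congr(secRes P hD.ge $hs)
    rw [secRes_smul, secRes_secRes, secRes_secRes, secRes_self, map_pow, ringRes_ringRes] at h1
    have h2 := congr(ringRes (X.basicOpen_le f) $hf')
    rw [ringRes_ringRes, map_mul] at h2
    rw [secRes_smul, secRes_secRes, h1, h2, smul_smul, map_pow, ← mul_pow, ← mul_assoc, ← map_mul]
    simp
  inj f s hs := by
    obtain ⟨f', v, hv, hf', hD⟩ := exists_basicOpen_basicOpen hU g f
    obtain ⟨j, s₀, hs₀⟩ := h.surj g s
    obtain ⟨n, hn⟩ := h.inj f' s₀ (by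
      have h1 := congr(secRes P hD.le (secRes P (X.basicOpen_le f) $hs₀))
      rw [secRes_smul P (X.basicOpen_le f), hs, smul_zero, map_zero, secRes_secRes,
        secRes_secRes] at h1
      exact h1)
    have h2 := congr(secRes P (X.basicOpen_le g) $hn)
    rw [secRes_smul, hs₀, map_zero, map_pow, hf', mul_pow, smul_smul, mul_assoc, mul_smul] at h2
    have h3 := eq_zero_of_isUnit_smul (hv.pow n) h2
    rw [mul_comm, mul_smul] at h3
    exact ⟨n, eq_zero_of_isUnit_smul ((isUnit_ringRes_basicOpen g).pow j) h3⟩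

end IsQCAt

/-- An ideal of functions on an affine open set is the unit ideal if it contains, for each point,
a function that does not vanish there. -/
lemma eq_top_of_forall_mem_basicOpen (hU : IsAffineOpen U) (a : Ideal Γ(X, U))
    (h : ∀ x ∈ U, ∃ f ∈ a, x ∈ X.basicOpen f) : a = ⊤ := by
  have h1 : Ideal.span (a : Set Γ(X, U)) = ⊤ := by
    rw [← hU.self_le_iSup_basicOpen_iff]
    intro x hx
    obtain ⟨f, hf, hxf⟩ := h x hx
    exact TopologicalSpace.Opens.mem_iSup.mpr ⟨⟨f, hf⟩, hxf⟩
  rwa [Ideal.span_eq] at h1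

lemma exists_finset_basicOpen (hU : IsAffineOpen U) (p : Γ(X, U) → Prop)
    (h : ∀ x ∈ U, ∃ f, p f ∧ x ∈ X.basicOpen f) :
    ∃ s : Finset Γ(X, U), (∀ f ∈ s, p f) ∧ ∀ x ∈ U, ∃ f ∈ s, x ∈ X.basicOpen f := by
  have h1 : Ideal.span {f | p f} = ⊤ := by
    rw [← hU.self_le_iSup_basicOpen_iff]
    intro x hx
    obtain ⟨f, hf, hxf⟩ := h x hx
    exact TopologicalSpace.Opens.mem_iSup.mpr ⟨⟨f, hf⟩, hxf⟩
  obtain ⟨s, hs, h2⟩ := (Ideal.span_eq_top_iff_finite _).mp h1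
  refine ⟨s, fun f hf => hs hf, fun x hx => ?_⟩
  obtain ⟨⟨f, hf⟩, hxf⟩ :=
    TopologicalSpace.Opens.mem_iSup.mp ((hU.self_le_iSup_basicOpen_iff (s := s)).mpr h2 hx)
  exact ⟨f, hf, hxf⟩

namespace IsQCAt

/-- The part of the localization property that concerns the vanishing of sections suffices for
the injectivity of the map to the associated sheaf. -/
lemma secUnit_eq_zero (hU : IsAffineOpen U)
    (h : ∀ (f : Γ(X, U)) (s : Sec P U), secRes P (X.basicOpen_le f) s = 0 → ∃ n : ℕ, f ^ n • s = 0)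
    {s : Sec P U} (hs : secUnit P U s = 0) : s = 0 := by
  let a : Ideal Γ(X, U) := LinearMap.ker (LinearMap.toSpanSingleton Γ(X, U) _ s)
  have ha : a = ⊤ := eq_top_of_forall_mem_basicOpen hU a fun x hx => by
    obtain ⟨V, hV, hxV, h0⟩ := secUnit_locally_injective hs hx
    obtain ⟨f, hf, hxf⟩ := hU.exists_basicOpen_le ⟨x, hxV⟩ hx
    obtain ⟨n, hn⟩ := h f s (by rw [← secRes_secRes hV hf, h0, map_zero])
    refine ⟨f ^ (n + 1), ?_, ?_⟩
    · change f ^ (n + 1) • s = 0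
      rw [pow_succ', mul_smul, hn, smul_zero]
    · rwa [Scheme.basicOpen_pow _ _ (Nat.succ_pos n)]
  have h1 : (1 : Γ(X, U)) ∈ a := ha ▸ trivial
  exact (one_smul _ s).symm.trans h1

lemma secUnit_injective (hU : IsAffineOpen U) (h : IsQCAt P U) :
    Function.Injective (secUnit P U) :=
  (injective_iff_map_eq_zero _).mpr fun _ hs => secUnit_eq_zero hU h.inj hs

/-- The sections of the associated sheaf are locally given by sections of `P`, for which a power of
`f` suffices; finitely many `D(g)` cover `U`. -/
lemma exists_pow_smul_eq_zero_of_sheafify (hU : IsAffineOpen U) (h : IsQCAt P U) (f : Γ(X, U))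
    (s : Sec (toPre (sheafify.obj P)) U)
    (hs : secRes (toPre (sheafify.obj P)) (X.basicOpen_le f) s = 0) : ∃ n : ℕ, f ^ n • s = 0 := by
  classical
  let p (g : Γ(X, U)) : Prop := ∃ t : Sec P (X.basicOpen g),
    secUnit P _ t = secRes (toPre (sheafify.obj P)) (X.basicOpen_le g) s
  obtain ⟨S, hS, hcov⟩ := exists_finset_basicOpen hU p fun x hx => by
    obtain ⟨V, hV, t, hxV, ht⟩ := secUnit_locally_surjective s hx
    obtain ⟨g, hg, hxg⟩ := hU.exists_basicOpen_le ⟨x, hxV⟩ hx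
    exact ⟨g, ⟨secRes P hg t, by rw [secUnit_secRes, ht, secRes_secRes]⟩, hxg⟩
  have hn (g : Γ(X, U)) (hg : p g) :
      ∃ n : ℕ, secRes (toPre (sheafify.obj P)) (X.basicOpen_le g) (f ^ n • s) = 0 := by
    obtain ⟨t, ht⟩ := hg
    have hQ := h.basicOpen hU g
    have hle : X.basicOpen (ringRes (X.basicOpen_le g) f) ≤ X.basicOpen f := by
      change X.basicOpen (X.presheaf.map _ f) ≤ _
      rw [Scheme.basicOpen_res]
      exact inf_le_right
    obtain ⟨n, hn⟩ := hQ.inj (ringRes (X.basicOpen_le g) f) t (by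
      apply secUnit_injective ((hU.basicOpen g).basicOpen _) (hQ.basicOpen (hU.basicOpen g) _)
      rw [secUnit_secRes, ht, secRes_secRes, map_zero, ← secRes_secRes (X.basicOpen_le f) hle, hs,
        map_zero])
    refine ⟨n, ?_⟩
    rw [secRes_smul, ← ht, map_pow, ← map_smul, hn, map_zero]
  choose! n hn using hn
  refine ⟨S.sup n, sec_eq_of_locally _ fun x hx => ?_⟩
  obtain ⟨g, hg, hxg⟩ := hcov x hx
  refine ⟨_, X.basicOpen_le g, hxg, ?_⟩
  have hle : n g ≤ S.sup n := Finset.le_sup hg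
  rw [← Nat.sub_add_cancel hle, pow_add, mul_smul, secRes_smul, hn g (hS g hg), smul_zero, map_zero]

/-- The functions `a` on `U` for which `a • t` comes from a section of `P` over `U` form an ideal
that is contained in no prime ideal. -/
lemma secUnit_surjective (hU : IsAffineOpen U) (h : IsQCAt P U) :
    Function.Surjective (secUnit P U) := by
  intro t
  let a : Ideal Γ(X, U) := (LinearMap.range (secUnit P U)).comap
    (LinearMap.toSpanSingleton Γ(X, U) _ t)
  have ha : a = ⊤ := eq_top_of_forall_mem_basicOpen hU a fun x hx => by
    obtain ⟨V, hV, s, hxV, hs⟩ := secUnit_locally_surjective t hx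
    obtain ⟨f, hf, hxf⟩ := hU.exists_basicOpen_le ⟨x, hxV⟩ hx
    obtain ⟨n, s', hs'⟩ := h.surj f (secRes P hf s)
    obtain ⟨m, hm⟩ := exists_pow_smul_eq_zero_of_sheafify hU h f (f ^ n • t - secUnit P U s') (by
      rw [map_sub, secRes_smul, ← secUnit_secRes, hs', map_smul, secUnit_secRes, hs,
        secRes_secRes, map_pow, sub_self])
    refine ⟨f ^ (m + n + 1), ⟨f • f ^ m • s', ?_⟩, ?_⟩
    · rw [smul_sub, sub_eq_zero, smul_smul, ← pow_add] at hm
      rw [map_smul, map_smul, ← hm, smul_smul, ← pow_succ']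
      rfl
    · rwa [Scheme.basicOpen_pow _ _ (Nat.succ_pos _)]
  have h1 : (1 : Γ(X, U)) ∈ a := ha ▸ trivial
  obtain ⟨y, hy⟩ := h1
  exact ⟨y, hy.trans (one_smul _ t)⟩

lemma secUnit_bijective (hU : IsAffineOpen U) (h : IsQCAt P U) :
    Function.Bijective (secUnit P U) :=
  ⟨h.secUnit_injective hU, h.secUnit_surjective hU⟩

lemma of_bijective (α : P ⟶ Q) (h : IsQCAt P U) (hU : Function.Bijective (secMap α U))
    (hD : ∀ f : Γ(X, U), Function.Bijective (secMap α (X.basicOpen f))) : IsQCAt Q U where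
  surj f t := by
    obtain ⟨t, rfl⟩ := (hD f).2 t
    obtain ⟨n, s, hs⟩ := h.surj f t
    exact ⟨n, secMap α U s, by rw [← secMap_secRes, hs, map_smul]⟩
  inj f s hs := by
    obtain ⟨s, rfl⟩ := hU.2 s
    rw [← secMap_secRes] at hs
    obtain ⟨n, hn⟩ := h.inj f s ((hD f).1 (hs.trans (map_zero _).symm))
    exact ⟨n, by rw [← map_smul, hn, map_zero]⟩

/-- The associated sheaf is quasi-coherent over `U` if the presheaf is. -/
protected theorem sheafify (hU : IsAffineOpen U) (h : IsQCAt P U) :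
    IsQCAt (toPre (sheafify.obj P)) U :=
  h.of_bijective _ (h.secUnit_bijective hU)
    fun f => (h.basicOpen hU f).secUnit_bijective (hU.basicOpen f)

end IsQCAt

end QuasiCoherence

/-! ### Comparison with modules on the spectrum -/

noncomputable section Affine

variable {X : Scheme.{u}} {U : X.Opens} (hU : IsAffineOpen U) (M : X.Modules)

lemma fromSpec_image_le (O : (Spec Γ(X, U)).Opens) : hU.fromSpec ''ᵁ O ≤ U := by
  calc _ ≤ hU.fromSpec ''ᵁ ⊤ := hU.fromSpec.image_mono le_top
    _ = U := by rw [Scheme.Hom.image_top_eq_opensRange, hU.opensRange_fromSpec]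

lemma fromSpec_image_top : hU.fromSpec ''ᵁ ⊤ = U := by
  rw [Scheme.Hom.image_top_eq_opensRange, hU.opensRange_fromSpec]

lemma fromSpec_appIso_inv (O : (Spec Γ(X, U)).Opens) (r : Γ(X, U)) :
    (hU.fromSpec.appIso O).inv ((Spec Γ(X, U)).presheaf.map O.leTop.op
      ((Scheme.ΓSpecIso Γ(X, U)).inv r)) = ringRes (fromSpec_image_le hU O) r := by
  have h : (Scheme.ΓSpecIso Γ(X, U)).inv ≫ (Spec Γ(X, U)).presheaf.map O.leTop.op =
      X.presheaf.map (homOfLE (fromSpec_image_le hU O)).op ≫ (hU.fromSpec.appIso O).hom := by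
    rw [Scheme.Hom.appIso_hom']
    rw [Scheme.Hom.map_appLE]
    rw [Scheme.Hom.appLE, hU.fromSpec_app_self, Category.assoc, ← Functor.map_comp]
    rfl
  have h' := congr((hU.fromSpec.appIso O).inv ($h r))
  refine h'.trans ?_
  simp

/-- The sections over `O` of the restriction of `M` to `Spec Γ(X, U)` are the sections of `M` over
the image of `O`, with the same action of `Γ(X, U)`. -/
lemma smul_restrict_fromSpec (O : (Spec Γ(X, U)).Opens) (r : Γ(X, U))
    (x : Γ(M.restrict hU.fromSpec, O)) :
    (r • x : Γ(M.restrict hU.fromSpec, O)) =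
      (ringRes (fromSpec_image_le hU O) r • (show Sec (toPre M) (hU.fromSpec ''ᵁ O) from x) :
        Sec (toPre M) (hU.fromSpec ''ᵁ O)) := by
  rw [Scheme.Modules.smul_Spec_def, ← fromSpec_appIso_inv]
  rfl

lemma isQCAt_iff_isLocalizing :
    IsQCAt (toPre M) U ↔ IsLocalizing (modulesSpecToSheaf.obj (M.restrict hU.fromSpec)) := by
  have e1 := fromSpec_image_top hU
  have e2 (f : Γ(X, U)) : hU.fromSpec ''ᵁ (PrimeSpectrum.basicOpen f) = X.basicOpen f :=
    hU.fromSpec_image_basicOpen f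
  have hle (f : Γ(X, U)) : hU.fromSpec ''ᵁ (PrimeSpectrum.basicOpen f) ≤ hU.fromSpec ''ᵁ ⊤ :=
    hU.fromSpec.image_mono le_top
  constructor
  · intro h f
    refine ⟨?_, ?_, ?_⟩
    · rw [Subtype.forall]
      change Submonoid.powers f ≤ (IsUnit.submonoid _).comap _
      rw [Submonoid.powers_le]
      exact (M.restrict hU.fromSpec).isUnit_algebraMap_end_of_le_basicOpen f le_rfl
    · intro (t : Sec (toPre M) (hU.fromSpec ''ᵁ (PrimeSpectrum.basicOpen f)))
      obtain ⟨n, s, hs⟩ := h.surj f (secRes (toPre M) (e2 f).ge t)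
      refine ⟨⟨secRes (toPre M) e1.le s, ⟨f ^ n, n, rfl⟩⟩, ?_⟩
      have h1 := congr(secRes (toPre M) (e2 f).le $hs)
      rw [secRes_smul, secRes_secRes, secRes_secRes, secRes_self, map_pow, ringRes_ringRes,
        ← map_pow] at h1
      refine (smul_restrict_fromSpec hU M _ _ _).trans ?_
      refine h1.symm.trans ?_
      exact (secRes_secRes e1.le (hle f) s).symm
    · intro (x : Sec (toPre M) (hU.fromSpec ''ᵁ ⊤)) (y : Sec (toPre M) (hU.fromSpec ''ᵁ ⊤)) hxy
      have h0 : secRes (toPre M) (hle f) (x - y) = 0 := by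
        rw [map_sub]
        exact sub_eq_zero.mpr hxy
      obtain ⟨n, hn⟩ := h.inj f (secRes (toPre M) e1.ge (x - y)) (by
        rw [secRes_secRes, ← secRes_secRes (hle f) (e2 f).ge, h0, map_zero])
      refine ⟨⟨f ^ n, n, rfl⟩, ?_⟩
      have h1 := congr(secRes (toPre M) e1.le $hn)
      rw [secRes_smul, secRes_secRes, secRes_self, map_zero, smul_sub, sub_eq_zero] at h1
      exact (smul_restrict_fromSpec hU M _ _ _).trans
        (h1.trans (smul_restrict_fromSpec hU M _ _ _).symm)
  · intro h
    refine ⟨fun f t => ?_, fun f s hs => ?_⟩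
    · obtain ⟨⟨(s : Sec (toPre M) (hU.fromSpec ''ᵁ ⊤)), ⟨_, n, rfl⟩⟩, hs⟩ :=
        (h f).surj (secRes (toPre M) (e2 f).le t)
      replace hs := (smul_restrict_fromSpec hU M _ _ _).symm.trans hs
      replace hs : ringRes (fromSpec_image_le hU _) (f ^ n) • secRes (toPre M) (e2 f).le t =
        secRes (toPre M) (hle f) s := hs
      refine ⟨n, secRes (toPre M) e1.ge s, ?_⟩
      have h1 := congr(secRes (toPre M) (e2 f).ge $hs)
      rw [secRes_smul, secRes_secRes, secRes_secRes, secRes_self, map_pow, map_pow,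
        ringRes_ringRes] at h1
      rw [secRes_secRes, h1]
    · obtain ⟨⟨_, n, rfl⟩, hn⟩ := (h f).exists_of_eq (x₁ := secRes (toPre M) e1.le s) (x₂ := 0) (by
        have h1 : secRes (toPre M) (hle f) (secRes (toPre M) e1.le s) = 0 := by
          rw [secRes_secRes, ← secRes_secRes (X.basicOpen_le f) (e2 f).le, hs, map_zero]
        exact h1.trans (map_zero _).symm)
      replace hn := (smul_restrict_fromSpec hU M _ _ _).symm.trans (hn.trans (smul_zero _))
      replace hn : ringRes e1.le (f ^ n) • secRes (toPre M) e1.le s = 0 := hn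
      refine ⟨n, ?_⟩
      have h1 := congr(secRes (toPre M) e1.ge $hn)
      rw [secRes_smul, secRes_secRes, secRes_self, ringRes_ringRes, ringRes_self, map_zero] at h1
      exact h1

/-- Over an affine open set `U`, the condition `IsQCAt` says that the restriction of `M` to
`Spec Γ(X, U)` is associated to a module. -/
lemma isQCAt_iff_isIso_fromTildeΓ :
    IsQCAt (toPre M) U ↔ IsIso (M.restrict hU.fromSpec).fromTildeΓ := by
  rw [isQCAt_iff_isLocalizing hU, isIso_fromTildeΓ_iff_isLocalizing]

lemma isQCAt_of_isQuasicoherent (hU : IsAffineOpen U) (M : X.Modules) [M.IsQuasicoherent] :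
    IsQCAt (toPre M) U := by
  rw [isQCAt_iff_isIso_fromTildeΓ hU]
  infer_instance

end Affine

/-! ### Morphisms out of an inverse image -/

lemma map_bijective_of_isIso_counit {C D : Type*} [Category C] [Category D] {L : C ⥤ D} {R : D ⥤ C}
    (adj : L ⊣ R) (M N : D) [IsIso (adj.counit.app M)] :
    Function.Bijective (fun u : M ⟶ N => R.map u) := by
  have h : (fun u : M ⟶ N => R.map u) =
      fun u => adj.homEquiv _ _ ((adj.counit.app M) ≫ u) := by
    funext u
    simp [Adjunction.homEquiv_unit]
  rw [h]
  refine (adj.homEquiv _ _).bijective.comp ⟨fun u v huv => ?_, fun u => ?_⟩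
  · exact (cancel_epi _).mp huv
  · exact ⟨inv (adj.counit.app M) ≫ u, by simp⟩

noncomputable section Pullback

variable {X Y : Scheme.{u}} {U : Y.Opens} (hU : IsAffineOpen U) (M : Y.Modules)

/-- A morphism from a sheaf that is quasi-coherent over `U` to a sheaf that comes from
`Spec Γ(Y, U)` amounts to a linear map on the sections over `U`. -/
lemma exists_unique_hom_of_isQCAt (hM : IsQCAt (toPre M) U) (G : (Spec Γ(Y, U)).Modules)
    (g : Sec (toPre M) U →ₗ[Γ(Y, U)] Γ(G, ⊤)) :
    ∃! v : M ⟶ (Scheme.Modules.pushforward hU.fromSpec).obj G, ∀ s : Γ(M, U),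
      G.presheaf.map (homOfLE hU.fromSpec_preimage_self.ge).op (v.app U s) = g s := by
  have e1 := fromSpec_image_top hU
  have hQ : IsIso (tilde.adjunction.counit.app (M.restrict hU.fromSpec)) :=
    (isQCAt_iff_isIso_fromTildeΓ hU M).mp hM
  have hbij := map_bijective_of_isIso_counit tilde.adjunction (M.restrict hU.fromSpec) G
  let adj := (Scheme.Modules.restrictAdjunction hU.fromSpec).homEquiv M G
  have key (w : M.restrict hU.fromSpec ⟶ G) (s : Γ(M, U)) :
      G.presheaf.map (homOfLE hU.fromSpec_preimage_self.ge).op ((adj w).app U s) =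
        w.app ⊤ (M.presheaf.map (homOfLE e1.le).op s) := by
    have h1 : adj w = _ := Adjunction.homEquiv_unit _ _ _ _
    rw [h1]
    have h2 : (M.presheaf.map (homOfLE e1.le).op s : Γ(M.restrict hU.fromSpec, ⊤)) =
        (M.restrict hU.fromSpec).presheaf.map (homOfLE hU.fromSpec_preimage_self.ge).op
          (M.presheaf.map (homOfLE (hU.fromSpec.image_preimage_le U)).op s) :=
      (secRes_secRes (P := toPre M) _ _ _).symm
    rw [h2]
    exact congr($(w.mapPresheaf.naturality (homOfLE hU.fromSpec_preimage_self.ge).op).hom _).symm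
  let g' : moduleSpecΓFunctor.obj (M.restrict hU.fromSpec) ⟶ moduleSpecΓFunctor.obj G :=
    ModuleCat.ofHom (X := Γ(M.restrict hU.fromSpec, ⊤)) (Y := Γ(G, ⊤))
      { toFun := fun x => g (secRes (toPre M) e1.ge x)
        map_add' := fun x y => (congrArg g (map_add (secRes (toPre M) e1.ge) x y)).trans
          (map_add g _ _)
        map_smul' := fun r x => by
          have h1 (y : Sec (toPre M) (hU.fromSpec ''ᵁ ⊤)) :
              g (secRes (toPre M) e1.ge (ringRes (fromSpec_image_le hU ⊤) r • y)) =
                r • g (secRes (toPre M) e1.ge y) := by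
            rw [secRes_smul, ringRes_ringRes, ringRes_self, map_smul]
          exact (congrArg (fun y => g (secRes (toPre M) e1.ge y))
            (smul_restrict_fromSpec hU M ⊤ r x)).trans (h1 x) }
  have hg' (x : Sec (toPre M) (hU.fromSpec ''ᵁ ⊤)) : g' x = g (secRes (toPre M) e1.ge x) := rfl
  obtain ⟨w, hw⟩ := hbij.2 g'
  refine ⟨adj w, fun s => ?_, fun v hv => ?_⟩
  · rw [key]
    have h1 := congr($hw (secRes (toPre M) e1.le s))
    refine Eq.trans h1 ?_
    rw [hg']
    exact congrArg g ((secRes_secRes (P := toPre M) e1.le e1.ge s).trans (secRes_self _ _))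
  · obtain ⟨w', rfl⟩ := adj.surjective v
    congr 1
    apply hbij.1
    refine Eq.trans ?_ hw.symm
    ext x
    have h1 := (key w' _).symm.trans (hv (secRes (toPre M) e1.ge x))
    refine Eq.trans ?_ h1
    refine congrArg (w'.app ⊤) ?_
    exact ((secRes_secRes (P := toPre M) e1.ge e1.le x).trans (secRes_self _ _)).symm

variable {M}

/-- The restriction to `V` of the inverse image of a section, as a semilinear map. -/
def pullbackSec (f : X ⟶ Y) {U : Y.Opens} {V : X.Opens} (e : V ≤ f ⁻¹ᵁ U) :
    Sec (toPre M) U →ₛₗ[(f.appLE U V e).hom]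
      Sec (toPre ((Scheme.Modules.pullback f).obj M)) V where
  toFun s := secRes (toPre ((Scheme.Modules.pullback f).obj M)) e (pullbackSection f s)
  map_add' s t := (congrArg (secRes (toPre ((Scheme.Modules.pullback f).obj M)) e)
    (map_add
      (secMap (preMap ((Scheme.Modules.pullbackPushforwardAdjunction f).unit.app M)) U) s t)).trans
    (map_add (secRes (toPre ((Scheme.Modules.pullback f).obj M)) e) _ _)
  map_smul' r s := by
    have h1 : pullbackSection f (r • s : Γ(M, U)) =
        (f.app U r • (show Sec (toPre ((Scheme.Modules.pullback f).obj M)) (f ⁻¹ᵁ U) from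
          pullbackSection f s) : Sec (toPre ((Scheme.Modules.pullback f).obj M)) (f ⁻¹ᵁ U)) :=
      Scheme.Modules.Hom.app_smul _ r s
    refine (congrArg (secRes (toPre ((Scheme.Modules.pullback f).obj M)) e) h1).trans ?_
    rw [secRes_smul]
    rfl

variable (M)

lemma smul_pushforward_SpecMap {R S : CommRingCat.{u}} (φ : R ⟶ S) (N : (Spec S).Modules) (r : R)
    (x : Γ((Scheme.Modules.pushforward (Spec.map φ)).obj N, ⊤)) :
    φ r • (show Γ(N, ⊤) from x) = (show Γ(N, ⊤) from r • x) := by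
  have h : ((Spec S).presheaf.map (TopologicalSpace.Opens.leTop ⊤).op)
      ((Scheme.ΓSpecIso S).inv (φ r)) =
      (Spec.map φ).app ⊤ (((Spec R).presheaf.map (TopologicalSpace.Opens.leTop ⊤).op)
        ((Scheme.ΓSpecIso R).inv r)) := by
    have h1 := congr($(Scheme.ΓSpecIso_inv_naturality φ) r)
    refine (congrArg _ h1).trans ?_
    change (Spec S).presheaf.map (𝟙 _) _ = (Spec.map φ).app ⊤ ((Spec R).presheaf.map (𝟙 _) _)
    rw [CategoryTheory.Functor.map_id, CategoryTheory.Functor.map_id]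
    rfl
  exact congrArg (fun a : Γ(Spec S, ⊤) => a • (show Γ(N, ⊤) from x)) h

/-- Morphisms out of the restriction of `f^*M` to an affine open set `V` that `f` maps to `U`
correspond to semilinear maps on `M(U)`, by adjunction. -/
lemma exists_unique_pullback_hom (hU : IsAffineOpen U) (hM : IsQCAt (toPre M) U) (f : X ⟶ Y)
    {V : X.Opens} (hV : IsAffineOpen V) (e : V ≤ f ⁻¹ᵁ U) (N : (Spec Γ(X, V)).Modules)
    (g : Sec (toPre M) U →ₛₗ[(f.appLE U V e).hom] Γ(N, ⊤)) :
    ∃! u : ((Scheme.Modules.pullback f).obj M).restrict hV.fromSpec ⟶ N,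
      ∀ s : Sec (toPre M) U, u.app ⊤ (secRes (toPre ((Scheme.Modules.pullback f).obj M))
        (fromSpec_image_top hV).le (pullbackSec f e s)) = g s := by
  let φ := f.appLE U V e
  have hcomp : hV.fromSpec ≫ f = Spec.map φ ≫ hU.fromSpec :=
    (IsAffineOpen.SpecMap_appLE_fromSpec f hU hV e).symm
  let G := (Scheme.Modules.pushforward (Spec.map φ)).obj N
  -- Both sheaves are the direct image of `N` under `Spec Γ(X, V) ⟶ Y`.
  let iso : (Scheme.Modules.pushforward f).obj ((Scheme.Modules.pushforward hV.fromSpec).obj N) ≅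
      (Scheme.Modules.pushforward hU.fromSpec).obj G :=
    (Scheme.Modules.pushforwardComp hV.fromSpec f).app N ≪≫
      (Scheme.Modules.pushforwardCongr hcomp).app N ≪≫
      ((Scheme.Modules.pushforwardComp (Spec.map φ) hU.fromSpec).app N).symm
  let E : (((Scheme.Modules.pullback f).obj M).restrict hV.fromSpec ⟶ N) ≃
      (M ⟶ (Scheme.Modules.pushforward hU.fromSpec).obj G) :=
    ((Scheme.Modules.restrictAdjunction hV.fromSpec).homEquiv _ N).trans
      (((Scheme.Modules.pullbackPushforwardAdjunction f).homEquiv M _).trans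
        (iso.homToEquiv))
  let g' : Sec (toPre M) U →ₗ[Γ(Y, U)] Γ(G, ⊤) :=
    { toFun := g
      map_add' := g.map_add
      map_smul' := fun r s => by
        rw [g.map_smulₛₗ]
        exact smul_pushforward_SpecMap φ N r (g s) }
  have key (u) (s : Sec (toPre M) U) :
      G.presheaf.map (homOfLE hU.fromSpec_preimage_self.ge).op ((E u).app U s) =
        u.app ⊤ (secRes (toPre ((Scheme.Modules.pullback f).obj M))
          (fromSpec_image_top hV).le (pullbackSec f e s)) := by
    have h1 : E u = (Scheme.Modules.pullbackPushforwardAdjunction f).unit.app M ≫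
        (Scheme.Modules.pushforward f).map ((Scheme.Modules.restrictAdjunction hV.fromSpec).unit.app
          _ ≫ (Scheme.Modules.pushforward hV.fromSpec).map u) ≫ iso.hom := by
      change ((Scheme.Modules.pullbackPushforwardAdjunction f).homEquiv M _
        ((Scheme.Modules.restrictAdjunction hV.fromSpec).homEquiv _ N u)) ≫ iso.hom = _
      rw [Adjunction.homEquiv_unit, Adjunction.homEquiv_unit, Category.assoc]
    have hle : hV.fromSpec ⁻¹ᵁ f ⁻¹ᵁ U = ⊤ := by
      rw [← Scheme.Hom.comp_preimage, hcomp, Scheme.Hom.comp_preimage, hU.fromSpec_preimage_self]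
      rfl
    have h2 : secRes (toPre ((Scheme.Modules.pullback f).obj M))
          (fromSpec_image_top hV).le (pullbackSec f e s) =
        (((Scheme.Modules.pullback f).obj M).restrict hV.fromSpec).presheaf.map
          (homOfLE hle.ge).op (secRes (toPre ((Scheme.Modules.pullback f).obj M))
            (hV.fromSpec.image_preimage_le _) (pullbackSection f s)) :=
      (secRes_secRes (P := toPre ((Scheme.Modules.pullback f).obj M)) _ _ _).trans
        (secRes_secRes (P := toPre ((Scheme.Modules.pullback f).obj M)) _ _ _).symm
    rw [h1, h2]
    have h3 := congr($(u.mapPresheaf.naturality (homOfLE hle.ge).op).hom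
      (secRes (toPre ((Scheme.Modules.pullback f).obj M))
            (hV.fromSpec.image_preimage_le _) (pullbackSection f s)))
    refine Eq.trans ?_ h3.symm
    exact secRes_secRes (P := toPre N) _ _ _
  obtain ⟨v, hv, hv'⟩ := exists_unique_hom_of_isQCAt hU M hM G g'
  refine ⟨E.symm v, fun s => ?_, fun u hu => ?_⟩
  · rw [← key, Equiv.apply_symm_apply]
    exact hv s
  · rw [Equiv.eq_symm_apply]
    exact hv' _ fun s => (key u s).trans (hu s)

end Pullback

/-! ### Semilinear base change -/

section Semilinear

variable {B C M N : Type*} [CommRing B] [CommRing C] [AddCommGroup M] [AddCommGroup N]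
  [Module B M] [Module C N] {σ : B →+* C}

/-- A semilinear map `M → N` along `σ : B → C` exhibits `N` as the base change of `M`. -/
def IsSemilinearBaseChange (ε : M →ₛₗ[σ] N) : Prop :=
  letI := σ.toAlgebra
  letI := Module.compHom N σ
  haveI : IsScalarTower B C N := .of_algebraMap_smul fun _ _ => rfl
  IsBaseChange C (show M →ₗ[B] N from
    { toFun := ε, map_add' := ε.map_add, map_smul' := ε.map_smulₛₗ })

lemma isSemilinearBaseChange_of_bijective (ε : M →ₛₗ[σ] N)
    (a : letI := σ.toAlgebra; C ⊗[B] M →ₗ[C] N)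
    (ha : letI := σ.toAlgebra; ∀ m, a (1 ⊗ₜ m) = ε m) (hb : Function.Bijective a) :
    IsSemilinearBaseChange ε := by
  let _ := σ.toAlgebra
  let _ := Module.compHom N σ
  have : IsScalarTower B C N := .of_algebraMap_smul fun _ _ => rfl
  exact IsBaseChange.of_equiv (LinearEquiv.ofBijective a hb) ha

lemma tensor_hom_ext {B C M N : Type*} [CommRing B] [CommRing C] [Algebra B C] [AddCommGroup M]
    [AddCommGroup N] [Module B M] [Module C N] {a b : C ⊗[B] M →ₗ[C] N}
    (h : ∀ m, a (1 ⊗ₜ m) = b (1 ⊗ₜ m)) : a = b := by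
  ext x
  induction x with
  | zero => simp
  | add x y hx hy => rw [map_add, map_add, hx, hy]
  | tmul c m =>
    rw [← mul_one c, ← smul_eq_mul, ← TensorProduct.smul_tmul', map_smul, map_smul, h]

lemma exists_lift_of_semilinear (ε : M →ₛₗ[σ] N) :
    letI := σ.toAlgebra
    ∃ a : C ⊗[B] M →ₗ[C] N, ∀ m, a (1 ⊗ₜ m) = ε m := by
  let _ := σ.toAlgebra
  let _ := Module.compHom N σ
  have : IsScalarTower B C N := .of_algebraMap_smul fun _ _ => rfl
  let l : M →ₗ[B] N := { toFun := ε, map_add' := ε.map_add, map_smul' := ε.map_smulₛₗ }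
  exact ⟨l.liftBaseChange C, fun m => by rw [LinearMap.liftBaseChange_tmul, one_smul]; rfl⟩

end Semilinear

/-! ### Sections of an inverse image -/

noncomputable section Tilde

variable {R : CommRingCat.{u}}

/-- The canonical map from a module to the sections of the associated sheaf on the spectrum. -/
def tildeTop (Q : ModuleCat.{u} R) : Q →ₗ[R] Γ(tilde Q, ⊤) := (tilde.toOpen Q ⊤).hom

lemma tildeTop_bijective (Q : ModuleCat.{u} R) : Function.Bijective (tildeTop Q) :=
  ConcreteCategory.bijective_of_isIso (tilde.toOpen Q ⊤)

/-- The sheaf associated to a module represents the functor of linear maps to global sections. -/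
lemma exists_unique_tilde_hom (Q : ModuleCat.{u} R) (Z : (Spec R).Modules) (a : Q →ₗ[R] Γ(Z, ⊤)) :
    ∃! w : tilde Q ⟶ Z, ∀ q, w.app ⊤ (tildeTop Q q) = a q := by
  let a' : Q ⟶ moduleSpecΓFunctor.obj Z := ModuleCat.ofHom (Y := Γ(Z, ⊤)) a
  have key (w : (tilde.functor R).obj Q ⟶ Z) (q : Q) :
      (tilde.adjunction.homEquiv Q Z w).hom q = w.app ⊤ (tildeTop Q q) := by
    rw [Adjunction.homEquiv_unit]
    rfl
  refine ⟨(tilde.adjunction.homEquiv Q Z).symm a', fun q => ?_, fun w hw => ?_⟩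
  · refine (key _ q).symm.trans ?_
    rw [Equiv.apply_symm_apply]
    rfl
  · refine (Equiv.eq_symm_apply _).mpr (ModuleCat.hom_ext (LinearMap.ext fun q => ?_))
    exact (key w q).trans (hw q)

end Tilde

noncomputable section Pullback

variable {X Y : Scheme.{u}} {U : Y.Opens} (M : Y.Modules)

/-- On an affine open set `V` that `f` maps to `U`, the inverse image `f^*M` is the sheaf associated
to `Γ(X, V) ⊗ M(U)`: by `exists_unique_pullback_hom` and `exists_unique_tilde_hom` both sheaves
represent the same functor on the modules over `Spec Γ(X, V)`. -/
theorem pullback_isQCAt_and_isSemilinearBaseChange (hU : IsAffineOpen U)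
    (hM : IsQCAt (toPre M) U) (f : X ⟶ Y) {V : X.Opens} (hV : IsAffineOpen V) (e : V ≤ f ⁻¹ᵁ U) :
    IsQCAt (toPre ((Scheme.Modules.pullback f).obj M)) V ∧
      IsSemilinearBaseChange (pullbackSec (M := M) f e) := by
  let _ : Algebra Γ(Y, U) Γ(X, V) := (f.appLE U V e).hom.toAlgebra
  let Z := ((Scheme.Modules.pullback f).obj M).restrict hV.fromSpec
  let P := toPre ((Scheme.Modules.pullback f).obj M)
  have e1 := fromSpec_image_top hV
  let Q : ModuleCat Γ(X, V) := ModuleCat.of Γ(X, V) (Γ(X, V) ⊗[Γ(Y, U)] Sec (toPre M) U)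
  let T := tilde Q
  let top : Q →ₗ[Γ(X, V)] Γ(T, ⊤) := tildeTop Q
  have htop : Function.Bijective top := tildeTop_bijective Q
  let g : Sec (toPre M) U →ₛₗ[(f.appLE U V e).hom] Γ(T, ⊤) :=
    { toFun := fun s => top (1 ⊗ₜ s)
      map_add' := fun s t => by rw [TensorProduct.tmul_add, map_add]
      map_smul' := fun r s => by
        rw [← map_smul, TensorProduct.tmul_smul]
        congr 1 }
  obtain ⟨u, hu, -⟩ := exists_unique_pullback_hom M hU hM f hV e T g
  let ε : Sec (toPre M) U →ₛₗ[(f.appLE U V e).hom] Γ(Z, ⊤) :=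
    { toFun := fun s => secRes P e1.le (pullbackSec f e s)
      map_add' := fun s t => (congrArg (secRes P e1.le) (map_add _ s t)).trans (map_add _ _ _)
      map_smul' := fun r s => by
        refine Eq.trans ?_ (smul_restrict_fromSpec hV _ ⊤ _ _).symm
        refine (congrArg (secRes P e1.le) ((pullbackSec f e).map_smulₛₗ r s)).trans ?_
        exact secRes_smul _ _ _ _ }
  obtain ⟨a, ha⟩ := exists_lift_of_semilinear ε
  obtain ⟨w, hw, -⟩ := exists_unique_tilde_hom Q Z a
  have huw : u ≫ w = 𝟙 Z := by
    refine (exists_unique_pullback_hom M hU hM f hV e Z ε).unique (fun s => ?_) (fun s => rfl)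
    change w.app ⊤ (u.app ⊤ _) = _
    rw [hu]
    exact (hw _).trans (ha s)
  have hwu : w ≫ u = 𝟙 T := by
    refine (exists_unique_tilde_hom Q T top).unique (fun q => ?_) (fun q => rfl)
    change u.app ⊤ (w.app ⊤ (tildeTop Q q)) = _
    rw [hw]
    let L1 : Γ(X, V) ⊗[Γ(Y, U)] Sec (toPre M) U →ₗ[Γ(X, V)] Γ(T, ⊤) :=
      (moduleSpecΓFunctor.map u).hom ∘ₗ a
    have h1 : L1 = top := by
      refine tensor_hom_ext fun s => ?_
      change u.app ⊤ (a (1 ⊗ₜ s)) = top (1 ⊗ₜ s)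
      rw [ha]
      exact hu s
    exact congr($h1 q)
  have hiso : IsIso (Scheme.Modules.fromTildeΓ Z) :=
    isIso_fromTildeΓ_iff.mpr ⟨Q, ⟨⟨w, u, hwu, huw⟩⟩⟩
  refine ⟨(isQCAt_iff_isIso_fromTildeΓ hV _).mpr hiso, ?_⟩
  have hab : Function.Bijective a := by
    have h1 : (a : _ → _) = (w.app ⊤) ∘ top := funext fun q => (hw q).symm
    rw [h1]
    refine Function.Bijective.comp ?_ htop
    have : IsIso w := ⟨u, hwu, huw⟩
    exact ConcreteCategory.bijective_of_isIso (w.app ⊤)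
  let b : Γ(Z, ⊤) →ₗ[Γ(X, V)] Sec P V :=
    { toFun := fun x => secRes P e1.ge x
      map_add' := fun x y => map_add (secRes P e1.ge) x y
      map_smul' := fun r x => by
        refine (congrArg (secRes P e1.ge) (smul_restrict_fromSpec hV _ ⊤ r x)).trans ?_
        refine (secRes_smul P e1.ge _ _).trans ?_
        rw [ringRes_ringRes, ringRes_self]
        rfl }
  have hb : Function.Bijective b :=
    Function.bijective_iff_has_inverse.mpr ⟨fun x => secRes P e1.le x,
      fun x => (secRes_secRes (P := P) e1.ge e1.le x).trans (secRes_self _ _),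
      fun x => (secRes_secRes (P := P) e1.le e1.ge x).trans (secRes_self _ _)⟩
  refine isSemilinearBaseChange_of_bijective _ (b ∘ₗ a) (fun m => ?_) (hb.comp hab)
  change b (a _) = _
  rw [ha]
  exact (secRes_secRes (P := P) e1.le e1.ge _).trans (secRes_self _ _)

end Pullback

/-! ### Localization of tensor products and symmetric powers -/

section Localization

variable {B B' M M' N N' : Type*} [CommRing B] [CommRing B'] [AddCommGroup M] [AddCommGroup M']
  [AddCommGroup N] [AddCommGroup N'] [Module B M] [Module B' M'] [Module B N] [Module B' N']
  {σ : B →+* B'} (f : B)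

/-- A semilinear map `M → M'` along `σ : B → B'` that is a localization with respect to the powers
of `f`, provided that `σ f` is a unit. -/
structure IsLocalAt (ρ : M →ₛₗ[σ] M') : Prop where
  surj (t : M') : ∃ (n : ℕ) (s : M), ρ s = σ f ^ n • t
  inj (s : M) (hs : ρ s = 0) : ∃ n : ℕ, f ^ n • s = 0

/-- A semilinear map, regarded as a linear map by restriction of scalars. -/
def linearOfSemilinear (ρ : M →ₛₗ[σ] M') :
    letI := Module.compHom M' σ
    M →ₗ[B] M' :=
  letI := Module.compHom M' σ
  { toFun := ρ, map_add' := ρ.map_add, map_smul' := ρ.map_smulₛₗ }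

variable {f}

lemma IsLocalAt.isLocalizedModule {ρ : M →ₛₗ[σ] M'} (h : IsLocalAt f ρ) (hf : IsUnit (σ f)) :
    letI := Module.compHom M' σ
    IsLocalizedModule (Submonoid.powers f) (linearOfSemilinear ρ) := by
  let _ := Module.compHom M' σ
  refine ⟨?_, fun t => ?_, fun {x y} hxy => ?_⟩
  · rw [Subtype.forall]
    change Submonoid.powers f ≤ (IsUnit.submonoid _).comap _
    rw [Submonoid.powers_le]
    change IsUnit (algebraMap B (Module.End B M') f)
    rw [Module.End.isUnit_iff]
    obtain ⟨v, hv⟩ := hf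
    refine Function.bijective_iff_has_inverse.mpr
      ⟨fun m => (↑v⁻¹ : B') • m, fun m => ?_, fun m => ?_⟩
    · change (↑v⁻¹ : B') • σ f • m = m
      rw [← hv, smul_smul, Units.inv_mul, one_smul]
    · change σ f • (↑v⁻¹ : B') • m = m
      rw [← hv, smul_smul, Units.mul_inv, one_smul]
  · obtain ⟨n, s, hs⟩ := h.surj t
    refine ⟨⟨s, ⟨f ^ n, n, rfl⟩⟩, ?_⟩
    change σ (f ^ n) • t = ρ s
    rw [hs, map_pow]
  · obtain ⟨n, hn⟩ := h.inj (x - y) (by rw [map_sub]; exact sub_eq_zero.mpr hxy)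
    rw [smul_sub, sub_eq_zero] at hn
    exact ⟨⟨f ^ n, n, rfl⟩, hn⟩

lemma IsLocalAt.tensor (hσ : letI := σ.toAlgebra; IsLocalization.Away f B') {ρ : M →ₛₗ[σ] M'}
    {ρ' : N →ₛₗ[σ] N'} (h : IsLocalAt f ρ) (h' : IsLocalAt f ρ') (τ : M ⊗[B] N →ₛₗ[σ] M' ⊗[B'] N')
    (hτ : ∀ m n, τ (m ⊗ₜ n) = ρ m ⊗ₜ ρ' n) : IsLocalAt f τ := by
  let _ := σ.toAlgebra
  let _ := Module.compHom M' σ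
  let _ := Module.compHom N' σ
  have : IsScalarTower B B' M' := .of_algebraMap_smul fun _ _ => rfl
  have : IsScalarTower B B' N' := .of_algebraMap_smul fun _ _ => rfl
  have hf : IsUnit (σ f) := IsLocalization.Away.algebraMap_isUnit (S := B') f
  have h1 := h.isLocalizedModule hf
  have h2 := h'.isLocalizedModule hf
  have h3 : IsLocalizedModule (Submonoid.powers f)
    (TensorProduct.map (linearOfSemilinear ρ) (linearOfSemilinear ρ')) := inferInstance
  let e := IsLocalization.moduleTensorEquiv (Submonoid.powers f) B' M' N'
  have he (x : M ⊗[B] N) : e (τ x) =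
      TensorProduct.map (linearOfSemilinear ρ) (linearOfSemilinear ρ') x := by
    induction x with
    | zero => simp
    | add x y hx hy => simp only [map_add, hx, hy]
    | tmul m n => rw [hτ]; rfl
  refine ⟨fun t => ?_, fun s hs => ?_⟩
  · obtain ⟨⟨s, ⟨_, n, rfl⟩⟩, hs⟩ := h3.surj (e t)
    refine ⟨n, s, e.injective ?_⟩
    rw [he, map_smul, ← map_pow]
    refine hs.symm.trans ?_
    exact (algebraMap_smul B' (f ^ n) (e t)).symm
  · obtain ⟨⟨_, n, rfl⟩, hn⟩ := h3.exists_of_eq (x₁ := s) (x₂ := 0) (by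
      rw [← he, hs, map_zero, map_zero])
    exact ⟨n, hn.trans (smul_zero _)⟩

lemma IsLocalAt.sym (hσ : letI := σ.toAlgebra; IsLocalization.Away f B') {ρ : M →ₛₗ[σ] M'}
    (h : IsLocalAt f ρ) (k : ℕ) : IsLocalAt f (symPowerMap ρ k) := by
  let _ := σ.toAlgebra
  let _ := Module.compHom M' σ
  have : IsScalarTower B B' M' := .of_algebraMap_smul fun _ _ => rfl
  have hf : IsUnit (σ f) := IsLocalization.Away.algebraMap_isUnit (S := B') f
  have h1 := h.isLocalizedModule hf
  refine ⟨?_, ?_⟩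
  · have hprod (m : Fin k → M') : ∃ (n : ℕ) (s : symPower B M k),
        symPowerMap ρ k s = σ f ^ n • symProd B' m := by
      choose n s hs using fun i => h.surj (m i)
      refine ⟨∑ i, n i, symProd B s, Subtype.ext ?_⟩
      change symMap ρ (∏ i, SymmetricAlgebra.ι B M (s i)) =
        σ f ^ (∑ i, n i) • ∏ i, SymmetricAlgebra.ι B' M' (m i)
      rw [map_prod, ← Finset.prod_pow_eq_pow_sum, ← Finset.prod_smul]
      exact Finset.prod_congr rfl fun i _ => by rw [symMap_ι, hs, map_smul]
    rintro ⟨t, ht⟩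
    have key : ∃ (n : ℕ) (s : symPower B M k), symMap ρ s = σ f ^ n • t := by
      unfold symPower at ht
      induction ht using Submodule.span_induction with
      | mem x hx =>
        obtain ⟨m, rfl⟩ := hx
        obtain ⟨n, s, hs⟩ := hprod m
        exact ⟨n, s, congrArg Subtype.val hs⟩
      | zero => exact ⟨0, 0, by simp⟩
      | add x y _ _ hx hy =>
        obtain ⟨n, s, hs⟩ := hx
        obtain ⟨n', s', hs'⟩ := hy
        refine ⟨n + n', f ^ n' • s + f ^ n • s', ?_⟩
        change symMapₛₗ ρ _ = _
        change symMapₛₗ ρ _ = _ at hs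
        change symMapₛₗ ρ _ = _ at hs'
        rw [Submodule.coe_add, Submodule.coe_smul, Submodule.coe_smul, map_add,
          LinearMap.map_smulₛₗ, LinearMap.map_smulₛₗ, hs, hs', smul_add, smul_smul, smul_smul,
          map_pow, map_pow, pow_add, mul_comm]
      | smul b x _ hx =>
        obtain ⟨n, s, hs⟩ := hx
        obtain ⟨c, ⟨_, j, rfl⟩, hc⟩ := IsLocalization.exists_mk'_eq (Submonoid.powers f) b
        have hc' : σ c = σ f ^ j * b := by
          rw [← hc, mul_comm, ← map_pow]
          exact (IsLocalization.mk'_spec (M := Submonoid.powers f) _ c ⟨f ^ j, j, rfl⟩).symm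
        refine ⟨j + n, c • s, ?_⟩
        change symMapₛₗ ρ _ = _
        change symMapₛₗ ρ _ = _ at hs
        rw [Submodule.coe_smul, LinearMap.map_smulₛₗ, hs, hc', smul_smul, smul_smul]
        congr 1
        ring
    obtain ⟨n, s, hs⟩ := key
    exact ⟨n, s, Subtype.ext hs⟩
  -- The homomorphism `Θ : Sym_{B'}(M') → B' ⊗ Sym_B(M)` shows that an element of `Sym_B(M)` that
  -- vanishes in `Sym_{B'}(M')` vanishes after localization.
  · have hbc : IsBaseChange B' (linearOfSemilinear ρ) :=
      (isLocalizedModule_iff_isBaseChange (Submonoid.powers f) B' _).mp h1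
    let S := SymmetricAlgebra B M
    let incl : S →ₐ[B] B' ⊗[B] S := Algebra.TensorProduct.includeRight
    let Θ : SymmetricAlgebra B' M' →ₐ[B'] B' ⊗[B] S :=
      SymmetricAlgebra.lift (hbc.lift (incl.toLinearMap ∘ₗ SymmetricAlgebra.ι B M))
    have hΘ (x : S) : Θ (symMap ρ x) = incl x := by
      induction x using SymmetricAlgebra.induction with
      | algebraMap r =>
        rw [symMap_algebraMap, AlgHom.commutes, AlgHom.commutes]
        exact (IsScalarTower.algebraMap_apply B B' (B' ⊗[B] S) r).symm
      | ι m =>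
        rw [symMap_ι, SymmetricAlgebra.lift_ι_apply]
        exact hbc.lift_eq _ m
      | mul a b ha hb => simp only [map_mul, ha, hb]
      | add a b ha hb => simp only [map_add, ha, hb]
    rintro ⟨s, hs'⟩ hs
    have h2 : incl s = 0 := by
      rw [← hΘ]
      have : symMap ρ s = 0 := congrArg Subtype.val hs
      rw [this, map_zero]
    have h3 : IsLocalizedModule (Submonoid.powers f) (TensorProduct.mk B B' S 1) := inferInstance
    obtain ⟨⟨_, n, rfl⟩, hn⟩ := h3.exists_of_eq (x₁ := s) (x₂ := 0) (h2.trans (map_zero _).symm)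
    exact ⟨n, Subtype.ext (hn.trans (smul_zero _))⟩

end Localization

/-! ### Tensor products, symmetric powers, kernels and cokernels -/

noncomputable section Constructions

variable {X : Scheme.{u}} {U V : X.Opens} {M N : X.Modules}

lemma isQCAt_iff_isLocalAt {P : X.PresheafOfModules} :
    IsQCAt P U ↔ ∀ f : Γ(X, U), IsLocalAt f (secRes P (X.basicOpen_le f)) :=
  ⟨fun h f => ⟨h.surj f, h.inj f⟩, fun h => ⟨fun f => (h f).surj, fun f => (h f).inj⟩⟩

lemma isQCAt_tensorPre (hU : IsAffineOpen U) (hM : IsQCAt (toPre M) U) (hN : IsQCAt (toPre N) U) :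
    IsQCAt (tensorPre M N) U := by
  rw [isQCAt_iff_isLocalAt] at *
  intro f
  refine IsLocalAt.tensor (hU.isLocalization_basicOpen f) (hM f) (hN f)
    (secRes (tensorPre M N) (X.basicOpen_le f)) fun m n => ?_
  exact PresheafOfModules.Monoidal.tensorObj_map_tmul (R := X.presheaf) _ _ _

lemma isQCAt_symPowPre (hU : IsAffineOpen U) (hM : IsQCAt (toPre M) U) (k : ℕ) :
    IsQCAt (symPowPre M k) U := by
  rw [isQCAt_iff_isLocalAt] at *
  intro f
  exact IsLocalAt.sym (hU.isLocalization_basicOpen f) (hM f) k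

variable (α : M ⟶ N)

lemma kernel_ι_injective (U : X.Opens) : Function.Injective (secMap (preMap (kernel.ι α)) U) := by
  let G := sectionsFunctor U
  have h : Mono (G.map (kernel.ι α)) := inferInstance
  exact (AddCommGrpCat.mono_iff_injective _).mp h

lemma exists_kernel_ι_eq {s : Sec (toPre M) U} (hs : secMap (preMap α) U s = 0) :
    ∃ t, secMap (preMap (kernel.ι α)) U t = s := by
  let G := sectionsFunctor U
  have h1 := isLimitForkMapOfIsLimit' G (kernel.condition α) (kernelIsKernel α)
  have h2 : (ShortComplex.mk (G.map (kernel.ι α)) (G.map α)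
    (by rw [← G.map_comp, kernel.condition, G.map_zero])).Exact :=
      ShortComplex.exact_of_f_is_kernel _ h1
  exact (ShortComplex.ab_exact_iff _).mp h2 s hs

lemma secMap_kernel_ι (t : Sec (toPre (kernel α)) U) :
    secMap (preMap α) U (secMap (preMap (kernel.ι α)) U t) = 0 :=
  congr(secMap (preMap $(kernel.condition α)) U t)

lemma isQCAt_kernel (hM : IsQCAt (toPre M) U) (hN : IsQCAt (toPre N) U) :
    IsQCAt (toPre (kernel α)) U where
  surj f t := by
    obtain ⟨n, s, hs⟩ := hM.surj f (secMap (preMap (kernel.ι α)) _ t)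
    obtain ⟨m, hm⟩ := hN.inj f (secMap (preMap α) U s) (by
      rw [← secMap_secRes, hs, map_smul, secMap_kernel_ι, smul_zero])
    rw [← map_smul] at hm
    obtain ⟨s', hs'⟩ := exists_kernel_ι_eq α hm
    refine ⟨m + n, s', kernel_ι_injective α _ ?_⟩
    rw [secMap_secRes, hs', secRes_smul, hs, map_smul, smul_smul, map_pow, pow_add]
  inj f s hs := by
    obtain ⟨n, hn⟩ := hM.inj f (secMap (preMap (kernel.ι α)) U s) (by
      rw [← secMap_secRes, hs, map_zero])
    exact ⟨n, kernel_ι_injective α _ (by rw [map_smul, hn, map_zero])⟩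

/-- The cokernel of a morphism of sheaves is the sheaf associated to the presheaf of the cokernels
on sections. -/
lemma exists_presheaf_cokernel : ∃ (Q : X.PresheafOfModules) (p : toPre N ⟶ Q)
    (κ : sheafify.obj Q ≅ cokernel α),
    (∀ U, Function.Surjective (secMap p U)) ∧
    (∀ U (s : Sec (toPre N) U), secMap p U s = 0 ↔ ∃ t, secMap (preMap α) U t = s) ∧
    ∀ U (s : Sec (toPre N) U), secMap (preMap κ.hom) U (secUnit Q U (secMap p U s)) =
      secMap (preMap (cokernel.π α)) U s := by
  let Q := cokernel (preMap α)
  let p : toPre N ⟶ Q := cokernel.π (preMap α)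
  let β : N ⟶ sheafify.obj Q := ofPreMap (p ≫ sheafifyUnit Q)
  have hαβ : α ≫ β = 0 := by
    apply preMap_injective
    rw [preMap_comp, preMap_ofPreMap, cokernel.condition_assoc, zero_comp]
    rfl
  have hc : preMap α ≫ preMap (cokernel.π α) = 0 := congr(preMap $(cokernel.condition α))
  let γ' : Q ⟶ toPre (cokernel α) := cokernel.desc (preMap α) (preMap (cokernel.π α)) hc
  obtain ⟨γ, hγ, -⟩ := exists_unique_sheafify_hom γ'
  let δ : cokernel α ⟶ sheafify.obj Q := cokernel.desc α β hαβ
  have hδ : cokernel.π α ≫ δ = β := cokernel.π_desc _ _ _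
  have hpγ : p ≫ γ' = preMap (cokernel.π α) := cokernel.π_desc _ _ _
  have h1 : δ ≫ γ = 𝟙 _ := by
    rw [← cancel_epi (cokernel.π α), ← Category.assoc, hδ, Category.comp_id]
    apply preMap_injective
    rw [preMap_comp, preMap_ofPreMap, Category.assoc, hγ, hpγ]
  have h2 : γ ≫ δ = 𝟙 _ := by
    refine (exists_unique_sheafify_hom (sheafifyUnit Q)).unique ?_ (Category.comp_id _)
    rw [preMap_comp, ← Category.assoc, hγ, ← cancel_epi p, ← Category.assoc, hpγ, ← preMap_comp,
      hδ, preMap_ofPreMap]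
  refine ⟨Q, p, ⟨γ, δ, h2, h1⟩, fun U => ?_, fun U s => ?_, fun U s => ?_⟩
  · have h : Epi ((PresheafOfModules.evaluation _ (op U)).map p) := inferInstance
    exact (ModuleCat.epi_iff_surjective _).mp h
  · let G := PresheafOfModules.toPresheaf X.ringCatSheaf.obj ⋙ (evaluation _ _).obj (op U)
    have h1 := isColimitCoforkMapOfIsColimit' G (cokernel.condition (preMap α))
      (cokernelIsCokernel (preMap α))
    have h2 : (ShortComplex.mk (G.map (preMap α)) (G.map p)
      (by rw [← G.map_comp, cokernel.condition, G.map_zero])).Exact :=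
        ShortComplex.exact_of_g_is_cokernel _ h1
    constructor
    · exact (ShortComplex.ab_exact_iff _).mp h2 s
    · rintro ⟨t, rfl⟩
      exact congr(secMap $(cokernel.condition (preMap α)) U t)
  · have := congr(secMap (p ≫ $hγ) U s)
    rw [hpγ] at this
    exact this

/-- The presheaf of the cokernels on sections is quasi-coherent over `U`, hence it has the same
sections over `U` as its associated sheaf. -/
theorem isQCAt_cokernel (hU : IsAffineOpen U) (hM : IsQCAt (toPre M) U) (hN : IsQCAt (toPre N) U) :
    IsQCAt (toPre (cokernel α)) U ∧ Function.Surjective (secMap (preMap (cokernel.π α)) U) ∧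
      ∀ s : Sec (toPre N) U, secMap (preMap (cokernel.π α)) U s = 0 ↔
        ∃ t, secMap (preMap α) U t = s := by
  obtain ⟨Q, p, κ, hp, hp', hκ⟩ := exists_presheaf_cokernel α
  have hQ : IsQCAt Q U := by
    refine ⟨fun f t => ?_, fun f s hs => ?_⟩
    · obtain ⟨t, rfl⟩ := hp _ t
      obtain ⟨n, s, hs⟩ := hN.surj f t
      exact ⟨n, secMap p U s, by rw [← secMap_secRes, hs, map_smul]⟩
    · obtain ⟨s, rfl⟩ := hp _ s
      rw [← secMap_secRes, hp'] at hs
      obtain ⟨t, ht⟩ := hs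
      obtain ⟨n, t', ht'⟩ := hM.surj f t
      obtain ⟨m, hm⟩ := hN.inj f (f ^ n • s - secMap (preMap α) U t') (by
        rw [map_sub, secRes_smul, ← secMap_secRes, ht', map_smul, ht, map_pow, sub_self])
      refine ⟨m + n, ?_⟩
      rw [← map_smul, hp']
      rw [smul_sub, sub_eq_zero, smul_smul, ← pow_add] at hm
      exact ⟨f ^ m • t', by rw [map_smul, hm]⟩
  have hκb (V : X.Opens) : Function.Bijective (secMap (preMap κ.hom) V) :=
    Function.bijective_iff_has_inverse.mpr ⟨secMap (preMap κ.inv) V,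
      fun s => congr(secMap (preMap $(κ.hom_inv_id)) V s),
      fun s => congr(secMap (preMap $(κ.inv_hom_id)) V s)⟩
  have hb := hQ.secUnit_bijective hU
  refine ⟨(hQ.sheafify hU).of_bijective _ (hκb _) fun f => hκb _, fun t => ?_, fun s => ?_⟩
  · obtain ⟨t, rfl⟩ := (hκb U).2 t
    obtain ⟨t, rfl⟩ := hb.2 t
    obtain ⟨s, rfl⟩ := hp U t
    exact ⟨s, (hκ U s).symm⟩
  · rw [← hp', ← hκ, map_eq_zero_iff _ (hκb U).1, map_eq_zero_iff _ hb.1]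

end Constructions

/-! ### The ideal sheaf, the structure sheaf and the conormal sheaf of a closed subscheme -/

noncomputable section ClosedSubscheme

variable {Y : Scheme.{u}} {U V : Y.Opens} (J : Y.IdealSheafData)

/-- A function, as a section of the structure module. -/
def structureSec (U : Y.Opens) : Γ(Y, U) ≃ₗ[Γ(Y, U)] Sec (toPre (structureModule Y)) U where
  toFun a := a
  invFun a := a
  map_add' _ _ := rfl
  map_smul' _ _ := rfl
  left_inv _ := rfl
  right_inv _ := rfl

lemma isQCAt_structureModule (hU : IsAffineOpen U) : IsQCAt (toPre (structureModule Y)) U where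
  surj f t := by
    obtain ⟨n, b, hb⟩ := exists_ringRes_eq_pow_mul hU f ((structureSec _).symm t)
    exact ⟨n, structureSec U b, hb⟩
  inj f s hs := exists_pow_mul_eq_zero hU f ((structureSec _).symm s) hs

/-- The restriction of functions to the closed subscheme defined by `J`. -/
def quotSec (U : Y.Opens) : Γ(Y, U) →ₗ[Γ(Y, U)] Sec (toPre (quotientModule J)) U :=
  secMap (preMap (toQuotient J)) U ∘ₗ (structureSec U).toLinearMap

lemma quotSec_ringRes (h : V ≤ U) (a : Γ(Y, U)) :
    quotSec J V (ringRes h a) = secRes (toPre (quotientModule J)) h (quotSec J U a) :=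
  secMap_secRes (preMap (toQuotient J)) h (structureSec U a)

lemma quotSec_surjective (hU : IsAffineOpen U) : Function.Surjective (quotSec J U) :=
  J.subschemeι_app_surjective ⟨U, hU⟩

lemma quotSec_eq_zero_iff (hU : IsAffineOpen U) (a : Γ(Y, U)) :
    quotSec J U a = 0 ↔ a ∈ J.ideal ⟨U, hU⟩ := by
  rw [← J.ker_subschemeι_app ⟨U, hU⟩]
  exact Iff.rfl

lemma secMap_quotientMap {J J' : Y.IdealSheafData} (h : J ≤ J') (U : Y.Opens) (a : Γ(Y, U)) :
    secMap (preMap (quotientMap h)) U (quotSec J U a) = quotSec J' U a :=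
  congr(secMap (preMap $(toQuotient_quotientMap h)) U a)

lemma isQCAt_quotientModule (hU : IsAffineOpen U) : IsQCAt (toPre (quotientModule J)) U where
  surj f t := by
    obtain ⟨a, rfl⟩ := quotSec_surjective J (hU.basicOpen f) t
    obtain ⟨n, b, hb⟩ := exists_ringRes_eq_pow_mul hU f a
    exact ⟨n, quotSec J U b, by rw [← quotSec_ringRes, hb, ← map_smul, smul_eq_mul]⟩
  inj f s hs := by
    obtain ⟨a, rfl⟩ := quotSec_surjective J hU s
    rw [← quotSec_ringRes, quotSec_eq_zero_iff J (hU.basicOpen f)] at hs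
    have h1 : (J.ideal ⟨U, hU⟩).map (ringRes (Y.basicOpen_le f)) =
      J.ideal ⟨Y.basicOpen f, hU.basicOpen f⟩ := J.map_ideal_basicOpen ⟨U, hU⟩ f
    rw [← h1] at hs
    have := hU.isLocalization_basicOpen f
    obtain ⟨⟨⟨b, hb⟩, ⟨_, n, rfl⟩⟩, h2⟩ :=
      (IsLocalization.mem_map_algebraMap_iff (Submonoid.powers f) Γ(Y, Y.basicOpen f)).mp hs
    have h3 : ringRes (Y.basicOpen_le f) (f ^ n * a - b) = 0 := by
      rw [map_sub, map_mul, mul_comm, sub_eq_zero]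
      exact h2
    obtain ⟨m, hm⟩ := exists_pow_mul_eq_zero hU f _ h3
    refine ⟨m + n, ?_⟩
    rw [← map_smul, quotSec_eq_zero_iff J hU, smul_eq_mul]
    rw [mul_sub, sub_eq_zero, ← mul_assoc, ← pow_add] at hm
    rw [hm]
    exact Ideal.mul_mem_left _ _ hb

/-- A section of the ideal sheaf over an affine open set, as an element of the ideal. -/
def idealSec (U : Y.Opens) : Sec (toPre (idealModule J)) U →ₗ[Γ(Y, U)] Γ(Y, U) :=
  (structureSec U).symm.toLinearMap ∘ₗ secMap (preMap (kernel.ι (toQuotient J))) U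

lemma idealSec_injective (U : Y.Opens) : Function.Injective (idealSec J U) :=
  kernel_ι_injective (toQuotient J) U

lemma range_idealSec (hU : IsAffineOpen U) (a : Γ(Y, U)) :
    (∃ t, idealSec J U t = a) ↔ a ∈ J.ideal ⟨U, hU⟩ := by
  rw [← quotSec_eq_zero_iff]
  constructor
  · rintro ⟨t, rfl⟩
    exact secMap_kernel_ι (toQuotient J) t
  · intro h
    exact exists_kernel_ι_eq (toQuotient J) (s := structureSec U a) h

lemma idealSec_secRes (h : V ≤ U) (t : Sec (toPre (idealModule J)) U) :
    idealSec J V (secRes _ h t) = ringRes h (idealSec J U t) :=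
  secMap_secRes (preMap (kernel.ι (toQuotient J))) h t

lemma isQCAt_idealModule (hU : IsAffineOpen U) : IsQCAt (toPre (idealModule J)) U :=
  isQCAt_kernel _ (isQCAt_structureModule hU) (isQCAt_quotientModule J hU)

lemma idealSec_idealMap {J J' : Y.IdealSheafData} (h : J ≤ J')
    (t : Sec (toPre (idealModule J)) U) :
    idealSec J' U (secMap (preMap (idealMap h)) U t) = idealSec J U t := by
  have h1 : idealMap h ≫ kernel.ι (toQuotient J') = kernel.ι (toQuotient J) :=
    (kernel.lift_ι _ _ _).trans (Category.comp_id _)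
  exact congr(secMap (preMap $h1) U t)

/-- The class in the conormal module of a section of the ideal. -/
def conormalSec (U : Y.Opens) :
    Sec (toPre (idealModule J)) U →ₗ[Γ(Y, U)] Sec (toPre (conormal J)) U :=
  secMap (preMap (cokernel.π (idealMap (sq_le J)))) U

lemma conormalSec_secRes (h : V ≤ U) (t : Sec (toPre (idealModule J)) U) :
    conormalSec J V (secRes _ h t) = secRes _ h (conormalSec J U t) :=
  secMap_secRes _ h t

lemma isQCAt_conormal (hU : IsAffineOpen U) : IsQCAt (toPre (conormal J)) U :=
  (isQCAt_cokernel _ hU (isQCAt_idealModule _ hU) (isQCAt_idealModule _ hU)).1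

lemma conormalSec_surjective (hU : IsAffineOpen U) : Function.Surjective (conormalSec J U) :=
  (isQCAt_cokernel _ hU (isQCAt_idealModule _ hU) (isQCAt_idealModule _ hU)).2.1

lemma conormalSec_eq_zero_iff (hU : IsAffineOpen U) (t : Sec (toPre (idealModule J)) U) :
    conormalSec J U t = 0 ↔ idealSec J U t ∈ J.ideal ⟨U, hU⟩ ^ 2 := by
  have h1 := (isQCAt_cokernel (idealMap (sq_le J)) hU (isQCAt_idealModule _ hU)
    (isQCAt_idealModule _ hU)).2.2 t
  have h2 : J.ideal ⟨U, hU⟩ ^ 2 = (J ^ 2).ideal ⟨U, hU⟩ := rfl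
  rw [h2, ← range_idealSec]
  refine h1.trans ⟨?_, ?_⟩
  · rintro ⟨s, rfl⟩
    exact ⟨s, (idealSec_idealMap _ s).symm⟩
  · rintro ⟨s, hs⟩
    exact ⟨s, idealSec_injective J U ((idealSec_idealMap _ s).trans hs)⟩

lemma tmul_one_surjective_and_ker {A M Q : Type*} [CommRing A] [AddCommGroup M]
    [Module A M] [AddCommGroup Q] [Module A Q] (I : Ideal A) (f : A →ₗ[A] Q)
    (hf : Function.Surjective f) (hI : ∀ a, f a = 0 ↔ a ∈ I) :
    Function.Surjective ((TensorProduct.mk A M Q).flip (f 1)) ∧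
      LinearMap.ker ((TensorProduct.mk A M Q).flip (f 1)) = I • ⊤ := by
  have h0 : I = LinearMap.ker f := by ext a; exact (hI a).symm
  subst h0
  let e : Q ≃ₗ[A] A ⧸ LinearMap.ker f := (f.quotKerEquivOfSurjective hf).symm
  let g : M ⊗[A] Q ≃ₗ[A] M ⧸ (LinearMap.ker f • ⊤ : Submodule A M) :=
    TensorProduct.congr (LinearEquiv.refl A M) e ≪≫ₗ
      TensorProduct.tensorQuotEquivQuotSMul M (LinearMap.ker f)
  have h : ∀ m : M, g (m ⊗ₜ f 1) = Submodule.Quotient.mk m := by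
    intro m
    have h1 : e (f 1) = Ideal.Quotient.mk _ 1 := by
      exact (LinearEquiv.symm_apply_eq _).mpr rfl
    change TensorProduct.tensorQuotEquivQuotSMul M (LinearMap.ker f) (m ⊗ₜ e (f 1)) = _
    rw [h1, TensorProduct.tensorQuotEquivQuotSMul_tmul_mk, one_smul]
  constructor
  · intro x
    obtain ⟨m, hm⟩ := Submodule.Quotient.mk_surjective _ (g x)
    exact ⟨m, g.injective ((h m).trans hm)⟩
  · ext m
    rw [LinearMap.mem_ker, LinearMap.flip_apply, TensorProduct.mk_apply,
      ← map_eq_zero_iff g g.injective, h,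
      Submodule.Quotient.mk_eq_zero]

variable (M : Y.Modules)

lemma secRes_tmul {M N : Y.Modules} (h : V ≤ U) (m : Sec (toPre M) U) (n : Sec (toPre N) U) :
    secRes (tensorPre M N) h (m ⊗ₜ[Γ(Y, U)] n : Sec (toPre M) U ⊗[Γ(Y, U)] Sec (toPre N) U) =
      (secRes (toPre M) h m ⊗ₜ[Γ(Y, V)] secRes (toPre N) h n :
        Sec (toPre M) V ⊗[Γ(Y, V)] Sec (toPre N) V) :=
  PresheafOfModules.Monoidal.tensorObj_map_tmul (R := Y.presheaf) (M₁ := toPre M)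
    (M₂ := toPre N) (homOfLE h).op m n

/-- The map `M → M ⊗ 𝒪_Z` on sections. -/
def tensorQuotSec (U : Y.Opens) :
    Sec (toPre M) U →ₗ[Γ(Y, U)] Sec (toPre (tensor M (quotientModule J))) U :=
  secUnit (tensorPre M (quotientModule J)) U ∘ₗ
    (TensorProduct.mk Γ(Y, U) (Sec (toPre M) U) (Sec (toPre (quotientModule J)) U)).flip
      (quotSec J U 1)

lemma tensorQuotSec_secRes (h : V ≤ U) (s : Sec (toPre M) U) :
    tensorQuotSec J M V (secRes _ h s) = secRes _ h (tensorQuotSec J M U s) := by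
  refine Eq.trans ?_ (secUnit_secRes (P := tensorPre M (quotientModule J)) h _)
  have h1 : quotSec J V 1 = secRes _ h (quotSec J U 1) :=
    (congrArg (quotSec J V) (map_one (ringRes h)).symm).trans (quotSec_ringRes J h 1)
  refine congrArg (secUnit (tensorPre M (quotientModule J)) V) ?_
  exact (congrArg (fun z => secRes (toPre M) h s ⊗ₜ[Γ(Y, V)] z) h1).trans
    (secRes_tmul h s (quotSec J U 1)).symm

lemma isQCAt_tensorQuot (hU : IsAffineOpen U) (hM : IsQCAt (toPre M) U) :
    IsQCAt (toPre (tensor M (quotientModule J))) U :=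
  (isQCAt_tensorPre hU hM (isQCAt_quotientModule J hU)).sheafify hU

/-- Over an affine open set, `M ⊗ 𝒪_Z` is the quotient of `M` by the ideal of `Z`. -/
lemma tensorQuotSec_surjective_and_ker (hU : IsAffineOpen U) (hM : IsQCAt (toPre M) U) :
    Function.Surjective (tensorQuotSec J M U) ∧
      LinearMap.ker (tensorQuotSec J M U) = J.ideal ⟨U, hU⟩ • ⊤ := by
  have h1 := (isQCAt_tensorPre hU hM (isQCAt_quotientModule J hU)).secUnit_bijective hU
  have h2 := tmul_one_surjective_and_ker (M := Sec (toPre M) U) (J.ideal ⟨U, hU⟩) (quotSec J U)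
    (quotSec_surjective J hU) (quotSec_eq_zero_iff J hU)
  refine ⟨h1.2.comp h2.1, ?_⟩
  rw [← h2.2]
  ext m
  exact map_eq_zero_iff (secUnit (tensorPre M (quotientModule J)) U) h1.1

lemma secMap_tensorMap_quotientMap {J J' : Y.IdealSheafData} (h : J ≤ J') (U : Y.Opens)
    (m : Sec (toPre M) U) :
    secMap (preMap (tensorMap M (quotientMap h))) U (tensorQuotSec J M U m) =
      tensorQuotSec J' M U m := by
  refine (secMap_sheafify_map (P := tensorPre M (quotientModule J))
    (Q := tensorPre M (quotientModule J')) _ U _).trans ?_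
  refine congrArg (secUnit (tensorPre M (quotientModule J')) U) ?_
  exact congrArg (fun z => m ⊗ₜ[Γ(Y, U)] z) (secMap_quotientMap h U 1)

end ClosedSubscheme

/-! ### Affine neighborhoods of the diagonal -/

section Neighborhoods

variable {X S : Scheme.{u}} (π : X ⟶ S) {U V : X.Opens}

/-- An affine open set of `X` that lies over an affine open set of `S`. -/
def IsSmall (U : X.Opens) : Prop :=
  IsAffineOpen U ∧ ∃ V : S.Opens, IsAffineOpen V ∧ U ≤ π ⁻¹ᵁ V

variable {π} in
lemma IsSmall.mono (h : IsSmall π U) (hV : IsAffineOpen V) (e : V ≤ U) : IsSmall π V :=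
  ⟨hV, h.2.choose, h.2.choose_spec.1, e.trans h.2.choose_spec.2⟩

variable {π} in
lemma IsSmall.basicOpen (h : IsSmall π U) (f : Γ(X, U)) : IsSmall π (X.basicOpen f) :=
  h.mono (h.1.basicOpen f) (X.basicOpen_le f)

lemma exists_isSmall_mem_le {x : X} (hx : x ∈ U) : ∃ V, IsSmall π V ∧ x ∈ V ∧ V ≤ U := by
  obtain ⟨V, hV, hxV, -⟩ := exists_isAffineOpen_mem_and_subset (U := ⊤) (x := π x) trivial
  obtain ⟨W, hW, hxW, e⟩ := exists_isAffineOpen_mem_and_subset (U := U ⊓ π ⁻¹ᵁ V) (x := x) ⟨hx, hxV⟩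
  exact ⟨W, ⟨hW, V, hV, e.trans inf_le_right⟩, hxW, e.trans inf_le_left⟩

variable {π}

/-- If `U` lies over the affine open set `V` of `S`, then `p⁻¹U ∩ q⁻¹U` is `U ×_V U`. -/
lemma IsSmall.isAffineOpen_inf (h : IsSmall π U) :
    IsAffineOpen (pullback.fst π π ⁻¹ᵁ U ⊓ pullback.snd π π ⁻¹ᵁ U) := by
  obtain ⟨hU, V, hV, e⟩ := h
  have : IsAffine U := hU
  have : IsAffine V := hV
  let f : (U : Scheme.{u}) ⟶ V := π.resLE V U e
  let g : pullback f f ⟶ pullback π π :=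
    pullback.map f f π π U.ι U.ι V.ι (by simp [f]) (by simp [f])
  have h1 : g.opensRange = pullback.fst π π ⁻¹ᵁ U ⊓ pullback.snd π π ⁻¹ᵁ U := by
    ext1
    refine (Scheme.Pullback.range_map _ _ _ _ _ _ _ _ _).trans ?_
    simp
  rw [← h1]
  exact isAffineOpen_opensRange g

lemma diagonal_preimage_inf (U : X.Opens) :
    pullback.diagonal π ⁻¹ᵁ (pullback.fst π π ⁻¹ᵁ U ⊓ pullback.snd π π ⁻¹ᵁ U) = U := by
  rw [Scheme.Hom.preimage_inf, ← Scheme.Hom.comp_preimage, ← Scheme.Hom.comp_preimage,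
    pullback.diagonal_fst, pullback.diagonal_snd, inf_idem]
  rfl

/-- The diagonal of a small open set is closed in the affine open set `p⁻¹U ∩ q⁻¹U`, because the
restriction of functions to it is surjective. -/
lemma IsSmall.le_diagNhd (h : IsSmall π U) :
    pullback.fst π π ⁻¹ᵁ U ⊓ pullback.snd π π ⁻¹ᵁ U ≤ diagNhd π := by
  set O := pullback.fst π π ⁻¹ᵁ U ⊓ pullback.snd π π ⁻¹ᵁ U
  have : IsAffine O := h.isAffineOpen_inf
  have : IsAffine (pullback.diagonal π ⁻¹ᵁ O : X.Opens) := by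
    rw [diagonal_preimage_inf]; exact h.1
  have h2 : Function.Surjective (pullback.diagonal π ∣_ O).appTop := by
    let O' := pullback.diagonal π ⁻¹ᵁ O
    let r : (O : Scheme.{u}) ⟶ O' := IsOpenImmersion.lift O'.ι (O.ι ≫ pullback.fst π π) (by
      rw [Scheme.Opens.range_ι]
      rintro _ ⟨x, rfl⟩
      exact (diagonal_preimage_inf U).ge x.2.1)
    have hr : (pullback.diagonal π ∣_ O) ≫ r = 𝟙 _ := by
      rw [← cancel_mono O'.ι, Category.assoc, IsOpenImmersion.lift_fac,
        morphismRestrict_ι_assoc, pullback.diagonal_fst, Category.comp_id, Category.id_comp]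
    intro a
    exact ⟨r.appTop a, congr((Scheme.Hom.appTop $hr) a)⟩
  have : IsClosedImmersion (pullback.diagonal π ∣_ O) := .of_surjective_of_isAffine _ h2
  have h3 : IsClosed (O.ι ⁻¹' Set.range (pullback.diagonal π)) := by
    convert! (pullback.diagonal π ∣_ O).isClosedEmbedding.isClosed_range using 1
    ext y
    constructor
    · rintro ⟨x, hx⟩
      have hxO : pullback.diagonal π x ∈ O := by rw [hx]; exact y.2
      exact ⟨⟨x, hxO⟩, Subtype.ext ((morphismRestrict_base_coe _ _ _).trans hx)⟩
    · rintro ⟨x, rfl⟩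
      exact ⟨x.1, (morphismRestrict_base_coe _ _ _).symm⟩
  -- `diagNhd π` is the coborder of the image of the diagonal, and this is local.
  have h4 := O.ι.isOpenEmbedding.coborder_preimage (Set.range (pullback.diagonal π))
  rw [h3.coborder_eq] at h4
  intro x hx
  exact h4.le (Set.mem_univ (⟨x, hx⟩ : O))

lemma IsSmall.isAffineOpen_nhd (h : IsSmall π U) : IsAffineOpen (nhd π U) :=
  h.isAffineOpen_inf.preimage_of_isOpenImmersion (diagNhd π).ι
    (by rw [Scheme.Opens.opensRange_ι]; exact h.le_diagNhd)

lemma diag_preimage_nhd (U : X.Opens) : diag π ⁻¹ᵁ nhd π U = U := by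
  refine le_antisymm (fun x hx => ?_) (le_diag_preimage_nhd π U)
  have h1 : diag π ⁻¹ᵁ proj₁ π ⁻¹ᵁ U = U := by
    rw [← Scheme.Hom.comp_preimage, diag_proj₁]; rfl
  exact h1.le hx.1

noncomputable section

variable (π)

lemma nhd_le₁ (U : X.Opens) : nhd π U ≤ proj₁ π ⁻¹ᵁ U := inf_le_left

lemma nhd_le₂ (U : X.Opens) : nhd π U ≤ proj₂ π ⁻¹ᵁ U := inf_le_right

lemma appLE_comp_appLE_of_comp_eq_id {Y : Scheme.{u}} {f : Y ⟶ X} {g : X ⟶ Y} (h : g ≫ f = 𝟙 X)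
    {V : Y.Opens} (e : V ≤ f ⁻¹ᵁ U) (e' : U ≤ g ⁻¹ᵁ V) :
    f.appLE U V e ≫ g.appLE V U e' = 𝟙 _ := by
  rw [Scheme.Hom.appLE_comp_appLE]
  simp only [h]
  refine (Category.id_comp _).trans ?_
  exact X.presheaf.map_id _

lemma ringRes_eq_zero_iff (h : V ≤ U) (h' : U ≤ V) (a : Γ(X, U)) : ringRes h a = 0 ↔ a = 0 := by
  refine ⟨fun h0 => ?_, fun h0 => by rw [h0, map_zero]⟩
  rw [← ringRes_self le_rfl a, ← ringRes_ringRes h h', h0, map_zero]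

/-- `p^♯` on functions, from `U` to the neighborhood `p⁻¹U ∩ q⁻¹U` of the diagonal. -/
def projHom₁ (U : X.Opens) : Γ(X, U) →+* Γ(diagNhd π, nhd π U) :=
  ((proj₁ π).appLE U (nhd π U) (nhd_le₁ π U)).hom

/-- `q^♯` on functions, from `U` to the neighborhood `p⁻¹U ∩ q⁻¹U` of the diagonal. -/
def projHom₂ (U : X.Opens) : Γ(X, U) →+* Γ(diagNhd π, nhd π U) :=
  ((proj₂ π).appLE U (nhd π U) (nhd_le₂ π U)).hom

/-- Restriction of functions on `p⁻¹U ∩ q⁻¹U` to the diagonal. -/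
def diagHom (U : X.Opens) : Γ(diagNhd π, nhd π U) →+* Γ(X, U) :=
  ((diag π).appLE (nhd π U) U (le_diag_preimage_nhd π U)).hom

lemma diagHom_projHom₁ (U : X.Opens) (b : Γ(X, U)) : diagHom π U (projHom₁ π U b) = b :=
  congr($(appLE_comp_appLE_of_comp_eq_id (diag_proj₁ π) _ _) b)

lemma diagHom_projHom₂ (U : X.Opens) (b : Γ(X, U)) : diagHom π U (projHom₂ π U b) = b :=
  congr($(appLE_comp_appLE_of_comp_eq_id (diag_proj₂ π) _ _) b)

instance : IsClosedImmersion (diag π) :=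
  inferInstanceAs (IsClosedImmersion (pullback.diagonal π).liftCoborder)

variable {π}

lemma diagIdeal_ideal (hN : IsAffineOpen (nhd π U)) :
    (diagIdeal π).ideal ⟨nhd π U, hN⟩ = RingHom.ker (diagHom π U) := by
  refine (Scheme.Hom.ker_apply (diag π) ⟨nhd π U, hN⟩).trans ?_
  ext a
  exact (ringRes_eq_zero_iff (le_diag_preimage_nhd π U) (diag_preimage_nhd U).le _).symm

lemma projHom₁_smooth [Smooth π] (h : IsSmall π U) : (projHom₁ π U).Smooth := by
  have : Smooth (proj₁ π) := by unfold proj₁; infer_instance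
  exact (proj₁ π).smooth_appLE h.1 h.isAffineOpen_nhd _

lemma projHom₂_smooth [Smooth π] (h : IsSmall π U) : (projHom₂ π U).Smooth := by
  have : Smooth (proj₂ π) := by unfold proj₂; infer_instance
  exact (proj₂ π).smooth_appLE h.1 h.isAffineOpen_nhd _

end

end Neighborhoods

/-! ### Supports and differential forms -/

/-- Base change along a surjective ring homomorphism does not change a module that is killed by
the kernel. -/
lemma IsSemilinearBaseChange.bijective_of_surjective {B C M N : Type*} [CommRing B] [CommRing C]
    [AddCommGroup M] [AddCommGroup N] [Module B M] [Module C N] {σ : B →+* C} {ε : M →ₛₗ[σ] N}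
    (h : IsSemilinearBaseChange ε) (hσ : Function.Surjective σ)
    (hM : ∀ b, σ b = 0 → ∀ m : M, b • m = 0) : Function.Bijective ε := by
  let _ := σ.toAlgebra
  let _ := Module.compHom N σ
  have : IsScalarTower B C N := .of_algebraMap_smul fun _ _ => rfl
  let ε' : M →ₗ[B] N := { toFun := ε, map_add' := ε.map_add, map_smul' := ε.map_smulₛₗ }
  have h' : IsBaseChange C ε' := h
  let _ : SMul C M := ⟨fun c m => Function.surjInv hσ c • m⟩
  have hs (b : B) (m : M) : σ b • m = b • m := by
    change Function.surjInv hσ (σ b) • m = b • m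
    rw [← sub_eq_zero, ← sub_smul]
    exact hM _ (by rw [map_sub, Function.surjInv_eq hσ, sub_self]) m
  let _ : Module C M := Function.Surjective.moduleLeft σ hσ hs
  have : IsScalarTower B C M := .of_algebraMap_smul hs
  let g : N →ₗ[C] M := h'.lift LinearMap.id
  have hg (m : M) : g (ε m) = m := h'.lift_eq LinearMap.id m
  let f : M →ₗ[C] N :=
    { toFun := ε, map_add' := ε.map_add, map_smul' := fun c m => by
        obtain ⟨b, rfl⟩ := hσ c
        rw [hs]
        exact ε.map_smulₛₗ b m }
  have hf : f ∘ₗ g = LinearMap.id :=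
    h'.algHom_ext _ _ fun m => congrArg ε (hg m)
  exact Function.bijective_iff_has_inverse.mpr ⟨g, hg, fun n => congr($hf n)⟩

section Support

variable {Y : Scheme.{u}} {O V : Y.Opens} (J : Y.IdealSheafData)

lemma subsingleton_quotientModule (h : ∀ x ∈ O, x ∉ J.support) :
    Subsingleton (Sec (toPre (quotientModule J)) O) := by
  have h1 : J.subschemeι ⁻¹ᵁ O = ⊥ := by
    ext x
    refine ⟨fun hx => (h _ hx ?_).elim, False.elim⟩
    rw [← SetLike.mem_coe, ← J.range_subschemeι]
    exact ⟨x, rfl⟩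
  have h2 : Subsingleton Γ(J.subscheme, J.subschemeι ⁻¹ᵁ O) := by
    rw [h1]; infer_instance
  exact h2

lemma subsingleton_tensorQuot (M : Y.Modules) (h : ∀ x ∈ O, x ∉ J.support) :
    Subsingleton (Sec (toPre (tensor M (quotientModule J))) O) := by
  refine subsingleton_of_forall_eq 0 fun t => sec_eq_of_locally _ fun x hx => ?_
  obtain ⟨V, hV, s, hxV, hs⟩ := secUnit_locally_surjective t hx
  have h1 := subsingleton_quotientModule J fun x hx => h x (hV hx)
  have h2 : Subsingleton (Sec (toPre M) V ⊗[Γ(Y, V)] Sec (toPre (quotientModule J)) V) := by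
    refine subsingleton_of_forall_eq 0 fun z => ?_
    induction z with
    | zero => rfl
    | add x y hx hy => rw [hx, hy, add_zero]
    | tmul m n => rw [Subsingleton.elim n 0, TensorProduct.tmul_zero]
  have h3 : s = 0 := h2.elim _ _
  refine ⟨V, hV, hxV, hs.symm.trans ?_⟩
  rw [h3, map_zero]
  exact (map_zero (secRes (toPre (tensor M (quotientModule J))) hV)).symm

/-- The sections of `M ⊗ 𝒪_Z` only depend on a neighborhood of `Z`. -/
lemma secRes_tensorQuot_bijective (M : Y.Modules) (h : V ≤ O)
    (hV : ∀ x ∈ O, x ∈ J.support → x ∈ V) :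
    Function.Bijective (secRes (toPre (tensor M (quotientModule J))) h) := by
  set G := tensor M (quotientModule J)
  let O' : Y.Opens := O ⊓ ⟨(J.support : Set Y)ᶜ, J.support.isClosed.isOpen_compl⟩
  have h0 (T : Y.Opens) (hT : T ≤ O') : Subsingleton (Sec (toPre G) T) :=
    subsingleton_tensorQuot J M fun x hx => (hT hx).2
  constructor
  · intro s t hst
    refine sec_eq_of_locally G fun x hx => ?_
    by_cases hxV : x ∈ J.support
    · exact ⟨V, h, hV x hx hxV, hst⟩
    · exact ⟨O', inf_le_left, ⟨hx, hxV⟩, (h0 _ le_rfl).elim _ _⟩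
  · intro t
    -- Extension of `t` by zero on the complement of `Z`.
    let T (i : ULift.{u} Bool) : Y.Opens := if i.down then V else O'
    have hT (i) : T i ≤ O := by
      obtain ⟨_ | _⟩ := i
      exacts [inf_le_left, h]
    let s (i : ULift.{u} Bool) : Sec (toPre G) (T i) := match i with
      | ⟨true⟩ => t
      | ⟨false⟩ => 0
    have hcov : O ≤ iSup T := fun x hx => by
      refine TopologicalSpace.Opens.mem_iSup.mpr ?_
      by_cases hxV : x ∈ J.support
      · exact ⟨⟨true⟩, hV x hx hxV⟩
      · exact ⟨⟨false⟩, hx, hxV⟩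
    have hcomp (i j) : secRes (toPre G) inf_le_left (s i) =
        secRes (toPre G) (inf_le_right : T i ⊓ T j ≤ T j) (s j) := by
      match i, j with
      | ⟨true⟩, ⟨true⟩ => rfl
      | ⟨false⟩, _ => exact (h0 _ inf_le_left).elim _ _
      | ⟨true⟩, ⟨false⟩ => exact (h0 _ inf_le_right).elim _ _
    obtain ⟨t', ht'⟩ := exists_sec_of_locally G T hT hcov s hcomp
    exact ⟨t', ht' ⟨true⟩⟩

end Support

noncomputable section Forms

variable {X S : Scheme.{u}} (π : X ⟶ S) {U V : X.Opens}

/-- The functions on `p⁻¹U ∩ q⁻¹U` that vanish on the diagonal. -/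
abbrev DiagSec (U : X.Opens) : Type u := Sec (toPre (idealModule (diagIdeal π))) (nhd π U)

/-- The map `t ↦ Δ^*[t]` to differential forms, semilinear along the restriction to the diagonal. -/
def formSec (U : X.Opens) : DiagSec π U →ₛₗ[diagHom π U] Sec (toPre (relDifferentials π)) U :=
  (pullbackSec (M := conormal (diagIdeal π)) (diag π) (le_diag_preimage_nhd π U)).comp
    (conormalSec (diagIdeal π) (nhd π U))

variable {π}

lemma diagHom_surjective : Function.Surjective (diagHom π U) :=
  fun b => ⟨_, diagHom_projHom₁ π U b⟩

lemma isQCAt_relDifferentials (h : IsSmall π U) : IsQCAt (toPre (relDifferentials π)) U :=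
  (pullback_isQCAt_and_isSemilinearBaseChange (conormal (diagIdeal π)) h.isAffineOpen_nhd
    (isQCAt_conormal (diagIdeal π) h.isAffineOpen_nhd) (diag π) h.1 (le_diag_preimage_nhd π U)).1

/-- The conormal module is killed by the ideal of the diagonal, so its inverse image along the
diagonal has the same sections. -/
lemma pullbackSec_conormal_bijective (h : IsSmall π U) :
    Function.Bijective (pullbackSec (M := conormal (diagIdeal π)) (diag π)
      (le_diag_preimage_nhd π U)) := by
  refine (pullback_isQCAt_and_isSemilinearBaseChange (conormal (diagIdeal π)) h.isAffineOpen_nhd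
    (isQCAt_conormal (diagIdeal π) h.isAffineOpen_nhd) (diag π) h.1
    (le_diag_preimage_nhd π U)).2.bijective_of_surjective diagHom_surjective fun c hc m => ?_
  obtain ⟨t, rfl⟩ := conormalSec_surjective (diagIdeal π) h.isAffineOpen_nhd m
  rw [← map_smul, conormalSec_eq_zero_iff (diagIdeal π) h.isAffineOpen_nhd, map_smul, pow_two,
    diagIdeal_ideal]
  refine Ideal.mul_mem_mul hc ?_
  rw [← diagIdeal_ideal h.isAffineOpen_nhd, ← range_idealSec]
  exact ⟨t, rfl⟩

lemma formSec_surjective (h : IsSmall π U) : Function.Surjective (formSec π U) :=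
  (pullbackSec_conormal_bijective h).2.comp
    (conormalSec_surjective (diagIdeal π) h.isAffineOpen_nhd)

lemma formSec_eq_zero_iff (h : IsSmall π U) (t : DiagSec π U) :
    formSec π U t = 0 ↔ idealSec (diagIdeal π) _ t ∈ RingHom.ker (diagHom π U) ^ 2 := by
  rw [← diagIdeal_ideal h.isAffineOpen_nhd, ← conormalSec_eq_zero_iff]
  exact map_eq_zero_iff (pullbackSec (M := conormal (diagIdeal π)) (diag π)
      (le_diag_preimage_nhd π U)) (pullbackSec_conormal_bijective h).1

lemma nhd_mono (h : V ≤ U) : nhd π V ≤ nhd π U :=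
  inf_le_inf ((proj₁ π).preimage_mono h) ((proj₂ π).preimage_mono h)

lemma pullbackSec_secRes {X Y : Scheme.{u}} (f : X ⟶ Y) {M : Y.Modules} {U U' : Y.Opens}
    {V V' : X.Opens} (e : V ≤ f ⁻¹ᵁ U) (e' : V' ≤ f ⁻¹ᵁ U') (h : U' ≤ U) (h' : V' ≤ V)
    (s : Sec (toPre M) U) :
    pullbackSec f e' (secRes (toPre M) h s) =
      secRes (toPre ((Scheme.Modules.pullback f).obj M)) h' (pullbackSec f e s) := by
  have h1 : pullbackSection f (secRes (toPre M) h s) =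
      secRes (toPre ((Scheme.Modules.pullback f).obj M)) (f.preimage_mono h)
        (pullbackSection f s) :=
    secMap_secRes (preMap ((Scheme.Modules.pullbackPushforwardAdjunction f).unit.app M)) h s
  refine (congrArg (secRes (toPre ((Scheme.Modules.pullback f).obj M)) e') h1).trans ?_
  refine (secRes_secRes _ _ _).trans ?_
  exact (secRes_secRes (P := toPre ((Scheme.Modules.pullback f).obj M)) e h'
    (pullbackSection f s)).symm

lemma formSec_secRes (h : V ≤ U) (t : DiagSec π U) :
    formSec π V (secRes _ (nhd_mono h) t) = secRes _ h (formSec π U t) := by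
  refine (congrArg (pullbackSec (M := conormal (diagIdeal π)) (diag π)
    (le_diag_preimage_nhd π V)) (conormalSec_secRes (diagIdeal π) (nhd_mono h) t)).trans ?_
  exact pullbackSec_secRes (M := conormal (diagIdeal π)) (diag π) _ _ (nhd_mono h) h _

variable (π) (k : ℕ) (E : X.Modules)

/-- A section of `P^k_π(E)` over `U`, restricted to the neighborhood `p⁻¹U ∩ q⁻¹U` of `Δ(U)`. -/
def partsRes (U : X.Opens) :
    Sec (toPre (principalParts π k E)) U →ₛₗ[projHom₁ π U]
      Sec (toPre (preParts π k E)) (nhd π U) where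
  toFun s := secRes (toPre (preParts π k E)) (nhd_le₁ π U)
    (show Sec (toPre (preParts π k E)) (proj₁ π ⁻¹ᵁ U) from s)
  map_add' s t := map_add (secRes (toPre (preParts π k E)) (nhd_le₁ π U))
    (show Sec (toPre (preParts π k E)) (proj₁ π ⁻¹ᵁ U) from s) t
  map_smul' a s := by
    refine (secRes_smul (toPre (preParts π k E)) (nhd_le₁ π U) ((proj₁ π).app U a)
      (show Sec (toPre (preParts π k E)) (proj₁ π ⁻¹ᵁ U) from s)).trans ?_
    rfl

lemma mem_range_of_mem_support_ker_pow {X Y : Scheme.{u}} (f : X ⟶ Y) [IsClosedImmersion f] {z : Y}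
    (hz : z ∈ (f.ker ^ (k + 1)).support) : ∃ x, f x = z := by
  rw [Scheme.IdealSheafData.support_pow_succ, ← SetLike.mem_coe, Scheme.Hom.support_ker,
    f.isClosedEmbedding.isClosed_range.closure_eq] at hz
  exact hz

/-- The sheaf `q^*E ⊗ 𝒪_{Δ_k}` is supported on the diagonal, which meets `p⁻¹U` only inside
`p⁻¹U ∩ q⁻¹U`. -/
lemma partsRes_bijective (U : X.Opens) : Function.Bijective (partsRes π k E U) := by
  refine secRes_tensorQuot_bijective (diagIdeal π ^ (k + 1)) _ (nhd_le₁ π U) fun z hz hz' => ?_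
  obtain ⟨x, rfl⟩ := mem_range_of_mem_support_ker_pow k (diag π) hz'
  refine le_diag_preimage_nhd π U (x := x) ?_
  have h1 : diag π ⁻¹ᵁ proj₁ π ⁻¹ᵁ U = U := by
    rw [← Scheme.Hom.comp_preimage, diag_proj₁]; rfl
  exact h1.le hz

lemma partsRes_secRes (h : V ≤ U) (s : Sec (toPre (principalParts π k E)) U) :
    partsRes π k E V (secRes _ h s) = secRes _ (nhd_mono h) (partsRes π k E U s) := by
  refine (secRes_secRes (P := toPre (preParts π k E)) ((proj₁ π).preimage_mono h) (nhd_le₁ π V)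
    (show Sec (toPre (preParts π k E)) (proj₁ π ⁻¹ᵁ U) from s)).trans ?_
  exact (secRes_secRes (P := toPre (preParts π k E)) (nhd_le₁ π U) (nhd_mono h)
    (show Sec (toPre (preParts π k E)) (proj₁ π ⁻¹ᵁ U) from s)).symm

lemma partsRes_truncation (s : Sec (toPre (principalParts π (k + 1) E)) U) :
    partsRes π k E U (secMap (preMap (truncation π k E)) U s) =
      secMap (preMap (tensorMap _ (quotientMap (pow_succ_le (diagIdeal π) (k + 1))))) (nhd π U)
        (partsRes π (k + 1) E U s) :=
  (secMap_secRes (preMap (tensorMap ((Scheme.Modules.pullback (proj₂ π)).obj E)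
    (quotientMap (pow_succ_le (diagIdeal π) (k + 1))))) (nhd_le₁ π U)
    (show Sec (toPre (preParts π (k + 1) E)) (proj₁ π ⁻¹ᵁ U) from s)).symm

end Forms

/-! ### The canonical map over a small affine open set -/

section TwoStructures

variable {B C K Ω M N F P : Type*} [CommRing B] [CommRing C] [AddCommGroup K] [Module C K]
  [AddCommGroup Ω] [Module B Ω] [AddCommGroup M] [Module B M] [AddCommGroup N] [Module C N]
  [AddCommGroup F] [Module C F] [AddCommGroup P] [Module B P] {p q : B →+* C} {δ : C →+* B}

/-- The map of `exists_localCanonicalMap` for two ring homomorphisms `p q : B → C` with the same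
retraction `δ`: the base change `N` of `M` is formed along `q`, whereas `P` is the module
`F = N/I^(k+2) N` regarded as a `B`-module along `p`. Both homomorphisms define the same
`B`-module structure on the image of the map, which is killed by `I = ker δ`. The ideal is given by
an injective linear map `ι : K → C`. -/
theorem exists_canonicalMap_of_two_sections (hp : ∀ b, δ (p b) = b) (hq : ∀ b, δ (q b) = b)
    (hqs : q.FormallySmooth) (ι : K →ₗ[C] C) (hι : Function.Injective ι)
    (hι' : ∀ c, (∃ t, ι t = c) ↔ c ∈ RingHom.ker δ) (d : K →ₛₗ[δ] Ω)
    (hd : ∀ t, d t = 0 ↔ ι t ∈ RingHom.ker δ ^ 2) (hsurj : Function.Surjective d) (k : ℕ)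
    (ε : M →ₛₗ[q] N) (hε : IsSemilinearBaseChange ε) (τ : N →ₗ[C] F)
    (hτ : LinearMap.ker τ = RingHom.ker δ ^ (k + 2) • (⊤ : Submodule C N))
    (ρ : P →ₛₗ[p] F) (hρ : Function.Bijective ρ) :
    ∃ φ : M ⊗[B] symPower B Ω (k + 1) →ₗ[B] P,
      (∀ (m : M) (t : Fin (k + 1) → K), ρ (φ (m ⊗ₜ symProd B fun i => d (t i))) =
        τ ((∏ i, ι (t i)) • ε m)) ∧
      Function.Injective φ ∧
      ∀ y, y ∈ LinearMap.range φ ↔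
        ρ y ∈ (RingHom.ker δ ^ (k + 1) • (⊤ : Submodule C N)).map τ := by
  let _ := q.toAlgebra
  let _ := Module.compHom N q
  let _ := Module.compHom F q
  have : IsScalarTower B C N := .of_algebraMap_smul fun _ _ => rfl
  have : IsScalarTower B C F := .of_algebraMap_smul fun _ _ => rfl
  have : Algebra.FormallySmooth B C := hqs
  let δ' : C →ₐ[B] B := { δ with commutes' := hq }
  let e : K ≃ₗ[C] RingHom.ker δ' := LinearEquiv.ofBijective
    (ι.codRestrict (RingHom.ker δ') fun t => (hι' _).mp ⟨t, rfl⟩)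
    ⟨fun s t hst => hι congr(($hst : C)), fun c => by
      obtain ⟨t, ht⟩ := (hι' c).mpr c.2
      exact ⟨t, Subtype.ext ht⟩⟩
  have he (t) : (e.symm t |> ι) = t := congr(($(e.apply_symm_apply t) : C))
  let d' : RingHom.ker δ' →ₛₗ[(δ' : C →+* B)] Ω :=
    { toFun t := d (e.symm t)
      map_add' s t := by rw [map_add, map_add]
      map_smul' c t := by
        rw [map_smul]
        exact d.map_smulₛₗ c _ }
  let ε' : M →ₗ[B] N := { toFun := ε, map_add' := ε.map_add, map_smul' := ε.map_smulₛₗ }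
  obtain ⟨φ, hφ, hinj, hrange⟩ := exists_localCanonicalMap δ' d'
    (fun t => (hd _).trans (by rw [he]; exact Iff.rfl)) (hsurj.comp e.symm.surjective) k ε' hε τ hτ
  -- The image of `φ` is killed by the ideal of the diagonal.
  have hkill (c : C) (hc : δ c = 0) (x) : c • φ x = 0 := by
    obtain ⟨n, hn, hx⟩ := (hrange _).mp ⟨x, rfl⟩
    rw [← hx, ← map_smul, ← LinearMap.mem_ker, hτ, pow_succ', mul_smul]
    exact Submodule.smul_mem_smul hc hn
  let r := Equiv.ofBijective ρ hρ
  have hr (y) : ρ (r.symm y) = y := r.apply_symm_apply y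
  let ψ : M ⊗[B] symPower B Ω (k + 1) →ₗ[B] P :=
    { toFun x := r.symm (φ x)
      map_add' x y := hρ.1 (by rw [hr, map_add, map_add, hr, hr])
      map_smul' b x := hρ.1 (by
        rw [hr, RingHom.id_apply, ρ.map_smulₛₗ, hr, φ.map_smul, ← sub_eq_zero]
        change q b • φ x - _ = 0
        rw [← sub_smul]
        exact hkill _ (by rw [map_sub, hp, hq, sub_self]) x) }
  have hψ (x) : ρ (ψ x) = φ x := hr _
  refine ⟨ψ, fun m t => ?_, fun x y hxy => hinj ?_, fun y => ?_⟩
  · have h1 := hφ m fun i => e (t i)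
    simp only [d', LinearMap.coe_mk, AddHom.coe_mk, LinearEquiv.symm_apply_apply] at h1
    rw [hψ, h1]
    rfl
  · rw [← hψ, ← hψ, hxy]
  · refine Iff.trans ?_ (hrange (ρ y))
    constructor
    · rintro ⟨x, rfl⟩
      exact ⟨x, (hψ x).symm⟩
    · rintro ⟨x, hx⟩
      exact ⟨x, hρ.1 ((hψ x).trans hx)⟩

end TwoStructures

noncomputable section LocalMap

variable {X S : Scheme.{u}} {π : X ⟶ S} {U V : X.Opens} {E : X.Modules}

/-- On the neighborhood `p⁻¹U ∩ q⁻¹U` of `Δ(U)`, the inverse image `q^*E` is quasi-coherent, and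
its sections are the base change of `E(U)` along `q`. -/
lemma pullback_proj₂ (h : IsSmall π U) (hE : IsQCAt (toPre E) U) :
    IsQCAt (toPre ((Scheme.Modules.pullback (proj₂ π)).obj E)) (nhd π U) ∧
      IsSemilinearBaseChange (pullbackSec (M := E) (proj₂ π) (nhd_le₂ π U)) :=
  pullback_isQCAt_and_isSemilinearBaseChange E h.1 hE (proj₂ π) h.isAffineOpen_nhd (nhd_le₂ π U)

variable (π E) in
/-- The map `q^*E → q^*E ⊗ 𝒪_{Δ_k}` on the neighborhood `p⁻¹U ∩ q⁻¹U` of `Δ(U)`. -/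
def toParts (k : ℕ) (U : X.Opens) :
    Sec (toPre ((Scheme.Modules.pullback (proj₂ π)).obj E)) (nhd π U) →ₗ[Γ(diagNhd π, nhd π U)]
      Sec (toPre (preParts π k E)) (nhd π U) :=
  tensorQuotSec (diagIdeal π ^ (k + 1)) ((Scheme.Modules.pullback (proj₂ π)).obj E) (nhd π U)

lemma diagIdeal_pow_ideal (hN : IsAffineOpen (nhd π U)) (k : ℕ) :
    (diagIdeal π ^ k).ideal ⟨nhd π U, hN⟩ = RingHom.ker (diagHom π U) ^ k :=
  congrArg (· ^ k) (diagIdeal_ideal hN)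

/-- Over a small affine open set, `P^k_π(E)` is the quotient of the sections of `q^*E` by the power
`I^(k+1)` of the ideal of the diagonal. -/
lemma toParts_surjective_and_ker (h : IsSmall π U) (hE : IsQCAt (toPre E) U) (k : ℕ) :
    Function.Surjective (toParts π E k U) ∧
      LinearMap.ker (toParts π E k U) = RingHom.ker (diagHom π U) ^ (k + 1) • ⊤ := by
  rw [← diagIdeal_pow_ideal h.isAffineOpen_nhd]
  exact tensorQuotSec_surjective_and_ker _ _ h.isAffineOpen_nhd (pullback_proj₂ h hE).1

lemma truncation_toParts (k : ℕ) (U : X.Opens)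
    (n : Sec (toPre ((Scheme.Modules.pullback (proj₂ π)).obj E)) (nhd π U)) :
    secMap (preMap (tensorMap ((Scheme.Modules.pullback (proj₂ π)).obj E)
      (quotientMap (pow_succ_le (diagIdeal π) (k + 1))))) (nhd π U) (toParts π E (k + 1) U n) =
      toParts π E k U n :=
  secMap_tensorMap_quotientMap _ _ _ n

lemma truncation_surjective_of_isSmall (h : IsSmall π U) (hE : IsQCAt (toPre E) U) (k : ℕ) :
    Function.Surjective (secMap (preMap (truncation π k E)) U) := by
  intro y
  obtain ⟨n, hn⟩ := (toParts_surjective_and_ker h hE k).1 (partsRes π k E U y)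
  obtain ⟨x, hx⟩ := (partsRes_bijective π (k + 1) E U).2 (toParts π E (k + 1) U n)
  refine ⟨x, (partsRes_bijective π k E U).1 ?_⟩
  refine (partsRes_truncation π k E x).trans ?_
  rw [hx, ← hn]
  exact truncation_toParts k U n

lemma truncation_eq_zero_iff (h : IsSmall π U) (hE : IsQCAt (toPre E) U) (k : ℕ)
    (y : Sec (toPre (principalParts π (k + 1) E)) U) :
    secMap (preMap (truncation π k E)) U y = 0 ↔ partsRes π (k + 1) E U y ∈
      (RingHom.ker (diagHom π U) ^ (k + 1) • ⊤ : Submodule _ _).map (toParts π E (k + 1) U) := by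
  rw [← map_eq_zero_iff _ (partsRes_bijective π k E U).1, ← (toParts_surjective_and_ker h hE k).2,
    partsRes_truncation]
  constructor
  · intro h0
    obtain ⟨n, hn⟩ := (toParts_surjective_and_ker h hE (k + 1)).1 (partsRes π (k + 1) E U y)
    refine ⟨n, ?_, hn⟩
    rw [← hn] at h0
    exact (truncation_toParts k U n).symm.trans h0
  · rintro ⟨n, hn, h0⟩
    rw [← h0]
    exact (truncation_toParts k U n).trans hn

/-- The canonical map on sections over a small affine open set. -/
theorem exists_canonicalMap_of_isSmall [Smooth π] (h : IsSmall π U) (hE : IsQCAt (toPre E) U)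
    (k : ℕ) :
    ∃ φ : Sec (toPre E) U ⊗[Γ(X, U)] symPower Γ(X, U) (Sec (toPre (relDifferentials π)) U) (k + 1)
        →ₗ[Γ(X, U)] Sec (toPre (principalParts π (k + 1) E)) U,
      (∀ (e : Sec (toPre E) U) (t : Fin (k + 1) → DiagSec π U),
        partsRes π (k + 1) E U (φ (e ⊗ₜ symProd Γ(X, U) fun i => formSec π U (t i))) =
          toParts π E (k + 1) U ((∏ i, idealSec (diagIdeal π) (nhd π U) (t i)) •
            pullbackSec (M := E) (proj₂ π) (nhd_le₂ π U) e)) ∧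
      Function.Injective φ ∧
      ∀ y, y ∈ LinearMap.range φ ↔ secMap (preMap (truncation π k E)) U y = 0 := by
  obtain ⟨φ, h1, h2, h3⟩ := exists_canonicalMap_of_two_sections (p := projHom₁ π U)
    (q := projHom₂ π U) (δ := diagHom π U) (diagHom_projHom₁ π U) (diagHom_projHom₂ π U)
    (projHom₂_smooth h).1 (idealSec (diagIdeal π) (nhd π U)) (idealSec_injective _ _)
    (fun c => by rw [← diagIdeal_ideal h.isAffineOpen_nhd]; exact range_idealSec _ _ c)
    (formSec π U) (formSec_eq_zero_iff h) (formSec_surjective h) k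
    (pullbackSec (M := E) (proj₂ π) (nhd_le₂ π U)) (pullback_proj₂ h hE).2
    (toParts π E (k + 1) U) (toParts_surjective_and_ker h hE (k + 1)).2
    (partsRes π (k + 1) E U) (partsRes_bijective π (k + 1) E U)
  exact ⟨φ, h1, h2, fun y => (h3 y).trans (truncation_eq_zero_iff h hE k y).symm⟩

end LocalMap

/-! ### Construction of the canonical map by gluing -/

/-- To prove a statement that is stable under addition for all elements of `M ⊗ Sym^k(N)`, it
suffices to prove it for the elements `m ⊗ n₁ ⋯ nₖ`. -/
lemma tensor_symPower_induction {R M N : Type*} [CommRing R] [AddCommGroup M] [AddCommGroup N]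
    [Module R M] [Module R N] {k : ℕ} {p : M ⊗[R] symPower R N k → Prop} (zero : p 0)
    (add : ∀ x y, p x → p y → p (x + y)) (tmul : ∀ m n, p (m ⊗ₜ symProd R n)) (x) : p x := by
  induction x with
  | zero => exact zero
  | add x y hx hy => exact add x y hx hy
  | tmul m s =>
    obtain ⟨s, hs⟩ := s
    suffices h : ∀ (hs : s ∈ symPower R N k) (m : M),
      p (m ⊗ₜ[R] (⟨s, hs⟩ : symPower R N k)) from h hs m
    induction hs using Submodule.span_induction with
    | zero =>
      intro hs m
      have h1 : (⟨0, hs⟩ : symPower R N k) = 0 := rfl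
      rw [h1, TensorProduct.tmul_zero]
      exact zero
    | add x y hx hy ihx ihy =>
      intro _ m
      have h1 : (⟨x + y, add_mem hx hy⟩ : symPower R N k) = ⟨x, hx⟩ + ⟨y, hy⟩ := rfl
      rw [h1, TensorProduct.tmul_add]
      exact add _ _ (ihx _ _) (ihy _ _)
    | smul r x hx ih =>
      intro _ m
      have h1 : (⟨r • x, Submodule.smul_mem _ r hx⟩ : symPower R N k) = r • ⟨x, hx⟩ := rfl
      rw [h1, ← TensorProduct.smul_tmul]
      exact ih _ _
    | mem x hx =>
      obtain ⟨n, rfl⟩ := hx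
      exact fun _ m => tmul m n

noncomputable section Gluing

variable {X : Scheme.{u}} {P Q : X.PresheafOfModules} {M N : X.Modules} {U V : X.Opens}

lemma exists_hom_of_secRes (t : ∀ U, Sec P U →ₗ[Γ(X, U)] Sec Q U)
    (ht : ∀ U V (h : V ≤ U) s, t V (secRes P h s) = secRes Q h (t U s)) :
    ∃ f : P ⟶ Q, ∀ U s, secMap f U s = t U s :=
  ⟨{ app U := ModuleCat.ofHom (t U.unop)
     naturality {U V} g := by
      ext s
      exact ht U.unop V.unop (leOfHom g.unop) s }, fun _ _ => rfl⟩

/-- Compatible linear maps on the sections over the members of a basis of the topology define a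
morphism of sheaves of modules. -/
theorem exists_hom_of_basis (p : X.Opens → Prop)
    (hp : ∀ (U : X.Opens) (x), x ∈ U → ∃ V, p V ∧ x ∈ V ∧ V ≤ U)
    (α : ∀ U, p U → (Sec (toPre M) U →ₗ[Γ(X, U)] Sec (toPre N) U))
    (hα : ∀ U V hU hV (h : V ≤ U) s, α V hV (secRes _ h s) = secRes _ h (α U hU s)) :
    ∃ f : M ⟶ N, ∀ U hU s, secMap (preMap f) U s = α U hU s := by
  have ext {U : X.Opens} {s t : Sec (toPre N) U}
      (h : ∀ V (hV : V ≤ U), p V → secRes _ hV s = secRes _ hV t) : s = t :=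
    sec_eq_of_locally N fun x hx => by
      obtain ⟨V, hV, hxV, e⟩ := hp U x hx
      exact ⟨V, e, hxV, h V e hV⟩
  have key (U : X.Opens) (s : Sec (toPre M) U) : ∃ t : Sec (toPre N) U,
      ∀ V (hV : V ≤ U) (h : p V), secRes _ hV t = α V h (secRes _ hV s) := by
    obtain ⟨t, ht⟩ := exists_sec_of_locally N (fun V : {V : X.Opens // p V ∧ V ≤ U} => V.1)
      (fun V => V.2.2) (fun x hx => by
        obtain ⟨V, hV, hxV, e⟩ := hp U x hx
        exact TopologicalSpace.Opens.mem_iSup.mpr ⟨⟨V, hV, e⟩, hxV⟩)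
      (fun V => α V.1 V.2.1 (secRes _ V.2.2 s)) (fun V V' => ext fun W hW h => by
        rw [secRes_secRes, secRes_secRes, ← hα _ _ _ h, ← hα _ _ _ h, secRes_secRes,
          secRes_secRes])
    exact ⟨t, fun V hV h => ht ⟨V, h, hV⟩⟩
  choose t ht using key
  obtain ⟨f, hf⟩ := exists_hom_of_secRes (P := toPre M) (Q := toPre N) (fun U =>
    { toFun := t U
      map_add' := fun a b => ext fun V hV h => by simp only [map_add, ht _ _ _ _ h]
      map_smul' := fun r a => ext fun V hV h => by
        rw [RingHom.id_apply, secRes_smul, ht _ _ _ _ h, ht _ _ _ _ h, secRes_smul, map_smul] })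
    (fun U V h s => ext fun W hW hp => by
      change secRes _ _ (t V _) = secRes _ _ (secRes _ _ (t U s))
      rw [secRes_secRes, ht _ _ _ _ hp, ht _ _ _ _ hp, secRes_secRes])
  refine ⟨ofPreMap f, fun U hU s => (hf U s).trans ?_⟩
  have := ht U s U le_rfl hU
  rwa [secRes_self, secRes_self] at this

lemma secRes_symProd {k : ℕ} (h : V ≤ U) (m : Fin k → Sec (toPre M) U) :
    secRes (symPowPre M k) h (symProd Γ(X, U) m : symPower Γ(X, U) (Sec (toPre M) U) k) =
      (symProd Γ(X, V) fun i => secRes (toPre M) h (m i) :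
        symPower Γ(X, V) (Sec (toPre M) V) k) := by
  refine Subtype.ext ?_
  change symMap _ (∏ i, SymmetricAlgebra.ι Γ(X, U) _ (m i)) =
    ∏ i, SymmetricAlgebra.ι Γ(X, V) (Sec (toPre M) V) (secRes (toPre M) h (m i))
  rw [map_prod]
  exact Finset.prod_congr rfl fun i _ => symMap_ι (secRes (toPre M) h) (m i)

variable (M N) in
/-- The canonical map `M(U) ⊗ Sym^k N(U) → (M ⊗ Sym^k N)(U)`. -/
def tensorSym (k : ℕ) (U : X.Opens) :
    Sec (toPre M) U ⊗[Γ(X, U)] symPower Γ(X, U) (Sec (toPre N) U) k →ₗ[Γ(X, U)]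
      Sec (toPre (tensor M (symPow N k))) U :=
  secUnit (tensorPre M (symPow N k)) U ∘ₗ
    LinearMap.lTensor (Sec (toPre M) U) (show symPower Γ(X, U) (Sec (toPre N) U) k →ₗ[Γ(X, U)]
      Sec (toPre (symPow N k)) U from secUnit (symPowPre N k) U)

lemma secRes_tensorSym_tmul {k : ℕ} (h : V ≤ U) (m : Sec (toPre M) U)
    (n : Fin k → Sec (toPre N) U) :
    secRes _ h (tensorSym M N k U (m ⊗ₜ symProd Γ(X, U) n)) =
      tensorSym M N k V
        (secRes (toPre M) h m ⊗ₜ symProd Γ(X, V) fun i => secRes (toPre N) h (n i)) := by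
  refine (secUnit_secRes (P := tensorPre M (symPow N k)) h _).symm.trans ?_
  refine congrArg (secUnit (tensorPre M (symPow N k)) V) ?_
  refine (secRes_tmul (M := M) (N := symPow N k) h m _).trans ?_
  refine congrArg (fun z => secRes (toPre M) h m ⊗ₜ[Γ(X, V)] z) ?_
  refine (secUnit_secRes (P := symPowPre N k) h _).symm.trans ?_
  exact congrArg (secUnit (symPowPre N k) V) (secRes_symProd h n)

lemma tensorSym_bijective (hU : IsAffineOpen U) (hM : IsQCAt (toPre M) U)
    (hN : IsQCAt (toPre N) U) (k : ℕ) : Function.Bijective (tensorSym M N k U) := by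
  have h1 := isQCAt_symPowPre hU hN k
  have h2 := (isQCAt_tensorPre hU hM (h1.sheafify hU)).secUnit_bijective hU
  let e : symPower Γ(X, U) (Sec (toPre N) U) k ≃ₗ[Γ(X, U)] Sec (toPre (symPow N k)) U :=
    LinearEquiv.ofBijective _ (h1.secUnit_bijective hU)
  exact h2.comp (LinearEquiv.lTensor (Sec (toPre M) U) e).bijective

end Gluing

noncomputable section Canonical

variable {X S : Scheme.{u}} {π : X ⟶ S} {U V : X.Opens} {E : X.Modules}

variable (π) in
/-- The section `q^*e ⊗ t₁ ⋯ tₖ` on `p⁻¹U ∩ q⁻¹U`. -/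
def canonicalSection {n : ℕ} (k : ℕ) (e : Sec (toPre E) U) (t : Fin n → DiagSec π U) :
    Sec (toPre (preParts π k E)) (nhd π U) :=
  toParts π E k U ((∏ i, idealSec (diagIdeal π) (nhd π U) (t i)) •
    pullbackSec (M := E) (proj₂ π) (nhd_le₂ π U) e)

lemma canonicalSection_eq_tmul {n : ℕ} (k : ℕ) (e : Sec (toPre E) U) (t : Fin n → DiagSec π U) :
    canonicalSection π k e t =
      tmul (M := (Scheme.Modules.pullback (proj₂ π)).obj E)
        (N := quotientModule (diagIdeal π ^ (k + 1)))
        (res inf_le_right (pullbackSection (proj₂ π) e))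
        ((toQuotient (diagIdeal π ^ (k + 1))).app (nhd π U)
          (∏ i, idealSection (t i) : Γ(diagNhd π, nhd π U))) := by
  refine congrArg (secUnit (tensorPre ((Scheme.Modules.pullback (proj₂ π)).obj E)
    (quotientModule (diagIdeal π ^ (k + 1)))) (nhd π U)) ?_
  refine (TensorProduct.smul_tmul _ _ _).trans ?_
  refine congrArg (fun z => pullbackSec (M := E) (proj₂ π) (nhd_le₂ π U) e ⊗ₜ z) ?_
  refine (map_smul (quotSec (diagIdeal π ^ (k + 1)) (nhd π U)) _ _).symm.trans ?_
  rw [smul_eq_mul, mul_one]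
  rfl

lemma canonicalSection_secRes {n : ℕ} (k : ℕ) (h : V ≤ U) (e : Sec (toPre E) U)
    (t : Fin n → DiagSec π U) :
    canonicalSection π k (secRes (toPre E) h e) (fun i => secRes _ (nhd_mono h) (t i)) =
      secRes _ (nhd_mono h) (canonicalSection π k e t) := by
  refine Eq.trans ?_ (tensorQuotSec_secRes (diagIdeal π ^ (k + 1)) _ (nhd_mono h) _)
  refine congrArg (toParts π E k V) ?_
  rw [secRes_smul, map_prod]
  refine congrArg₂ (· • ·) (Finset.prod_congr rfl fun i _ => idealSec_secRes _ _ _) ?_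
  exact pullbackSec_secRes (M := E) (proj₂ π) (nhd_le₂ π U) (nhd_le₂ π V) h (nhd_mono h) e

/-- There is a canonical map, it is injective over small affine open sets, and its image there is
the kernel of the truncation. -/
theorem exists_canonicalMap [Smooth π] (hE : ∀ U, IsAffineOpen U → IsQCAt (toPre E) U) (k : ℕ) :
    ∃ φ : tensor E (symPow (relDifferentials π) (k + 1)) ⟶ principalParts π (k + 1) E,
      IsCanonical π φ ∧ ∀ U, IsSmall π U → Function.Injective (secMap (preMap φ) U) ∧
        ∀ y, (∃ x, secMap (preMap φ) U x = y) ↔ secMap (preMap (truncation π k E)) U y = 0 := by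
  have key (U : X.Opens) (h : IsSmall π U) :
      ∃ α : Sec (toPre (tensor E (symPow (relDifferentials π) (k + 1)))) U →ₗ[Γ(X, U)]
          Sec (toPre (principalParts π (k + 1) E)) U,
        (∀ e t, partsRes π (k + 1) E U (α (tensorSym E (relDifferentials π) (k + 1) U
          (e ⊗ₜ symProd Γ(X, U) fun i => formSec π U (t i)))) = canonicalSection π (k + 1) e t) ∧
        Function.Injective α ∧
        ∀ y, (∃ x, α x = y) ↔ secMap (preMap (truncation π k E)) U y = 0 := by
    obtain ⟨φ, h1, h2, h3⟩ := exists_canonicalMap_of_isSmall h (hE U h.1) k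
    let κ := LinearEquiv.ofBijective _
      (tensorSym_bijective h.1 (hE U h.1) (isQCAt_relDifferentials h) (k + 1))
    have hκ (x) : κ.symm (tensorSym E (relDifferentials π) (k + 1) U x) = x := κ.symm_apply_apply x
    refine ⟨φ ∘ₗ κ.symm, fun e t => ?_, h2.comp κ.symm.injective, fun y => Iff.trans ?_ (h3 y)⟩
    · exact (congrArg (fun x => partsRes π (k + 1) E U (φ x)) (hκ _)).trans (h1 e t)
    · exact ⟨fun ⟨x, hx⟩ => ⟨_, hx⟩, fun ⟨x, hx⟩ => ⟨κ x, by simpa using hx⟩⟩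
  choose α hα hinj hrange using key
  -- The maps `α U` commute with restriction because their values on products of forms `Δ^*[t]` do.
  obtain ⟨φ, hφ⟩ := exists_hom_of_basis (IsSmall π) (fun U x hx => exists_isSmall_mem_le π hx) α
    (fun U V hU hV h s => by
      obtain ⟨x, rfl⟩ := (tensorSym_bijective hU.1 (hE U hU.1) (isQCAt_relDifferentials hU)
        (k + 1)).2 s
      refine tensor_symPower_induction (p := fun x => α V hV (secRes _ h
        (tensorSym E (relDifferentials π) (k + 1) U x)) = secRes _ h
        (α U hU (tensorSym E (relDifferentials π) (k + 1) U x))) ?_ (fun x y hx hy => ?_)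
          (fun e ω => ?_) x
      · simp only [map_zero]
      · simp only [map_add, hx, hy]
      · choose t ht using fun i => formSec_surjective hU (ω i)
        obtain rfl : (fun i => formSec π U (t i)) = ω := funext ht
        refine (partsRes_bijective π (k + 1) E V).1 ?_
        rw [secRes_tensorSym_tmul, partsRes_secRes, hα,
          ← canonicalSection_secRes (h := h), ← hα V hV]
        simp only [formSec_secRes h])
  -- Over an arbitrary open set the formula for the canonical map is checked on small open subsets.
  have hcan (U : X.Opens) (e : Sec (toPre E) U) (t : Fin (k + 1) → DiagSec π U) :
      partsRes π (k + 1) E U (secMap (preMap φ) U (tensorSym E (relDifferentials π) (k + 1) U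
      (e ⊗ₜ symProd Γ(X, U) fun i => formSec π U (t i)))) = canonicalSection π (k + 1) e t := by
    obtain ⟨y, hy⟩ := (partsRes_bijective π (k + 1) E U).2 (canonicalSection π (k + 1) e t)
    rw [← hy]
    refine congrArg _ (sec_eq_of_locally _ fun x hx => ?_)
    obtain ⟨V, hV, hxV, h⟩ := exists_isSmall_mem_le π hx
    refine ⟨V, h, hxV, (partsRes_bijective π (k + 1) E V).1 ?_⟩
    rw [partsRes_secRes (s := y), hy, ← canonicalSection_secRes (h := h), ← hα V hV,
      ← secMap_secRes, secRes_tensorSym_tmul, hφ V hV]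
    simp only [formSec_secRes h]
  refine ⟨φ, fun U e t => (hcan U e t).trans (canonicalSection_eq_tmul (E := E) (k + 1) e t),
    fun U hU => ⟨?_, fun y => ?_⟩⟩
  · intro x y hxy
    exact hinj U hU (by rwa [hφ U hU, hφ U hU] at hxy)
  · refine Iff.trans ?_ (hrange U hU y)
    simp only [hφ U hU]

end Canonical

/-! ### Exactness on a basis of open sets -/

section Exactness

variable {X : Scheme.{u}} {M N : X.Modules} {p : X.Opens → Prop}

lemma hom_eq_of_basis (hp : ∀ (U : X.Opens) (x), x ∈ U → ∃ V, p V ∧ x ∈ V ∧ V ≤ U) {f g : M ⟶ N}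
    (h : ∀ U, p U → ∀ s, secMap (preMap f) U s = secMap (preMap g) U s) : f = g :=
  preMap_injective <| secMap_ext fun U s => sec_eq_of_locally N fun x hx => by
    obtain ⟨V, hV, hxV, e⟩ := hp U x hx
    exact ⟨V, e, hxV, by rw [← secMap_secRes, ← secMap_secRes, h V hV]⟩

lemma epi_of_basis (hp : ∀ (U : X.Opens) (x), x ∈ U → ∃ V, p V ∧ x ∈ V ∧ V ≤ U) (f : M ⟶ N)
    (h : ∀ U, p U → Function.Surjective (secMap (preMap f) U)) : Epi f :=
  ⟨fun g g' hg => hom_eq_of_basis hp fun U hU s => by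
    obtain ⟨s, rfl⟩ := h U hU s
    exact congr(secMap (preMap $hg) U s)⟩

lemma mono_of_basis (hp : ∀ (U : X.Opens) (x), x ∈ U → ∃ V, p V ∧ x ∈ V ∧ V ≤ U) (f : M ⟶ N)
    (h : ∀ U, p U → Function.Injective (secMap (preMap f) U)) : Mono f :=
  ⟨fun _ _ hg => hom_eq_of_basis hp fun U hU s => h U hU congr(secMap (preMap $hg) U s)⟩

lemma exact_of_basis (hp : ∀ (U : X.Opens) (x), x ∈ U → ∃ V, p V ∧ x ∈ V ∧ V ≤ U) {K : X.Modules}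
    (f : M ⟶ N) (g : N ⟶ K)
    (h : ∀ U, p U → ∀ y, (∃ x, secMap (preMap f) U x = y) ↔ secMap (preMap g) U y = 0) :
    ∃ w : f ≫ g = 0, (ShortComplex.mk f g w).Exact := by
  have w : f ≫ g = 0 := hom_eq_of_basis hp fun U hU s => (h U hU _).mp ⟨s, rfl⟩
  refine ⟨w, (ShortComplex.exact_iff_epi_kernel_lift _).mpr (epi_of_basis hp _ fun U hU t => ?_)⟩
  obtain ⟨x, hx⟩ := (h U hU _).mpr (secMap_kernel_ι g t)
  refine ⟨x, kernel_ι_injective g U (Eq.trans ?_ hx)⟩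
  exact congr(secMap (preMap $(kernel.lift_ι g f w)) U x)

end Exactness

/-! ### Freeness of localizations -/

section Free

variable {B B' C M N F P P' : Type*} [CommRing B] [CommRing B'] [CommRing C]
  [AddCommGroup M] [Module B M] [AddCommGroup N] [Module C N]
  [AddCommGroup F] [Module C F] [AddCommGroup P] [Module B P] [AddCommGroup P'] [Module B' P']
  {σ : B →+* B'} {p q : B →+* C}

lemma IsLocalAt.isBaseChange {f : B} (hσ : letI := σ.toAlgebra; IsLocalization.Away f B')
    {ρ : P →ₛₗ[σ] P'} (h : IsLocalAt f ρ) : IsSemilinearBaseChange ρ := by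
  let _ := σ.toAlgebra
  let _ := Module.compHom P' σ
  have : IsScalarTower B B' P' := .of_algebraMap_smul fun _ _ => rfl
  have hf : IsUnit (σ f) := IsLocalization.Away.algebraMap_isUnit (S := B') f
  have h1 := h.isLocalizedModule hf
  have h2 : IsBaseChange B' (linearOfSemilinear ρ) :=
    IsLocalizedModule.isBaseChange (Submonoid.powers f) B' (linearOfSemilinear ρ)
  exact h2

/-- A localization of a direct sum of copies of `A` is free if the localization of `A` is free. -/
lemma IsLocalAt.free_and_finite {A J : Type*} [AddCommGroup A] [Module B A] {f : B}
    (hσ : letI := σ.toAlgebra; IsLocalization.Away f B') {ρ : P →ₛₗ[σ] P'} (h : IsLocalAt f ρ)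
    (e : P ≃ₗ[B] (J →₀ A))
    [hA : Module.Free (Localization (.powers f)) (LocalizedModule.Away f A)] :
    Module.Free B' P' ∧ (Finite J → Module.Finite B A → Module.Finite B' P') := by
  classical
  let _ := σ.toAlgebra
  let _ := Module.compHom P' σ
  have : IsScalarTower B B' P' := .of_algebraMap_smul fun _ _ => rfl
  have h1 : IsBaseChange B' (linearOfSemilinear ρ) := h.isBaseChange hσ
  let L := Localization (Submonoid.powers f)
  let _ : Algebra L B' := (IsLocalization.algEquiv (Submonoid.powers f) L B').toAlgHom.toAlgebra
  have : IsScalarTower B L B' := .of_algebraMap_eq fun b =>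
    ((IsLocalization.algEquiv (Submonoid.powers f) L B').commutes b).symm
  have h2 : Module.Free L (L ⊗[B] A) :=
    .of_equiv (LocalizedModule.equivTensorProduct (Submonoid.powers f) A)
  have h3 : Module.Free B' (B' ⊗[B] A) :=
    .of_equiv (TensorProduct.AlgebraTensorModule.cancelBaseChange B L B' B' A)
  let e1 : P' ≃ₗ[B'] (J →₀ B' ⊗[B] A) := h1.equiv.symm ≪≫ₗ e.baseChange B B' P _ ≪≫ₗ
    TensorProduct.finsuppRight B B' B' A J
  exact ⟨.of_equiv e1.symm, fun _ _ => .equiv e1.symm⟩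

/-- If `M` is free, then the quotient of its base change by an ideal is a sum of copies of the
quotient ring, also as a module by means of another ring homomorphism. -/
lemma nonempty_equiv_finsupp {J : Type*} (b : Module.Basis J B M) {ε : M →ₛₗ[q] N}
    (hε : IsSemilinearBaseChange ε) (a : Ideal C) (τ : N →ₗ[C] F) (hτ : Function.Surjective τ)
    (hτ' : LinearMap.ker τ = a • ⊤) (ρ : P →ₛₗ[p] F) (hρ : Function.Bijective ρ) :
    letI := p.toAlgebra
    Nonempty (P ≃ₗ[B] (J →₀ C ⧸ a)) := by
  classical
  have h1 : Nonempty (F ≃ₗ[C] (J →₀ C ⧸ a)) := by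
    let _ := q.toAlgebra
    let _ := Module.compHom N q
    have : IsScalarTower B C N := .of_algebraMap_smul fun _ _ => rfl
    have h : IsBaseChange C (linearOfSemilinear ε) := hε
    let b' : Module.Basis J C N := (b.baseChange C).map h.equiv
    exact ⟨(τ.quotKerEquivOfSurjective hτ).symm ≪≫ₗ Submodule.quotEquivOfEq _ _ hτ' ≪≫ₗ
      (TensorProduct.quotTensorEquivQuotSMul N a).symm ≪≫ₗ
      LinearEquiv.lTensor (C ⧸ a) b'.repr ≪≫ₗ TensorProduct.finsuppScalarRight C C (C ⧸ a) J⟩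
  obtain ⟨e⟩ := h1
  let _ := p.toAlgebra
  exact ⟨LinearEquiv.ofBijective
    { toFun x := e (ρ x)
      map_add' x y := by rw [map_add, map_add]
      map_smul' c x := by
        rw [ρ.map_smulₛₗ, map_smul]
        exact algebraMap_smul C c (e (ρ x)) } (e.bijective.comp hρ)⟩

/-- A finitely generated projective module is free on a neighborhood of each point. -/
lemma exists_free_localizedModule {A : Type*} [AddCommGroup A] [Module B A] [Module.Finite B A]
    [Module.Projective B A] (x : PrimeSpectrum B) : ∃ f : B, f ∉ x.asIdeal ∧
      Module.Free (Localization (.powers f)) (LocalizedModule.Away f A) := by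
  have : Module.FinitePresentation B A := Module.finitePresentation_of_projective B A
  have : Module.Free (Localization.AtPrime x.asIdeal) (LocalizedModule.AtPrime x.asIdeal A) :=
    Module.free_of_flat_of_isLocalRing
  obtain ⟨r, hr, hr', _⟩ := Module.FinitePresentation.exists_free_localizedModule_powers
    x.asIdeal.primeCompl (LocalizedModule.mkLinearMap x.asIdeal.primeCompl A)
    (Localization.AtPrime x.asIdeal)
  exact ⟨r, hr, hr'⟩

end Free

/-! ### Local freeness of the modules of principal parts -/

section FreeParts

variable {X S : Scheme.{u}} {π : X ⟶ S} {U V : X.Opens} {E : X.Modules}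

lemma projHom₁_ringRes (h : V ≤ U) (b : Γ(X, U)) :
    projHom₁ π V (ringRes h b) = ringRes (nhd_mono h) (projHom₁ π U b) := by
  have h1 : X.presheaf.map (homOfLE h).op ≫ (proj₁ π).appLE V (nhd π V) (nhd_le₁ π V) =
      (proj₁ π).appLE U (nhd π U) (nhd_le₁ π U) ≫
        (diagNhd π : Scheme.{u}).presheaf.map (homOfLE (nhd_mono h)).op :=
    (Scheme.Hom.map_appLE _ _ _).trans (Scheme.Hom.appLE_map _ _ _).symm
  exact congr($h1 b)

/-- The set `p⁻¹D(f) ∩ q⁻¹D(f)` is not of the form `D(g)` in `p⁻¹U ∩ q⁻¹U`, but it contains the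
intersection of the diagonal with `D(p^♯ f)`, and this is enough for sections of
`q^*E ⊗ 𝒪_{Δ_k}`. -/
lemma isQCAt_principalParts (h : IsSmall π U) (hE : IsQCAt (toPre E) U) (k : ℕ) :
    IsQCAt (toPre (principalParts π k E)) U := by
  have hF : IsQCAt (toPre (preParts π k E)) (nhd π U) :=
    isQCAt_tensorQuot (diagIdeal π ^ (k + 1)) _ h.isAffineOpen_nhd (pullback_proj₂ h hE).1
  have hle (f : Γ(X, U)) :
      nhd π (X.basicOpen f) ≤ (diagNhd π : Scheme.{u}).basicOpen (projHom₁ π U f) := by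
    refine le_trans (fun x hx => ?_)
      (Scheme.basicOpen_appLE (proj₁ π) (nhd π U) U (nhd_le₁ π U) f).ge
    exact ⟨nhd_mono (X.basicOpen_le f) hx, hx.1⟩
  have hbij (f : Γ(X, U)) : Function.Bijective (secRes (toPre (preParts π k E)) (hle f)) := by
    refine secRes_tensorQuot_bijective (diagIdeal π ^ (k + 1)) _ (hle f) fun z hz hz' => ?_
    obtain ⟨x, rfl⟩ := mem_range_of_mem_support_ker_pow k (diag π) hz'
    refine le_diag_preimage_nhd π (X.basicOpen f) (x := x) ?_
    have h1 : diag π ⁻¹ᵁ proj₁ π ⁻¹ᵁ (X.basicOpen f) = X.basicOpen f := by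
      rw [← Scheme.Hom.comp_preimage, diag_proj₁]; rfl
    exact h1.le ((Scheme.basicOpen_appLE (proj₁ π) (nhd π U) U (nhd_le₁ π U) f).le hz).2
  constructor
  · intro f t
    obtain ⟨t', ht'⟩ := (hbij f).2 (partsRes π k E _ t)
    obtain ⟨n, s', hs'⟩ := hF.surj _ t'
    obtain ⟨s, rfl⟩ := (partsRes_bijective π k E U).2 s'
    refine ⟨n, s, (partsRes_bijective π k E _).1 ?_⟩
    rw [partsRes_secRes, ← secRes_secRes ((diagNhd π : Scheme.{u}).basicOpen_le _) (hle f), hs',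
      secRes_smul, ht', map_smulₛₗ, map_pow, map_pow, projHom₁_ringRes, ringRes_ringRes]
  · intro f s hs
    obtain ⟨n, hn⟩ := hF.inj (projHom₁ π U f) (partsRes π k E U s) ((hbij f).1 (by
      rw [secRes_secRes, map_zero, ← partsRes_secRes (h := X.basicOpen_le f), hs, map_zero]))
    refine ⟨n, (partsRes_bijective π k E U).1 ?_⟩
    rw [map_smulₛₗ, map_pow, hn, map_zero]

/-- If the sections of `E` over a small affine open set are free, then so are the sections of
`P^k_π(E)` on a smaller neighborhood of each of its points. -/
theorem exists_free_principalParts [Smooth π] (h : IsSmall π U) (hE : IsQCAt (toPre E) U)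
    [Module.Free Γ(X, U) (Sec (toPre E) U)] (k : ℕ) {x : X} (hx : x ∈ U) :
    ∃ f : Γ(X, U), x ∈ X.basicOpen f ∧
      Module.Free Γ(X, X.basicOpen f) (Sec (toPre (principalParts π k E)) (X.basicOpen f)) ∧
      (Module.Finite Γ(X, U) (Sec (toPre E) U) →
        Module.Finite Γ(X, X.basicOpen f)
          (Sec (toPre (principalParts π k E)) (X.basicOpen f))) := by
  have hs : (projHom₁ π U).Smooth := projHom₁_smooth h
  let a := RingHom.ker (diagHom π U) ^ (k + 1)
  let b := Module.Free.chooseBasis Γ(X, U) (Sec (toPre E) U)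
  obtain ⟨h1, h2⟩ := toParts_surjective_and_ker h hE k
  let _ := (projHom₁ π U).toAlgebra
  have : Algebra.Smooth Γ(X, U) Γ(diagNhd π, nhd π U) := hs
  let δ : Γ(diagNhd π, nhd π U) →ₐ[Γ(X, U)] Γ(X, U) :=
    { diagHom π U with commutes' := diagHom_projHom₁ π U }
  obtain ⟨h3, h4⟩ : Module.Projective Γ(X, U) (Γ(diagNhd π, nhd π U) ⧸ a) ∧
    Module.Finite Γ(X, U) (Γ(diagNhd π, nhd π U) ⧸ a) := projective_quotient_pow δ k
  obtain ⟨e⟩ := nonempty_equiv_finsupp b (pullback_proj₂ h hE).2 a (toParts π E k U) h1 h2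
    (partsRes π k E U) (partsRes_bijective π k E U)
  obtain ⟨f, hf, hf'⟩ := exists_free_localizedModule (A := Γ(diagNhd π, nhd π U) ⧸ a)
    (h.1.primeIdealOf ⟨x, hx⟩)
  have h5 := isQCAt_iff_isLocalAt.mp (isQCAt_principalParts h hE k) f
  obtain ⟨h6, h7⟩ := h5.free_and_finite (h.1.isLocalization_basicOpen f) e
  refine ⟨f, ?_, h6, fun _ => h7 inferInstance h4⟩
  have h8 : h.1.primeIdealOf ⟨x, hx⟩ ∈ h.1.fromSpec ⁻¹ᵁ X.basicOpen f := by
    rw [h.1.fromSpec_preimage_basicOpen]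
    exact hf
  have h9 : h.1.fromSpec (h.1.primeIdealOf ⟨x, hx⟩) ∈ X.basicOpen f := h8
  rwa [h.1.fromSpec_primeIdealOf] at h9

end FreeParts

/-! ### Free modules on spectra -/

noncomputable section SpecModules

/-- The free sheaf of modules with basis `I`. -/
def freeModule (X : Scheme.{u}) (I : Type u) : X.Modules :=
  SheafOfModules.free (R := X.ringCatSheaf) I

variable {R : CommRingCat.{u}} {I : Type u}

variable (R I) in
/-- The free module on the spectrum of `R` is associated to the free `R`-module. -/
def tildeFree : (tilde.functor R).obj (ModuleCat.of R (I →₀ R)) ≅ freeModule (Spec R) I :=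
  tildeFinsupp I

variable (Z : (Spec R).Modules) [h : IsIso Z.fromTildeΓ]

/-- A quasi-coherent module on a spectrum is associated to the module of its global sections. -/
def tildeΓIso : (tilde.functor R).obj (moduleSpecΓFunctor.obj Z) ≅ Z :=
  @asIso _ _ _ _ Z.fromTildeΓ h

/-- A morphism from a free module to a quasi-coherent module on the spectrum of a ring is given by
a linear map. -/
lemma exists_tilde_map_eq (g : freeModule (Spec R) I ⟶ Z) :
    ∃ h : ModuleCat.of R (I →₀ R) ⟶ moduleSpecΓFunctor.obj Z,
      (tilde.functor R).map h = (tildeFree R I).hom ≫ g ≫ (tildeΓIso Z).inv :=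
  (tilde.functor R).map_surjective _

lemma free_of_isIso (g : freeModule (Spec R) I ⟶ Z) [IsIso g] :
    Module.Free R (moduleSpecΓFunctor.obj Z) := by
  obtain ⟨h, hh⟩ := exists_tilde_map_eq Z g
  have h1 : IsIso ((tilde.functor R).map h) := by
    rw [hh]
    infer_instance
  have : IsIso h := isIso_of_reflects_iso h (tilde.functor R)
  exact .of_equiv (asIso h).toLinearEquiv

lemma finite_of_epi [Finite I] (g : freeModule (Spec R) I ⟶ Z) [Epi g] :
    Module.Finite R (moduleSpecΓFunctor.obj Z) := by
  obtain ⟨h, hh⟩ := exists_tilde_map_eq Z g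
  have h1 : Epi ((tilde.functor R).map h) := by
    rw [hh]
    infer_instance
  have : Epi h := (tilde.functor R).epi_of_epi_map h1
  exact .of_surjective h.hom ((ModuleCat.epi_iff_surjective h).mp this)

lemma nonempty_free_iso (b : Module.Basis I R (moduleSpecΓFunctor.obj Z)) :
    Nonempty (freeModule (Spec R) I ≅ Z) :=
  ⟨(tildeFree R I).symm ≪≫ (tilde.functor R).mapIso
    (LinearEquiv.toModuleIso (X₂ := moduleSpecΓFunctor.obj Z) b.repr.symm) ≪≫ tildeΓIso Z⟩

end SpecModules

section Sections

variable {X : Scheme.{u}} {U : X.Opens} (hU : IsAffineOpen U) (M : X.Modules)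

/-- Sections over an affine open set are the global sections of the restriction to the spectrum. -/
noncomputable def secEquiv :
    Sec (toPre M) U ≃ₗ[Γ(X, U)] moduleSpecΓFunctor.obj (M.restrict hU.fromSpec) where
  toFun s := secRes (toPre M) (fromSpec_image_top hU).le s
  invFun s := secRes (toPre M) (fromSpec_image_top hU).ge
    (show Sec (toPre M) (hU.fromSpec ''ᵁ ⊤) from s)
  map_add' := map_add (secRes (toPre M) (fromSpec_image_top hU).le)
  map_smul' r s := (secRes_smul _ _ _ _).trans (smul_restrict_fromSpec hU M ⊤ r
    (secRes (toPre M) (fromSpec_image_top hU).le s)).symm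
  left_inv _ := (secRes_secRes _ _ _).trans (secRes_self _ _)
  right_inv s := (secRes_secRes _ _ (show Sec (toPre M) (hU.fromSpec ''ᵁ ⊤) from s)).trans
    (secRes_self _ _)

end Sections

noncomputable section Localization

variable {X : Scheme.{u}} {U W : X.Opens} (hU : IsAffineOpen U)

/-- The morphism from the spectrum of the functions on `U` to a larger open set `W`. -/
def fromSpecOfLE (h : U ≤ W) : Spec Γ(X, U) ⟶ W := hU.isoSpec.inv ≫ X.homOfLE h

instance (h : U ≤ W) : IsOpenImmersion (fromSpecOfLE hU h) := by
  unfold fromSpecOfLE; infer_instance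

lemma fromSpecOfLE_ι (h : U ≤ W) : fromSpecOfLE hU h ≫ W.ι = hU.fromSpec := by
  rw [fromSpecOfLE, Category.assoc, X.homOfLE_ι]
  rfl

/-- Restriction of modules from `W` to an affine open subset. -/
def overToSpec (h : U ≤ W) :
    SheafOfModules (X.ringCatSheaf.over W) ⥤ SheafOfModules (Spec Γ(X, U)).ringCatSheaf :=
  (Scheme.Modules.overEquiv W).functor ⋙ Scheme.Modules.restrictFunctor (fromSpecOfLE hU h)

/-- Restriction from `X` to `W` and then to the spectrum is restriction along `Spec Γ(X, U) ⟶ X`. -/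
def overToSpecIso (h : U ≤ W) : SheafOfModules.overFunctor X.ringCatSheaf W ⋙ overToSpec hU h ≅
    Scheme.Modules.restrictFunctor hU.fromSpec :=
  (Functor.associator _ _ _).symm ≪≫
    Functor.isoWhiskerRight (Scheme.Modules.overFunctorEquiv W) _ ≪≫
    (Scheme.Modules.restrictFunctorComp _ _).symm ≪≫
    Scheme.Modules.restrictFunctorCongr (fromSpecOfLE_ι hU h)

instance (h : U ≤ W) : PreservesColimitsOfSize.{u, u} (overToSpec hU h) := by
  have h1 : PreservesColimitsOfSize.{u, u}
    (Scheme.Modules.restrictFunctor (fromSpecOfLE hU h)) := inferInstance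
  have h2 : PreservesColimitsOfSize.{u, u} (Scheme.Modules.overEquiv W).functor := inferInstance
  exact @comp_preservesColimits _ _ _ _ _ _ _ _ h2 h1

/-- Restriction of modules takes the structure sheaf to the structure sheaf. -/
def overToSpecUnit (h : U ≤ W) : SheafOfModules.unit (Spec Γ(X, U)).ringCatSheaf ≅
    (overToSpec hU h).obj (SheafOfModules.unit (X.ringCatSheaf.over W)) :=
  (Scheme.Modules.restrictUnitIso (fromSpecOfLE hU h)).symm

/-- Generating sections over `W` restrict to generating sections over an affine open subset, and a
basis restricts to a basis. -/
lemma exists_free_hom_restrict (h : U ≤ W) (M : X.Modules)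
    (σ : (SheafOfModules.over M W).GeneratingSections) :
    ∃ g : freeModule (Spec Γ(X, U)) σ.I ⟶ M.restrict hU.fromSpec,
      Epi g ∧ (IsIso σ.π → IsIso g) := by
  let N : SheafOfModules (Spec Γ(X, U)).ringCatSheaf := M.restrict hU.fromSpec
  let e : (overToSpec hU h).obj (SheafOfModules.over M W) ≅ N := (overToSpecIso hU h).app M
  let g : SheafOfModules.free σ.I ⟶ N :=
    (SheafOfModules.mapFreeIso (overToSpec hU h) σ.I (overToSpecUnit hU h)).hom ≫
      (overToSpec hU h).map σ.π ≫ e.hom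
  have : PreservesColimitsOfSize.{0, 0} (overToSpec hU h) := preservesColimitsOfSize_shrink _
  have h1 : Epi ((overToSpec hU h).map σ.π) := inferInstance
  have hg : Epi g := by
    have h2 : Epi ((overToSpec hU h).map σ.π ≫ e.hom) := epi_comp _ _
    exact epi_comp _ _
  have hg' (hσ : IsIso σ.π) : IsIso g := by
    have h2 : IsIso ((overToSpec hU h).map σ.π ≫ e.hom) := IsIso.comp_isIso
    exact IsIso.comp_isIso
  exact ⟨g, hg, hg'⟩

end Localization

/-! ### Locally free modules and modules of sections -/

noncomputable section LocallyFree

variable {X : Scheme.{u}} {U : X.Opens} (M : X.Modules)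

lemma isEquivalence_restrictFunctor {X Y : Scheme.{u}} (f : X ⟶ Y) [IsIso f] :
    (Scheme.Modules.restrictFunctor f).IsEquivalence := by
  let e1 : 𝟭 Y.Modules ≅
      Scheme.Modules.restrictFunctor f ⋙ Scheme.Modules.restrictFunctor (inv f) :=
    Scheme.Modules.restrictFunctorId.symm ≪≫
      Scheme.Modules.restrictFunctorCongr (IsIso.inv_hom_id f).symm ≪≫
      Scheme.Modules.restrictFunctorComp _ _
  let e2 : Scheme.Modules.restrictFunctor (inv f) ⋙ Scheme.Modules.restrictFunctor f ≅
      𝟭 X.Modules :=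
    (Scheme.Modules.restrictFunctorComp _ _).symm ≪≫
      Scheme.Modules.restrictFunctorCongr (IsIso.hom_inv_id f) ≪≫
      Scheme.Modules.restrictFunctorId
  exact (CategoryTheory.Equivalence.mk _ _ e1 e2).isEquivalence_functor

lemma isEquivalence_overToSpec (hU : IsAffineOpen U) :
    (overToSpec hU (le_refl U)).IsEquivalence := by
  have h1 : IsIso (fromSpecOfLE hU (le_refl U)) := by
    rw [fromSpecOfLE, Scheme.homOfLE_rfl]
    infer_instance
  have h2 := isEquivalence_restrictFunctor (fromSpecOfLE hU (le_refl U))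
  exact Functor.isEquivalence_trans (Scheme.Modules.overEquiv U).functor
    (Scheme.Modules.restrictFunctor (fromSpecOfLE hU (le_refl U)))

/-- A quasi-coherent module with free sections over an affine open set is free there. -/
lemma nonempty_free_iso_over (hU : IsAffineOpen U) (hM : IsQCAt (toPre M) U) {I : Type u}
    (b : Module.Basis I Γ(X, U) (Sec (toPre M) U)) :
    Nonempty (SheafOfModules.free I ≅ SheafOfModules.over M U) := by
  have := (isQCAt_iff_isIso_fromTildeΓ hU M).mp hM
  obtain ⟨e⟩ := nonempty_free_iso (M.restrict hU.fromSpec) (b.map (secEquiv hU M))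
  let N : SheafOfModules (Spec Γ(X, U)).ringCatSheaf := M.restrict hU.fromSpec
  let e' : SheafOfModules.free I ≅ N := e
  let F := overToSpec hU (le_refl U)
  let i : F.obj (SheafOfModules.over M U) ≅ N := (overToSpecIso hU (le_refl U)).app M
  have := isEquivalence_overToSpec hU
  exact ⟨F.preimageIso ((SheafOfModules.mapFreeIso F I (overToSpecUnit hU (le_refl U))).symm ≪≫
    e' ≪≫ i.symm)⟩

/-- The generating sections given by an isomorphism with a free module. -/
def generatorsOfIso {U : X.Opens} {I : Type u}
    (e : SheafOfModules.free I ≅ SheafOfModules.over M U) :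
    (SheafOfModules.over M U).GeneratingSections where
  I := I
  s := SheafOfModules.freeHomEquiv _ e.hom
  epi := by rw [Equiv.symm_apply_apply]; infer_instance

lemma isIso_generatorsOfIso {U : X.Opens} {I : Type u}
    (e : SheafOfModules.free I ≅ SheafOfModules.over M U) : IsIso (generatorsOfIso M e).π := by
  have h : (generatorsOfIso M e).π = e.hom := Equiv.symm_apply_apply _ _
  rw [h]
  exact e.isIso_hom

/-- Generating sections on neighborhoods `U x` of all points `x`, as local generators of `M`. -/
def localGenerators (U : X → X.Opens) (hU : ∀ x, x ∈ U x)
    (σ : ∀ x, (SheafOfModules.over M (U x)).GeneratingSections) :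
    SheafOfModules.LocalGeneratorsData.{u} M where
  I := X
  X := U
  coversTop := by
    rw [Opens.coversTop_iff]
    exact eq_top_iff.mpr fun x _ => TopologicalSpace.Opens.mem_iSup.mpr ⟨x, hU x⟩
  generators := σ

/-- A module is locally free if it is quasi-coherent with free sections on the members of an affine
open cover. -/
theorem isLocallyFree_of_cover (h : ∀ x : X, ∃ U : X.Opens, x ∈ U ∧ IsAffineOpen U ∧
      IsQCAt (toPre M) U ∧ Module.Free Γ(X, U) (Sec (toPre M) U)) : M.IsLocallyFree := by
  choose U hx hU hM hf using h
  have h1 (x : X) : ∃ σ : (SheafOfModules.over M (U x)).GeneratingSections, IsIso σ.π :=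
    ⟨_, isIso_generatorsOfIso M (nonempty_free_iso_over M (hU x) (hM x)
      (Module.Free.chooseBasis Γ(X, U x) (Sec (toPre M) (U x)))).some⟩
  choose σ hσ using h1
  have h2 : (localGenerators M U hx σ).IsLocallyFreeData := { isIso := fun x => hσ x }
  exact (localGenerators M U hx σ).isLocallyFree

theorem isFiniteType_of_cover (h : ∀ x : X, ∃ U : X.Opens, x ∈ U ∧ IsAffineOpen U ∧
      IsQCAt (toPre M) U ∧ Module.Free Γ(X, U) (Sec (toPre M) U) ∧
      Module.Finite Γ(X, U) (Sec (toPre M) U)) : M.IsFiniteType := by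
  choose U hx hU hM hf hfin using h
  have h1 (x : X) : ∃ σ : (SheafOfModules.over M (U x)).GeneratingSections, σ.IsFiniteType :=
    ⟨generatorsOfIso M (nonempty_free_iso_over M (hU x) (hM x)
      (Module.Free.chooseBasis Γ(X, U x) (Sec (toPre M) (U x)))).some,
      { finite := Finite.of_fintype
          (Module.Free.ChooseBasisIndex Γ(X, U x) (Sec (toPre M) (U x))) }⟩
  choose σ hσ using h1
  have h2 : (localGenerators M U hx σ).IsFiniteType := { isFiniteType := fun x => hσ x }
  exact SheafOfModules.IsFiniteType.mk (M := M) ⟨localGenerators M U hx σ, h2⟩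

/-- A quasi-coherent module that is locally free has free modules of sections over all sufficiently
small affine open sets. -/
lemma exists_mem_forall_free [M.IsLocallyFree] (hM : ∀ U, IsAffineOpen U → IsQCAt (toPre M) U)
    (x : X) : ∃ W : X.Opens, x ∈ W ∧ ∀ U ≤ W, IsAffineOpen U →
      Module.Free Γ(X, U) (Sec (toPre M) U) := by
  obtain ⟨q, hq⟩ := SheafOfModules.IsLocallyFree.exists_isLocallyFreeData (M := M)
  have hcov := q.coversTop
  rw [Opens.coversTop_iff] at hcov
  obtain ⟨i, hi⟩ := hcov.exists_mem x
  refine ⟨q.X i, hi, fun U h hU => ?_⟩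
  obtain ⟨g, -, hg⟩ := exists_free_hom_restrict hU h M (q.generators i)
  have := hg (hq.isIso i)
  have := (isQCAt_iff_isIso_fromTildeΓ hU M).mp (hM U hU)
  have := free_of_isIso (M.restrict hU.fromSpec) g
  exact .of_equiv (secEquiv hU M).symm

/-- A quasi-coherent module of finite type has finitely generated modules of sections over all
sufficiently small affine open sets. -/
lemma exists_mem_forall_finite [M.IsFiniteType] (hM : ∀ U, IsAffineOpen U → IsQCAt (toPre M) U)
    (x : X) : ∃ W : X.Opens, x ∈ W ∧ ∀ U ≤ W, IsAffineOpen U →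
      Module.Finite Γ(X, U) (Sec (toPre M) U) := by
  obtain ⟨q, hq⟩ := SheafOfModules.IsFiniteType.exists_localGeneratorsData M
  have hcov := q.coversTop
  rw [Opens.coversTop_iff] at hcov
  obtain ⟨i, hi⟩ := hcov.exists_mem x
  refine ⟨q.X i, hi, fun U h hU => ?_⟩
  obtain ⟨g, hg, -⟩ := exists_free_hom_restrict hU h M (q.generators i)
  have := hq.isFiniteType i
  have := (isQCAt_iff_isIso_fromTildeΓ hU M).mp (hM U hU)
  have := finite_of_epi (M.restrict hU.fromSpec) g
  exact .equiv (secEquiv hU M).symm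

end LocallyFree

end PrincipalParts

theorem mainTheorem4 {X S : Scheme.{u}} (π : X ⟶ S) [Smooth π] (E : X.Modules)
    [E.IsQuasicoherent] :
    (∀ k : ℕ,
      ∃ (φ : PrincipalParts.tensor E
            (PrincipalParts.symPow (PrincipalParts.relDifferentials π) (k + 1)) ⟶
          PrincipalParts.principalParts π (k + 1) E)
        (w : φ ≫ PrincipalParts.truncation π k E = 0),
        PrincipalParts.IsCanonical π φ ∧
        (ShortComplex.mk φ (PrincipalParts.truncation π k E) w).Exact ∧
        Epi (PrincipalParts.truncation π k E) ∧
        (E.IsLocallyFree → Mono φ)) ∧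
    (E.IsLocallyFree → ∀ k : ℕ, (PrincipalParts.principalParts π k E).IsLocallyFree ∧
      (E.IsFiniteType → (PrincipalParts.principalParts π k E).IsFiniteType)) := by
  have hE (U : X.Opens) (hU : IsAffineOpen U) :
      PrincipalParts.IsQCAt (PrincipalParts.toPre E) U :=
    PrincipalParts.isQCAt_of_isQuasicoherent hU E
  have hbasis (U : X.Opens) (x : X) (hx : x ∈ U) :
      ∃ V, PrincipalParts.IsSmall π V ∧ x ∈ V ∧ V ≤ U :=
    PrincipalParts.exists_isSmall_mem_le π hx
  refine ⟨fun k => ?_, fun hfree k => ⟨?_, fun hfin => ?_⟩⟩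
  · obtain ⟨φ, hφ, h⟩ := PrincipalParts.exists_canonicalMap (π := π) hE k
    obtain ⟨w, hw⟩ := PrincipalParts.exact_of_basis hbasis φ (PrincipalParts.truncation π k E)
      fun U hU => (h U hU).2
    exact ⟨φ, w, hφ, hw, PrincipalParts.epi_of_basis hbasis _ fun U hU =>
      PrincipalParts.truncation_surjective_of_isSmall hU (hE U hU.1) k,
      fun _ => PrincipalParts.mono_of_basis hbasis φ fun U hU => (h U hU).1⟩
  · refine PrincipalParts.isLocallyFree_of_cover _ fun x => ?_
    obtain ⟨W, hxW, hW⟩ := PrincipalParts.exists_mem_forall_free E hE x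
    obtain ⟨U, hU, hxU, hle⟩ := hbasis W x hxW
    have := hW U hle hU.1
    obtain ⟨f, hxf, h, -⟩ := PrincipalParts.exists_free_principalParts hU (hE U hU.1) k hxU
    exact ⟨_, hxf, hU.1.basicOpen f,
      PrincipalParts.isQCAt_principalParts (hU.basicOpen f) (hE _ (hU.1.basicOpen f)) k, h⟩
  · refine PrincipalParts.isFiniteType_of_cover _ fun x => ?_
    obtain ⟨W, hxW, hW⟩ := PrincipalParts.exists_mem_forall_free E hE x
    obtain ⟨W', hxW', hW'⟩ := PrincipalParts.exists_mem_forall_finite E hE x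
    obtain ⟨U, hU, hxU, hle⟩ := hbasis (W ⊓ W') x ⟨hxW, hxW'⟩
    have := hW U (hle.trans inf_le_left) hU.1
    obtain ⟨f, hxf, h, h'⟩ := PrincipalParts.exists_free_principalParts hU (hE U hU.1) k hxU
    exact ⟨_, hxf, hU.1.basicOpen f,
      PrincipalParts.isQCAt_principalParts (hU.basicOpen f) (hE _ (hU.1.basicOpen f)) k, h,
      h' (hW' U (hle.trans inf_le_right) hU.1)⟩
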